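/- **Setting.** Fix qubits $\mathbf Q=\{0,\dots,N-1\}$. Programs are $C::=\mathtt{skip}\mid C;C'\mid U(i)\mid \mathtt{T}(i)\mid \mathtt{CX}(i,j)\ (i\ne j)\mid \mathtt{if}\ i\ \mathtt{then}\ C\ \mathtt{else}\ C'\mid \mathtt{while}\ i\ \mathtt{do}\ C$ with $U\in\{X,Y,Z,H,S\}$. Their concrete semantics on partial density matrices $\rho$ (positive semidefinite, trace $\le 1$) is: $\mathtt{skip}$ is the identity, $;$ is composition, a gate $V$ acts as $\rho\mapsto V\rho V^\dagger$, and with $\Pi_b=|b\rangle\langle b|_i$, $[\![\mathtt{if}]\!](\rho)=[\![C]\!](\Pi_0\rho\Pi_0)+[\![C']\!](\Pi_1\rho\Pi_1)$, $[\![\mathtt{while}]\!](\rho)=\sum_{n\ge 0}\Pi_1 f^n(\rho)\Pi_1$, $f(\rho)=[\![C]\!](\Pi_0\rho\Pi_0)$. **Extended domain.** An array on a nonempty segment $A\subseteq\mathbf Q$ has between $1$ and $|A|$ rows in $\{I,X,Y,Z,\heartsuit\}^A$. Rows are multiplied entrywise up to phase, $\heartsuit$ being absorbing; two arrays are identified if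 each can be converted into the other by permuting rows and multiplying a row by another row. A row without $\heartsuit$ is an L-row, any other row a $\heartsuit$-row; "has the row $R$" means that some representative has it. $P_j$ is the row with $P$ in column $j$ and $I$ elsewhere, and $\langle P\rangle$ the one-row array on $\{j\}$ with entry $P$. $\mathcal E_A$ consists of a symbol $\blacksquare$, a symbol $\mathrm I$ if $|A|=1$, and the arrays on $A$ whose L-rows are independent and such that any two rows commute after a suitable substitution of $I,X,Y,Z$ for their $\heartsuit$'s (so L-rows commute); if $|A|\ge2$, an array may have neither the row $I\cdots I$ nor a row $P_j$, $P\in\{X,Y,Z,\heartsuit\}$. An extended assignment $\gamma$ is a partition of $\mathbf Q$ with an element of $\mathcal E_A$ for every segment $A$; $\gamma_0(i)$ is the segment of $i$ and $\gamma_1(i)$ its element. An array is a *full stabilizer* on $A$ if it consists of $|A|$ commuting independent L-rows. **Satisfaction.** $\gamma\vDash\rho$ means: (a) $\rho=\sum_k p_k\bigotimes_A\rho^{k,A}$, a finite sum with $p_k\ge0$, $\sum_k p_k\le 1$, $A$ ranging over the segments and $\rho^{k,A}$ density matrices on $A$; (b) $P^+_L\rho P^-_L=0$ for every L-row $L$ of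 every array $\gamma_1(i)$, where $P_L^\pm=\frac12(1\pm L)$ on all qubits; (c) if $\gamma_1(i)=\mathrm I$, then $\rho=\frac12 I_i\otimes\rho'$ for a partial density matrix $\rho'$ on $\mathbf Q\setminus\{i\}$. **Approximate join.** The normal form of an array deletes its $\heartsuit$-rows; an array without rows is $\blacksquare$; $\blacksquare$ and $\mathrm I$ are their own normal forms. $\biguplus_n\gamma_n$ is obtained by replacing each $\gamma_n$ by its normal form $\gamma_n'$, taking the join $\pi$ of the partitions, and giving $B\in\pi$ the join over $n$ of the elements $\bigodot_{j\in B}\gamma'_n(j)$, in the order in which $\mathrm I$ is least, $\blacksquare$ greatest and all other elements are incomparable. Here $\bigodot_{j\in B}\gamma'(j)$ is the element of $B$ if $B$ is a segment of $\gamma'$; otherwise $\mathrm I$ if all $\gamma'_1(j)$, $j\in B$, are $\mathrm I$; otherwise $\blacksquare$. **Abstract semantics.** Earlier conditions have priority, signs are ignored, empty segments are dropped. * $\mathtt{skip}$: $\gamma$. $C;C'$: composition. $U(i)$: $\gamma_1(i)$ is conjugated by $U_i$ ($\heartsuit,\mathrm I,\blacksquare$ are fixed). * $\mathtt T(i)$: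 $\gamma$ if $\gamma_1(i)\in\{\mathrm I,\blacksquare\}$ or $\gamma_1(i)$ has a representative without $X,Y$ in column $i$. Otherwise take a representative in which at most one L-row has $X$ or $Y$ in column $i$, and turn every $X$ and $Y$ in column $i$ into $\heartsuit$. * $\mathtt{CX}(i,j)$: rows are conjugated by $\mathrm{CX}$, both entries $i,j$ becoming $\heartsuit$ if one of them is; $\mathrm{CX}\blacksquare\,\mathrm{CX}^\dagger=\blacksquare$. If $\gamma_0(i)=\gamma_0(j)=A$, replace the segment by $update_E(\{i,j\},A,\mathrm{CX}\,\gamma_1(i)\,\mathrm{CX}^\dagger)$. Else $\gamma$ if $\gamma_1(i)=\langle Z\rangle$, $\gamma_1(j)=\langle X\rangle$ or $\gamma_1(i)=\gamma_1(j)=\mathrm I$. Else, if $\gamma_1(i)=\mathrm I$, set $\gamma_1(i):=\langle Z\rangle$. Else, if $\gamma_1(j)=\mathrm I$, set $\gamma_1(j):=\langle X\rangle$. Else merge the two segments, with element $\mathrm{CX}(\gamma_1(i)\otimes\gamma_1(j))\mathrm{CX}^\dagger$ (direct sum of arrays, $\blacksquare$ absorbing). * $\mathtt{if}$: $[\![C]\!]_E(meas_{E,i}(\gamma))\uplus[\![C']\!]_E(meas_{E,i}(\gamma))$.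 $\mathtt{while}$: $\biguplus_{n\in\mathbb N}meas_{E,i}\big(([\![C]\!]_E\circ meas_{E,i})^n(\gamma)\big)$. $update(J,A,E)$, for a full stabilizer $E$: let $D$ be the set of $j\in J$ such that $E$ has a row $P^{(j)}_j$ with $P^{(j)}\in\{X,Y,Z\}$; write $E=\bigotimes_{j\in D}\langle P^{(j)}\rangle\otimes S''$; the result is $\{(\{j\},\langle P^{(j)}\rangle)\mid j\in D\}\cup\{(A\setminus D,S'')\}$. $update_E(J,A,E)$ is $\{(A,\blacksquare)\}$ if $E=\blacksquare$ and $update(J,A,E)$ if $E$ is a full stabilizer; otherwise, with $D$ as before, it is $\{(A,E)\}$ if $D=\emptyset$ and $\{(\{j\},\langle P^{(j)}\rangle)\mid j\in D\}\cup\{(A\setminus D,\blacksquare)\}$ if not. $meas_{E,i}(\gamma)$ replaces the segment $A=\gamma_0(i)$ with element $E=\gamma_1(i)$ as follows. (1) If $|A|=1$: by $(\{i\},\langle Z\rangle)$. (2) If $E$ is a full stabilizer: by $update(A,A,E')$, where $E'$ arises from a representative of $E$ with exactly one row having $X$ or $Y$ in column $i$ by replacing that row by $Z_i$ ($E'=E$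 if there is none). (3) If $E$ is another array having a representative with exactly one row having $X$ or $Y$ in column $i$ and all others having $I$ or $Z$ there: delete that row and column $i$ to get $E'$, and use $\{(\{i\},\langle Z\rangle)\}\cup update_E(A\setminus\{i\},A\setminus\{i\},E')$. (4) Otherwise: by $\{(\{i\},\langle Z\rangle),(A\setminus\{i\},\blacksquare)\}$. **Theorem.** However the representatives in these clauses are chosen, for every partial density matrix $\rho$, every extended assignment $\gamma$ and every program $C$: if $\gamma\vDash\rho$, then $[\![C]\!]_E(\gamma)\vDash[\![C]\!](\rho)$. -/

import Mathlib

noncomputable section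

namespace ExtStab

open scoped ComplexOrder
open Matrix

/-! ## States and programs -/

/-- Operators on the qubits indexed by `V`, in the computational basis `V → {0,1}`. -/
abbrev Op (V : Type) : Type := Matrix (V → Fin 2) (V → Fin 2) ℂ

/-- Density matrices. -/
def IsDensity {V : Type} [Fintype V] [DecidableEq V] (ρ : Op V) : Prop :=
  ρ.PosSemidef ∧ ρ.trace = 1

/-- Partial density matrices (trace at most one). -/
def IsPartialDensity {V : Type} [Fintype V] [DecidableEq V] (ρ : Op V) : Prop :=
  ρ.PosSemidef ∧ ρ.trace.re ≤ 1

/-- The one-qubit gates other than `T`. -/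
inductive Clifford1 : Type
  | X | Y | Z | H | S

def Clifford1.mat : Clifford1 → Matrix (Fin 2) (Fin 2) ℂ
  | .X => !![0, 1; 1, 0]
  | .Y => !![0, -Complex.I; Complex.I, 0]
  | .Z => !![1, 0; 0, -1]
  | .H => ((Real.sqrt 2 : ℝ) : ℂ)⁻¹ • !![1, 1; 1, -1]
  | .S => !![1, 0; 0, Complex.I]

def matT : Matrix (Fin 2) (Fin 2) ℂ :=
  !![1, 0; 0, Complex.exp (Complex.I * (Real.pi / 4 : ℝ))]

/-- The projection `|b⟩⟨b|` of one qubit. -/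
def ketbra (b : Fin 2) : Matrix (Fin 2) (Fin 2) ℂ :=
  Matrix.of fun a c => if a = b ∧ c = b then 1 else 0

/-- The one-qubit operator `U` applied to qubit `i`, identity on the other qubits. -/
def appOn {N : ℕ} (U : Matrix (Fin 2) (Fin 2) ℂ) (i : Fin N) : Op (Fin N) :=
  Matrix.of fun s t => if ∀ j, j ≠ i → s j = t j then U (s i) (t i) else 0

/-- Controlled-X with control `i` and target `j`. -/
def cxOp {N : ℕ} (i j : Fin N) : Op (Fin N) :=
  Matrix.of fun s t => if s = Function.update t j (t j + t i) then 1 else 0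

/-- Syntax of the quantum imperative language on `N` qubits. -/
inductive QIL (N : ℕ) : Type
  | skip : QIL N
  | seq : QIL N → QIL N → QIL N
  | gate : Clifford1 → Fin N → QIL N
  | gateT : Fin N → QIL N
  | cx (i j : Fin N) (h : i ≠ j) : QIL N
  | ite : Fin N → QIL N → QIL N → QIL N
  | while : Fin N → QIL N → QIL N

/-- `ρ ↦ |b⟩⟨b|ᵢ ρ |b⟩⟨b|ᵢ`. -/
def project {N : ℕ} (b : Fin 2) (i : Fin N) (ρ : Op (Fin N)) : Op (Fin N) :=
  appOn (ketbra b) i * ρ * appOn (ketbra b) i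

/-- The concrete semantics. On positive semidefinite `ρ` the series for `while` converges: its terms
are positive semidefinite and their traces add up to at most the trace of `ρ`. -/
def QIL.sem {N : ℕ} : QIL N → Op (Fin N) → Op (Fin N)
  | .skip, ρ => ρ
  | .seq C C', ρ => C'.sem (C.sem ρ)
  | .gate U i, ρ => appOn U.mat i * ρ * (appOn U.mat i)ᴴ
  | .gateT i, ρ => appOn matT i * ρ * (appOn matT i)ᴴ
  | .cx i j _, ρ => cxOp i j * ρ * (cxOp i j)ᴴ
  | .ite i C C', ρ => C.sem (project 0 i ρ) + C'.sem (project 1 i ρ)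
  | .while i C, ρ => ∑' n : ℕ, project 1 i ((fun σ => C.sem (project 0 i σ))^[n] ρ)

/-! ## Arrays with heart entries -/

/-- Entries of an array: the Pauli matrices and the symbol `♡`. -/
inductive Sym : Type
  | I | X | Y | Z | heart
  deriving DecidableEq

/-- Multiplication of entries, ignoring phases; `♡` is absorbing. -/
def Sym.mul : Sym → Sym → Sym
  | .heart, _ => .heart
  | _, .heart => .heart
  | .I, b => b
  | a, .I => a
  | .X, .X => .I
  | .Y, .Y => .I
  | .Z, .Z => .I
  | .X, .Y => .Z
  | .Y, .X => .Z
  | .Y, .Z => .X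
  | .Z, .Y => .X
  | .Z, .X => .Y
  | .X, .Z => .Y

instance : CommMonoid Sym where
  mul := Sym.mul
  one := .I
  mul_assoc := by intro a b c; cases a <;> cases b <;> cases c <;> rfl
  one_mul := by intro a; cases a <;> rfl
  mul_one := by intro a; cases a <;> rfl
  mul_comm := by intro a b; cases a <;> cases b <;> rfl

/-- The matrix of a Pauli entry (the value at `♡` is never used). -/
def Sym.mat : Sym → Matrix (Fin 2) (Fin 2) ℂ
  | .I => 1
  | .X => !![0, 1; 1, 0]
  | .Y => !![0, -Complex.I; Complex.I, 0]
  | .Z => !![1, 0; 0, -1]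
  | .heart => 0

/-- The entry is `X` or `Y`. -/
def Sym.Flips (a : Sym) : Prop := a = .X ∨ a = .Y

/-- A row, written on all `N` qubits: a row of an array on a segment `A` has the entry `I` in every
column outside `A`. -/
abbrev Row (N : ℕ) : Type := Fin N → Sym

/-- A row without `♡`. -/
def IsLRow {N : ℕ} (R : Row N) : Prop := ∀ i, R i ≠ .heart

/-- All non-identity entries of the row are in columns of `A`. -/
def SupportedOn {N : ℕ} (A : Finset (Fin N)) (R : Row N) : Prop := ∀ i, i ∉ A → R i = .I

/-- The row with entry `a` in column `j` and `I` elsewhere. -/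
def single {N : ℕ} (j : Fin N) (a : Sym) : Row N := Function.update (fun _ => Sym.I) j a

/-- The Pauli operator (tensor product of Pauli matrices) given by an L-row. -/
def rowOp {N : ℕ} (R : Row N) : Op (Fin N) :=
  Matrix.of fun s t => ∏ i, (R i).mat (s i) (t i)

/-- Projections onto the `+1` and `-1` eigenspaces of an L-row. -/
def projPlus {N : ℕ} (R : Row N) : Op (Fin N) := (1 / 2 : ℂ) • (1 + rowOp R)

def projMinus {N : ℕ} (R : Row N) : Op (Fin N) := (1 / 2 : ℂ) • (1 - rowOp R)

/-- `r` arises from `R` by substituting a Pauli matrix for every `♡`. -/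
def Fills {N : ℕ} (R r : Row N) : Prop := IsLRow r ∧ ∀ i, R i ≠ .heart → r i = R i

/-- Multiplication of one row of an array by another row. (Arrays are multisets of rows, which takes
care of the permutations of rows.) -/
inductive RowStep {N : ℕ} : Multiset (Row N) → Multiset (Row N) → Prop
  | mul (R S : Row N) (M : Multiset (Row N)) :
      RowStep (R ::ₘ S ::ₘ M) ((R * S) ::ₘ S ::ₘ M)

/-- One array can be converted into the other. -/
def Conv {N : ℕ} : Multiset (Row N) → Multiset (Row N) → Prop := Relation.ReflTransGen RowStep

/-- Two arrays are identified if they can be converted into one another. -/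
instance arraySetoid (N : ℕ) : Setoid (Multiset (Row N)) where
  r M M' := Conv M M' ∧ Conv M' M
  iseqv :=
    { refl := fun _ => ⟨.refl, .refl⟩
      symm := fun h => ⟨h.2, h.1⟩
      trans := fun h h' => ⟨h.1.trans h'.1, h'.2.trans h.2⟩ }

/-- Arrays up to identification. -/
abbrev Arr (N : ℕ) : Type := Quotient (arraySetoid N)

/-- Some representative of the array has the row `R`. -/
def HasRow {N : ℕ} (q : Arr N) (R : Row N) : Prop :=
  ∃ M : Multiset (Row N), (⟦R ::ₘ M⟧ : Arr N) = q

theorem Conv.map {N : ℕ} {f : Row N → Row N} (hf : ∀ R S, f (R * S) = f R * f S)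
    {M M' : Multiset (Row N)} (h : Conv M M') : Conv (M.map f) (M'.map f) := by
  induction h with
  | refl => exact .refl
  | tail _ h ih =>
    refine ih.tail ?_
    cases h with
    | mul R S M => simpa [hf] using RowStep.mul (f R) (f S) (M.map f)

theorem Conv.add_right {N : ℕ} {M M' : Multiset (Row N)} (K : Multiset (Row N)) (h : Conv M M') :
    Conv (M + K) (M' + K) := by
  induction h with
  | refl => exact .refl
  | tail _ h ih =>
    refine ih.tail ?_
    cases h with
    | mul R S M => simpa using RowStep.mul R S (M + K)

open scoped Classical in
theorem Conv.filter {N : ℕ} {M M' : Multiset (Row N)} (h : Conv M M') :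
    (M'.filter IsLRow).card < (M.filter IsLRow).card ∨
      ((M'.filter IsLRow).card = (M.filter IsLRow).card ∧
        Conv (M.filter IsLRow) (M'.filter IsLRow)) := by
  induction h with
  | refl => exact .inr ⟨rfl, .refl⟩
  | tail _ h ih =>
    have key : ∀ {K K' : Multiset (Row N)}, RowStep K K' →
        (K'.filter IsLRow).card < (K.filter IsLRow).card ∨
          ((K'.filter IsLRow).card = (K.filter IsLRow).card ∧
            Conv (K.filter IsLRow) (K'.filter IsLRow)) := by
      intro K K' hK
      cases hK with
      | mul R S M =>
        have hRS : IsLRow (R * S) ↔ IsLRow R ∧ IsLRow S := by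
          have h0 : ∀ a b : Sym, a * b ≠ .heart ↔ a ≠ .heart ∧ b ≠ .heart := by
            intro a b
            cases a <;> cases b <;> simp <;> decide
          simp only [IsLRow, Pi.mul_apply, h0, forall_and]
        by_cases hR : IsLRow R
        · by_cases hS : IsLRow S
          · right
            simp only [Multiset.filter_cons_of_pos _ hR, Multiset.filter_cons_of_pos _ hS,
              Multiset.filter_cons_of_pos _ (hRS.2 ⟨hR, hS⟩), Multiset.card_cons, true_and]
            exact .single (.mul _ _ _)
          · left
            have : ¬ IsLRow (R * S) := fun h => hS (hRS.1 h).2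
            simp [hR, hS, this]
        · right
          have : ¬ IsLRow (R * S) := fun h => hR (hRS.1 h).1
          by_cases hS : IsLRow S <;> simp [hR, hS, this] <;> exact .refl
    rcases key h with h1 | ⟨h1, h2⟩ <;> rcases ih with h3 | ⟨h3, h4⟩
    · left; omega
    · left; omega
    · left; omega
    · exact .inr ⟨h1.trans h3, h4.trans h2⟩

/-- Apply a multiplicative map to every row. -/
def Arr.map {N : ℕ} (f : Row N → Row N) (hf : ∀ R S, f (R * S) = f R * f S) (q : Arr N) : Arr N :=
  Quotient.map (Multiset.map f) (fun M M' (h : Conv M M' ∧ Conv M' M) =>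
    ⟨Conv.map hf h.1, Conv.map hf h.2⟩) q

/-- Direct sum of two arrays. -/
def Arr.add {N : ℕ} (q q' : Arr N) : Arr N :=
  Quotient.map₂ (· + ·) (fun M M' h K K' h' => by
    refine ⟨(Conv.add_right K h.1).trans ?_, (Conv.add_right K' h.2).trans ?_⟩
    · rw [add_comm M' K, add_comm M' K']; exact Conv.add_right M' h'.1
    · rw [add_comm M K, add_comm M K']; exact Conv.add_right M h'.2) q q'

/-- Elements of the extended domain: the symbol `■`, the one-qubit element `I` (maximally mixed),
and arrays. -/
inductive Ext (N : ℕ) : Type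
  | unknown : Ext N
  | mixed : Ext N
  | arr : Arr N → Ext N

/-- The element given by an array; an array without rows is `■`. -/
def Ext.ofRows {N : ℕ} (M : Multiset (Row N)) : Ext N :=
  if M.card = 0 then .unknown else .arr ⟦M⟧

/-- The one-qubit stabilizer `⟨a⟩` of qubit `j`. -/
def Ext.pauli {N : ℕ} (j : Fin N) (a : Sym) : Ext N := .arr ⟦{single j a}⟧

/-- Independence of L-rows: no nonempty product is the identity (up to phase). -/
def Independent {N : ℕ} (M : Multiset (Row N)) : Prop :=
  ∀ K ≤ M, K.prod = 1 → K = 0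

open scoped Classical in
/-- The requirements on an array on the segment `A`. It has at most `|A|` rows, since rows
may have been removed. The commutation clause covers L-rows, where nothing is substituted, and
`♡`-rows alike. -/
def WellFormed {N : ℕ} (A : Finset (Fin N)) (M : Multiset (Row N)) : Prop :=
  1 ≤ M.card ∧ M.card ≤ A.card ∧ (∀ R ∈ M, SupportedOn A R) ∧
    Independent (M.filter IsLRow) ∧
    ∀ R ∈ M, ∀ R' ∈ M, ∃ r r', Fills R r ∧ Fills R' r' ∧ Commute (rowOp r) (rowOp r')

/-- Membership in the extended domain of the segment `A`. -/
def Ext.Mem {N : ℕ} (A : Finset (Fin N)) : Ext N → Prop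
  | .unknown => True
  | .mixed => A.card = 1
  | .arr q => (∃ M : Multiset (Row N), ⟦M⟧ = q ∧ WellFormed A M) ∧
      (2 ≤ A.card → ∀ R, HasRow q R → R ≠ 1 ∧ ∀ j, ∀ a, R ≠ single j a)

/-- The array has no `♡` and is the full stabilizer of a state: `|A|` commuting independent rows. -/
def IsStabilizer {N : ℕ} (A : Finset (Fin N)) (q : Arr N) : Prop :=
  ∃ M : Multiset (Row N), ⟦M⟧ = q ∧ M.card = A.card ∧ (∀ R ∈ M, SupportedOn A R ∧ IsLRow R) ∧
    Independent M ∧ ∀ R ∈ M, ∀ R' ∈ M, Commute (rowOp R) (rowOp R')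

open scoped Classical in
/-- Normalisation: removal of all `♡`-rows. -/
def Ext.normal {N : ℕ} : Ext N → Ext N
  | .unknown => .unknown
  | .mixed => .mixed
  | .arr q => Quotient.lift (fun M => Ext.ofRows (M.filter IsLRow)) (fun M M' h => by
      have h1 := Conv.filter h.1
      have h2 := Conv.filter h.2
      have hc : (M'.filter IsLRow).card = (M.filter IsLRow).card := by
        rcases h1 with h1 | h1 <;> rcases h2 with h2 | h2 <;> omega
      have h3 : Conv (M.filter IsLRow) (M'.filter IsLRow) := by
        rcases h1 with h1 | h1
        · omega
        · exact h1.2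
      have h4 : Conv (M'.filter IsLRow) (M.filter IsLRow) := by
        rcases h2 with h2 | h2
        · omega
        · exact h2.2
      have h5 : (⟦M.filter IsLRow⟧ : Arr N) = ⟦M'.filter IsLRow⟧ := Quotient.sound ⟨h3, h4⟩
      simp only [Ext.ofRows, hc, h5]) q

/-! ## Extended assignments -/

/-- A partition of the qubits with an element of the extended domain for each segment, written as
the functions `γ₀` (`cell`) and `γ₁` (`val`) on qubits. -/
structure Assignment (N : ℕ) : Type where
  cell : Fin N → Finset (Fin N)
  val : Fin N → Ext N
  mem_cell : ∀ i, i ∈ cell i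
  cell_eq : ∀ i j, j ∈ cell i → cell j = cell i
  val_eq : ∀ i j, j ∈ cell i → val j = val i

/-- Extended stabilizer assignments. -/
def Assignment.IsExtended {N : ℕ} (γ : Assignment N) : Prop :=
  ∀ i, (γ.val i).Mem (γ.cell i)

/-- The segments of the partition. -/
def Assignment.segments {N : ℕ} (γ : Assignment N) : Finset (Finset (Fin N)) :=
  Finset.univ.image γ.cell

/-- `ρ = ∑ₖ pₖ ⨂_A ρ^{k,A}`, the tensor product running over the segments. The weights add up to the
trace of `ρ`, which is at most one. -/
def Assignment.Separable {N : ℕ} (γ : Assignment N) (ρ : Op (Fin N)) : Prop :=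
  ∃ (m : ℕ) (p : Fin m → ℝ) (τ : Fin m → (A : Finset (Fin N)) → Op A),
    (∀ k, 0 ≤ p k) ∧ ∑ k, p k ≤ 1 ∧
    (∀ k, ∀ A ∈ γ.segments, IsDensity (τ k A)) ∧
    ∀ s t, ρ s t =
      ∑ k, (p k : ℂ) * ∏ A ∈ γ.segments, τ k A (fun x : A => s x) (fun x : A => t x)

/-- The relation `γ ⊨ ρ`. -/
def Assignment.Models {N : ℕ} (γ : Assignment N) (ρ : Op (Fin N)) : Prop :=
  γ.Separable ρ ∧
  (∀ i q, γ.val i = .arr q → ∀ L, HasRow q L → IsLRow L →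
    projPlus L * ρ * projMinus L = 0) ∧
  (∀ i, γ.val i = .mixed → ∃ ρ' : Op {j : Fin N // j ≠ i}, IsPartialDensity ρ' ∧
    ∀ s t, ρ s t =
      (if s i = t i then (1 / 2 : ℂ) else 0) * ρ' (fun x => s x.1) (fun x => t x.1))

/-- `γ[E/i]`. -/
def Assignment.setVal {N : ℕ} (γ : Assignment N) (i : Fin N) (E : Ext N) : Assignment N where
  cell := γ.cell
  val k := if k ∈ γ.cell i then E else γ.val k
  mem_cell := γ.mem_cell
  cell_eq := γ.cell_eq
  val_eq k j h := by
    have h1 := γ.cell_eq k j h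
    have h2 : j ∈ γ.cell i ↔ k ∈ γ.cell i := by
      constructor <;> intro h3
      · rw [← γ.cell_eq i j h3, h1]; exact γ.mem_cell k
      · rw [← γ.cell_eq i k h3]; exact h
    simp only [h2, γ.val_eq k j h]

/-- `γ[E/i,j]`: the segments of `i` and `j` are merged. -/
def Assignment.merge {N : ℕ} (γ : Assignment N) (i j : Fin N) (E : Ext N) : Assignment N where
  cell k := if k ∈ γ.cell i ∪ γ.cell j then γ.cell i ∪ γ.cell j else γ.cell k
  val k := if k ∈ γ.cell i ∪ γ.cell j then E else γ.val k
  mem_cell k := by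
    by_cases h : k ∈ γ.cell i ∪ γ.cell j
    · rw [if_pos h]; exact h
    · rw [if_neg h]; exact γ.mem_cell k
  cell_eq k l h := by
    by_cases hk : k ∈ γ.cell i ∪ γ.cell j
    · rw [if_pos hk] at h ⊢; rw [if_pos h]
    · rw [if_neg hk] at h ⊢
      have hl : l ∉ γ.cell i ∪ γ.cell j := by
        intro hl
        apply hk
        have h1 := γ.cell_eq k l h
        rw [Finset.mem_union] at hl ⊢
        rcases hl with hl | hl
        · left; rw [← γ.cell_eq i l hl, h1]; exact γ.mem_cell k
        · right; rw [← γ.cell_eq j l hl, h1]; exact γ.mem_cell k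
      rw [if_neg hl]; exact γ.cell_eq k l h
  val_eq k l h := by
    by_cases hk : k ∈ γ.cell i ∪ γ.cell j
    · rw [if_pos hk] at h ⊢; rw [if_pos h]
    · rw [if_neg hk] at h ⊢
      have hl : l ∉ γ.cell i ∪ γ.cell j := by
        intro hl
        apply hk
        have h1 := γ.cell_eq k l h
        rw [Finset.mem_union] at hl ⊢
        rcases hl with hl | hl
        · left; rw [← γ.cell_eq i l hl, h1]; exact γ.mem_cell k
        · right; rw [← γ.cell_eq j l hl, h1]; exact γ.mem_cell k
      rw [if_neg hl]; exact γ.val_eq k l h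

/-- A way to cut up a segment `A`: every qubit `j` of `singles` becomes a segment of its own with
the element `basis j`, and the other qubits of `A`, if any, form a segment with the element
`rest`. -/
structure Pieces (N : ℕ) : Type where
  singles : Finset (Fin N)
  basis : Fin N → Ext N
  rest : Ext N

/-- The segment of `i` is replaced by the given pieces. -/
def Assignment.split {N : ℕ} (γ : Assignment N) (i : Fin N) (P : Pieces N) : Assignment N where
  cell k := if k ∈ γ.cell i then (if k ∈ P.singles then {k} else γ.cell i \ P.singles)
    else γ.cell k
  val k := if k ∈ γ.cell i then (if k ∈ P.singles then P.basis k else P.rest) else γ.val k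
  mem_cell k := by
    have := γ.mem_cell k
    split_ifs <;> simp_all
  cell_eq k l h := by
    by_cases hk : k ∈ γ.cell i
    · by_cases hs : k ∈ P.singles
      · simp only [hk, hs, if_true, Finset.mem_singleton] at h
        rw [h]
      · simp only [hk, hs, if_true, if_false, Finset.mem_sdiff] at h
        simp [hk, hs, h.1, h.2]
    · simp only [hk, if_false] at h
      have h1 := γ.cell_eq k l h
      have hl : l ∉ γ.cell i := by
        intro hl
        apply hk
        rw [← γ.cell_eq i l hl, h1]; exact γ.mem_cell k
      simp only [hk, hl, if_false, h1]
  val_eq k l h := by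
    by_cases hk : k ∈ γ.cell i
    · by_cases hs : k ∈ P.singles
      · simp only [hk, hs, if_true, Finset.mem_singleton] at h
        rw [h]
      · simp only [hk, hs, if_true, if_false, Finset.mem_sdiff] at h
        simp [hk, hs, h.1, h.2]
    · simp only [hk, if_false] at h
      have h1 := γ.cell_eq k l h
      have hl : l ∉ γ.cell i := by
        intro hl
        apply hk
        rw [← γ.cell_eq i l hl, h1]; exact γ.mem_cell k
      simp only [hk, hl, if_false, γ.val_eq k l h]

/-- The normal form of an assignment. -/
def Assignment.normal {N : ℕ} (γ : Assignment N) : Assignment N where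
  cell := γ.cell
  val i := (γ.val i).normal
  mem_cell := γ.mem_cell
  cell_eq := γ.cell_eq
  val_eq i j h := by rw [γ.val_eq i j h]

/-! ## The approximate join -/

/-- Two qubits lie in the same segment of the join of the partitions of a family. -/
def Linked {N : ℕ} {ι : Type} (f : ι → Assignment N) : Fin N → Fin N → Prop :=
  Relation.EqvGen fun i j => ∃ n, j ∈ (f n).cell i

open scoped Classical in
/-- `⨀_{j ∈ B} γ(j)`. If all qubits of `B` are in one segment, the chosen one is irrelevant. -/
def Assignment.combine {N : ℕ} (γ : Assignment N) (B : Finset (Fin N)) : Ext N :=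
  if h : ∃ i ∈ B, ∀ j ∈ B, γ.cell j = γ.cell i then γ.val h.choose
  else if ∀ j ∈ B, γ.val j = .mixed then .mixed
  else .unknown

open scoped Classical in
/-- Join in the order on normal forms in which `I` is least, `■` is greatest, and all other elements
are incomparable. -/
def Ext.join {N : ℕ} {ι : Type} (x : ι → Ext N) : Ext N :=
  if ∀ n, x n = .mixed then .mixed
  else if h : ∃ F, ∀ n, x n = .mixed ∨ x n = F then h.choose
  else .unknown

open scoped Classical in
/-- The segment of `i` in the join of the partitions of a family. -/
def joinCell {N : ℕ} {ι : Type} (f : ι → Assignment N) (i : Fin N) : Finset (Fin N) :=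
  Finset.univ.filter (Linked f i)

theorem joinCell_eq {N : ℕ} {ι : Type} (f : ι → Assignment N) (i j : Fin N)
    (h : j ∈ joinCell f i) : joinCell f j = joinCell f i := by
  have h' : Linked f i j := by simpa [joinCell] using h
  ext k
  simp only [joinCell, Finset.mem_filter, Finset.mem_univ, true_and]
  exact ⟨fun h2 => .trans _ _ _ h' h2, fun h2 => .trans _ _ _ (.symm _ _ h') h2⟩

/-- The join of a family of assignments in normal form. -/
def joinNormal {N : ℕ} {ι : Type} (f : ι → Assignment N) : Assignment N where
  cell := joinCell f
  val i := Ext.join fun n => (f n).combine (joinCell f i)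
  mem_cell i := by
    have h : Linked f i i := Relation.EqvGen.refl i
    simp only [joinCell, Finset.mem_filter, Finset.mem_univ, true_and, h]
  cell_eq := joinCell_eq f
  val_eq i j h := by rw [joinCell_eq f i j h]

/-- The approximate join `⨄ₙ fₙ`: the join of the normal forms. -/
def approxJoin {N : ℕ} {ι : Type} (f : ι → Assignment N) : Assignment N :=
  joinNormal fun n => (f n).normal

/-! ## Gates on arrays (signs are ignored) -/

/-- `U a U†` for an entry `a`, where `U ♡ U† = ♡`. -/
def Clifford1.conj : Clifford1 → Sym → Sym
  | .H, .X => .Z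
  | .H, .Z => .X
  | .S, .X => .Y
  | .S, .Y => .X
  | _, a => a

/-- `Uᵢ R Uᵢ†` for a row `R`. -/
def Clifford1.conjRow {N : ℕ} (U : Clifford1) (i : Fin N) (R : Row N) : Row N :=
  fun k => if k = i then U.conj (R k) else R k

theorem Clifford1.conjRow_mul {N : ℕ} (U : Clifford1) (i : Fin N) (R S : Row N) :
    U.conjRow i (R * S) = U.conjRow i R * U.conjRow i S := by
  have h : ∀ a b : Sym, U.conj (a * b) = U.conj a * U.conj b := by
    intro a b
    cases U <;> cases a <;> cases b <;> rfl
  funext k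
  by_cases hk : k = i <;> simp [conjRow, hk, h]

/-- The factor that controlled-X passes from the control to the target. -/
def Sym.toTarget : Sym → Sym
  | .X => .X
  | .Y => .X
  | .heart => .heart
  | _ => .I

/-- The factor that controlled-X passes from the target to the control. -/
def Sym.toControl : Sym → Sym
  | .Z => .Z
  | .Y => .Z
  | .heart => .heart
  | _ => .I

/-- `CX R CX†` with control `i` and target `j`. If one of the two entries is `♡`, both become
`♡`. -/
def cxRow {N : ℕ} (i j : Fin N) (R : Row N) : Row N :=
  fun k => if k = i then R i * (R j).toControl else if k = j then R j * (R i).toTarget else R k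

theorem cxRow_mul {N : ℕ} (i j : Fin N) (R S : Row N) :
    cxRow i j (R * S) = cxRow i j R * cxRow i j S := by
  have h1 : ∀ a b c d : Sym,
      a * b * (c * d).toControl = a * c.toControl * (b * d.toControl) := by
    intro a b c d
    cases a <;> cases b <;> cases c <;> cases d <;> rfl
  have h2 : ∀ a b c d : Sym,
      a * b * (c * d).toTarget = a * c.toTarget * (b * d.toTarget) := by
    intro a b c d
    cases a <;> cases b <;> cases c <;> cases d <;> rfl
  funext k
  simp only [cxRow, Pi.mul_apply]
  split_ifs
  · exact h1 _ _ _ _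
  · exact h2 _ _ _ _
  · rfl

/-- Column `i` is removed, that is, its entry becomes `I`. -/
def eraseCol {N : ℕ} (i : Fin N) (R : Row N) : Row N := Function.update R i .I

/-- `X` and `Y` in column `i` become `♡`. -/
def heartCol {N : ℕ} (i : Fin N) (R : Row N) : Row N :=
  fun k => if k = i ∧ (R k = .X ∨ R k = .Y) then .heart else R k

def Ext.conj {N : ℕ} (U : Clifford1) (i : Fin N) : Ext N → Ext N
  | .unknown => .unknown
  | .mixed => .mixed
  | .arr q => .arr (q.map (U.conjRow i) (U.conjRow_mul i))

def Ext.cx {N : ℕ} (i j : Fin N) : Ext N → Ext N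
  | .unknown => .unknown
  | .mixed => .mixed
  | .arr q => .arr (q.map (cxRow i j) (cxRow_mul i j))

/-- Tensor product, absorbing at `■` (it is never used at `I`). -/
def Ext.tensor {N : ℕ} : Ext N → Ext N → Ext N
  | .arr q, .arr q' => .arr (q.add q')
  | _, _ => .unknown

/-! ## Abstract semantics

Several clauses work with a suitably chosen representative of an array. The choice is made by a
function `rep`, which picks an array with a given property whenever there is one. -/

def IsRepChoice {N : ℕ} (rep : (Multiset (Row N) → Prop) → Multiset (Row N)) : Prop :=
  ∀ p : Multiset (Row N) → Prop, (∃ M, p M) → p (rep p)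

section semantics

variable {N : ℕ} (rep : (Multiset (Row N) → Prop) → Multiset (Row N))

open scoped Classical in
/-- A Pauli symbol `a` such that `q` has the row with the only non-identity entry `a` in column
`j`. -/
def basisAt (q : Arr N) (j : Fin N) : Sym :=
  if HasRow q (single j .X) then .X else if HasRow q (single j .Y) then .Y else .Z

/-- `q` has a row whose only non-identity entry is a Pauli symbol in column `j`. -/
def HasSingle (q : Arr N) (j : Fin N) : Prop :=
  HasRow q (single j .X) ∨ HasRow q (single j .Y) ∨ HasRow q (single j .Z)

open scoped Classical in
/-- The qubits of `J` that split off from the array. -/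
def splitSet (J : Finset (Fin N)) (q : Arr N) : Finset (Fin N) := J.filter (HasSingle q)

/-- `q` is the product of one-qubit stabilizers of the qubits in `D` and of the array `M`, whose rows
are supported on `B`. -/
def SplitsAs (D B : Finset (Fin N)) (q : Arr N) (M : Multiset (Row N)) : Prop :=
  (∀ R ∈ M, SupportedOn B R) ∧
    (⟦D.val.map (fun j => single j (basisAt q j)) + M⟧ : Arr N) = q

open scoped Classical in
/-- The process `update` for a stabilizer `q` on `A`, which is written as the tensor
product of one-qubit stabilizers of the qubits of `J` that split off and a stabilizer on the other
qubits of `A`. -/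
def update (J A : Finset (Fin N)) (q : Arr N) : Pieces N where
  singles := splitSet J q
  basis j := .pauli j (basisAt q j)
  rest :=
    if ∃ M, SplitsAs (splitSet J q) (A \ splitSet J q) q M then
      Ext.ofRows (rep (SplitsAs (splitSet J q) (A \ splitSet J q) q))
    else .unknown

open scoped Classical in
/-- The process `update_E`. -/
def updateE (J A : Finset (Fin N)) : Ext N → Pieces N
  | .unknown => ⟨∅, fun _ => .unknown, .unknown⟩
  | .mixed => ⟨∅, fun _ => .unknown, .mixed⟩
  | .arr q =>
    if IsStabilizer A q then update rep J A q
    else ⟨splitSet J q, fun j => .pauli j (basisAt q j),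
      if splitSet J q = ∅ then .arr q else .unknown⟩

/-- `q` consists of one row with `X` or `Y` in column `i` and the rows `M`, which have `I` or `Z`
in column `i`. -/
def OneFlip (i : Fin N) (q : Arr N) (M : Multiset (Row N)) : Prop :=
  ∃ R : Row N, (⟦R ::ₘ M⟧ : Arr N) = q ∧ (R i).Flips ∧ ∀ R' ∈ M, R' i = .I ∨ R' i = .Z

open scoped Classical in
/-- Measurement of qubit `i` in a stabilizer: the row that does not commute with `Zᵢ` is replaced
by `Zᵢ`. -/
def measSt (i : Fin N) (q : Arr N) : Arr N :=
  if ∃ M, OneFlip i q M then ⟦single i .Z ::ₘ rep (OneFlip i q)⟧ else q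

open scoped Classical in
/-- Measurement `meas_E(i, γ)`. -/
def measE (i : Fin N) (γ : Assignment N) : Assignment N :=
  if (γ.cell i).card = 1 then γ.setVal i (.pauli i .Z)
  else match γ.val i with
  | .arr q =>
    if IsStabilizer (γ.cell i) q then
      γ.split i (update rep (γ.cell i) (γ.cell i) (measSt rep i q))
    else if ∃ M, OneFlip i q M then
      let P := updateE rep (γ.cell i \ {i}) (γ.cell i \ {i})
        (Ext.ofRows ((rep (OneFlip i q)).map (eraseCol i)))
      γ.split i ⟨insert i P.singles, Function.update P.basis i (.pauli i .Z), P.rest⟩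
    else γ.split i ⟨{i}, fun _ => .pauli i .Z, .unknown⟩
  | _ => γ.split i ⟨{i}, fun _ => .pauli i .Z, .unknown⟩

/-- Column `i` contains neither `X` nor `Y`. -/
def NoFlip (i : Fin N) (q : Arr N) (M : Multiset (Row N)) : Prop :=
  (⟦M⟧ : Arr N) = q ∧ ∀ R ∈ M, ¬ (R i).Flips

open scoped Classical in
/-- At most one L-row has `X` or `Y` in column `i`. -/
def AtMostOneFlip (i : Fin N) (q : Arr N) (M : Multiset (Row N)) : Prop :=
  (⟦M⟧ : Arr N) = q ∧ (M.filter fun R => IsLRow R ∧ (R i).Flips).card ≤ 1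

open scoped Classical in
/-- The effect of the gate `T` on qubit `i`, including the function `add_♡`. -/
def Ext.gateT (i : Fin N) : Ext N → Ext N
  | .unknown => .unknown
  | .mixed => .mixed
  | .arr q =>
    if ∃ M, NoFlip i q M then .arr q
    else if ∃ M, AtMostOneFlip i q M then .arr ⟦(rep (AtMostOneFlip i q)).map (heartCol i)⟧
    else .unknown

/-- Qubit `i` is a segment of its own with the stabilizer `⟨a⟩`. -/
def Assignment.IsPauli (γ : Assignment N) (i : Fin N) (a : Sym) : Prop :=
  γ.cell i = {i} ∧ γ.val i = .pauli i a

open scoped Classical in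
/-- The effect of controlled-X with control `i` and target `j`. -/
def Assignment.cx (γ : Assignment N) (i j : Fin N) : Assignment N :=
  if γ.cell i = γ.cell j then
    γ.split i (updateE rep {i, j} (γ.cell i) ((γ.val i).cx i j))
  else if γ.IsPauli i .Z ∨ γ.IsPauli j .X ∨ (γ.val i = .mixed ∧ γ.val j = .mixed) then γ
  else if γ.val i = .mixed then γ.setVal i (.pauli i .Z)
  else if γ.val j = .mixed then γ.setVal j (.pauli j .X)
  else γ.merge i j (((γ.val i).tensor (γ.val j)).cx i j)

/-- The abstract semantics. -/
def QIL.semE : QIL N → Assignment N → Assignment N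
  | .skip, γ => γ
  | .seq C C', γ => C'.semE (C.semE γ)
  | .gate U i, γ => γ.setVal i ((γ.val i).conj U i)
  | .gateT i, γ => γ.setVal i ((γ.val i).gateT rep i)
  | .cx i j _, γ => γ.cx rep i j
  | .ite i C C', γ =>
    approxJoin fun b : Bool => if b then C.semE (measE rep i γ) else C'.semE (measE rep i γ)
  | .while i C, γ =>
    approxJoin fun n : ℕ => measE rep i ((fun δ => C.semE (measE rep i δ))^[n] γ)

end semantics

end ExtStab

end

/-! The proof replaces `γ ⊨ ρ` by an invariant that is linear in `ρ` and stable under limits.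

For a self-adjoint involution `L` and a Hermitian `ρ`, the condition `P⁺ρP⁻ = 0` says exactly that
`L` commutes with `ρ` (`projPlus_mul_projMinus_iff`). So signs and phases are irrelevant, and
products of L-rows inherit the property. For a positive `ρ`, being maximally mixed on qubit `i`
amounts to commuting with `X_i` and `Z_i` (`commute_of_mixed`, `exists_mixed`), so the symbol `I`
acts as an element having every L-row on its qubit. Separability means lying in the cone generated
by `|ψ⟩⟨ψ|` for vectors `ψ` that factor along the partition, the bound on the weights being a bound
on the trace. Thus satisfaction becomes `Good`: membership in the cone together with commutation
with all L-rows. The companion invariant `Supp`, that L-rows live on their own segment, keeps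
operations elsewhere from disturbing them.

Commutation survives each clause for algebraic reasons. Clifford gates carry L-rows to L-rows up to
sign. `T` and the measurement projections are diagonal, hence commute with rows having `I` or `Z` at
the qubit; after a projection `Z_i` commutes as well. The L-rows of an approximate join are L-rows
of every member, since `I` has all of them and `■` has none.

Separability needs more care. Local operators act on one factor of `ψ`, and coarsening a partition
enlarges the cone. If `ρ` commutes with a Pauli operator on qubit `j`, it is the sum of its
compressions to the two eigenspaces. These projections have rank one on the qubit, so `j` splits off
(`mem_splitOne`). The same pinching shows that controlled-X creates no entanglement when `Z` on the
control or `X` on the target commutes with `ρ`: on each eigenspace it acts as a local gate.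

For `while`, the concrete state is a limit of partial sums whose terms are all good for the same
join. Commutation is a closed condition. The cone elements of trace at most one form a closed set
because they are multiples, by factors in `[0,1]`, of points in the convex hull of the compact set
of pure product states (`Assignment.mem_sepCone_of_tendsto`). -/

noncomputable section

namespace ExtStab

open scoped ComplexOrder
open Matrix

variable {N : ℕ}

/-! ## Tensor products of one-qubit operators -/

/-- The tensor product of one-qubit operators. -/
def tens (A : Fin N → Matrix (Fin 2) (Fin 2) ℂ) : Op (Fin N) :=
  Matrix.of fun s t => ∏ i, A i (s i) (t i)

theorem tens_mul (A B : Fin N → Matrix (Fin 2) (Fin 2) ℂ) :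
    tens A * tens B = tens fun i => A i * B i := by
  ext s t
  simp only [tens, Matrix.mul_apply, Matrix.of_apply, ← Finset.prod_mul_distrib]
  rw [Finset.prod_univ_sum, Fintype.piFinset_univ]

theorem tens_one : tens (fun _ : Fin N => 1) = 1 := by
  ext s t
  simp only [tens, Matrix.of_apply, Matrix.one_apply]
  rw [Finset.prod_ite_zero]
  simp [funext_iff]

theorem conjTranspose_tens (A : Fin N → Matrix (Fin 2) (Fin 2) ℂ) :
    (tens A)ᴴ = tens fun i => (A i)ᴴ := by
  ext s t
  simp [tens, Matrix.conjTranspose_apply]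

theorem rowOp_eq_tens (R : Row N) : rowOp R = tens fun i => (R i).mat := rfl

theorem appOn_eq_tens (U : Matrix (Fin 2) (Fin 2) ℂ) (i : Fin N) :
    appOn U i = tens fun k => if k = i then U else 1 := by
  ext s t
  simp only [tens, appOn, Matrix.of_apply]
  rw [← Finset.mul_prod_erase _ _ (Finset.mem_univ i)]
  simp only [if_true]
  have : ∀ k ∈ Finset.univ.erase i, (if k = i then U else 1) (s k) (t k)
      = if s k = t k then (1 : ℂ) else 0 := by
    intro k hk
    rw [if_neg (Finset.ne_of_mem_erase hk), Matrix.one_apply]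
  rw [Finset.prod_congr rfl this, Finset.prod_ite_zero]
  simp

theorem tens_smul_at (A B : Fin N → Matrix (Fin 2) (Fin 2) ℂ) (i : Fin N) (c : ℂ)
    (hi : A i = c • B i) (h : ∀ k, k ≠ i → A k = B k) : tens A = c • tens B := by
  ext s t
  simp only [tens, Matrix.of_apply, Matrix.smul_apply, smul_eq_mul]
  rw [← Finset.mul_prod_erase _ _ (Finset.mem_univ i),
    ← Finset.mul_prod_erase Finset.univ (fun k => B k (s k) (t k)) (Finset.mem_univ i), hi,
    Finset.prod_congr rfl fun k hk => by rw [h k (Finset.ne_of_mem_erase hk)]]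
  simp [mul_assoc]

theorem appOn_mul (U V : Matrix (Fin 2) (Fin 2) ℂ) (i : Fin N) :
    appOn U i * appOn V i = appOn (U * V) i := by
  simp only [appOn_eq_tens, tens_mul]
  congr 1; funext k; split_ifs <;> simp

theorem appOn_comm (U V : Matrix (Fin 2) (Fin 2) ℂ) {i j : Fin N} (h : i ≠ j) :
    Commute (appOn U i) (appOn V j) := by
  simp only [Commute, SemiconjBy, appOn_eq_tens, tens_mul]
  congr 1; funext k; split_ifs with h1 h2
  · exact absurd (h1.symm.trans h2) h
  all_goals simp

theorem appOn_one (i : Fin N) : appOn 1 i = 1 := by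
  simp [appOn_eq_tens, tens_one]

theorem appOn_add (U V : Matrix (Fin 2) (Fin 2) ℂ) (i : Fin N) :
    appOn (U + V) i = appOn U i + appOn V i := by
  ext s t; simp only [appOn, Matrix.of_apply, Matrix.add_apply]; split_ifs <;> simp

theorem appOn_smul (c : ℂ) (U : Matrix (Fin 2) (Fin 2) ℂ) (i : Fin N) :
    appOn (c • U) i = c • appOn U i := by
  ext s t; simp only [appOn, Matrix.of_apply, Matrix.smul_apply]; split_ifs <;> simp

theorem conjTranspose_appOn (U : Matrix (Fin 2) (Fin 2) ℂ) (i : Fin N) :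
    (appOn U i)ᴴ = appOn Uᴴ i := by
  simp only [appOn_eq_tens, conjTranspose_tens]
  congr 1; funext k; split_ifs <;> simp

/-- Lifts an identity between 2×2 matrices to all qubits: away from `i` the two tensor products have
the same factors. -/
theorem appOn_mul_rowOp (U : Matrix (Fin 2) (Fin 2) ℂ) (i : Fin N) (R R' : Row N) (c : ℂ)
    (hi : U * (R i).mat = c • ((R' i).mat * U)) (h : ∀ k, k ≠ i → R k = R' k) :
    appOn U i * rowOp R = c • (rowOp R' * appOn U i) := by
  rw [appOn_eq_tens, rowOp_eq_tens, rowOp_eq_tens, tens_mul, tens_mul]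
  apply tens_smul_at (i := i)
  · simpa using hi
  · intro k hk; simp [hk, h k hk]

theorem commute_appOn_rowOp (U : Matrix (Fin 2) (Fin 2) ℂ) (i : Fin N) (R : Row N)
    (h : U * (R i).mat = (R i).mat * U) : Commute (rowOp R) (appOn U i) := by
  have := appOn_mul_rowOp U i R R 1 (by simpa using h) (fun _ _ => rfl)
  rw [one_smul] at this
  exact this.symm

theorem rowOp_single (i : Fin N) (a : Sym) : rowOp (single i a) = appOn a.mat i := by
  rw [rowOp_eq_tens, appOn_eq_tens]
  congr 1; funext k
  by_cases hk : k = i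
  · subst hk; simp [single]
  · simp [single, hk, Sym.mat]

/-! ### Multiplication of Pauli rows up to phase -/

theorem Sym.exists_mat_mul (a b : Sym) (ha : a ≠ .heart) (hb : b ≠ .heart) :
    ∃ c : ℂ, (a * b).mat = c • (a.mat * b.mat) := by
  have h1 : ∀ a b : Sym, a * b = Sym.mul a b := fun _ _ => rfl
  rw [h1]
  cases a <;> cases b <;> first | exact absurd rfl ha | exact absurd rfl hb | skip
  case X.Y => exact ⟨-Complex.I, by ext i j; fin_cases i <;> fin_cases j <;> simp [Sym.mul, Sym.mat]⟩
  case Y.X => exact ⟨Complex.I, by ext i j; fin_cases i <;> fin_cases j <;> simp [Sym.mul, Sym.mat]⟩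
  case Y.Z => exact ⟨-Complex.I, by ext i j; fin_cases i <;> fin_cases j <;> simp [Sym.mul, Sym.mat]⟩
  case Z.Y => exact ⟨Complex.I, by ext i j; fin_cases i <;> fin_cases j <;> simp [Sym.mul, Sym.mat]⟩
  case Z.X => exact ⟨-Complex.I, by ext i j; fin_cases i <;> fin_cases j <;> simp [Sym.mul, Sym.mat]⟩
  case X.Z => exact ⟨Complex.I, by ext i j; fin_cases i <;> fin_cases j <;> simp [Sym.mul, Sym.mat]⟩
  all_goals exact ⟨1, by ext i j; fin_cases i <;> fin_cases j <;> simp [Sym.mul, Sym.mat]⟩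

theorem rowOp_mul (R S : Row N) (hR : IsLRow R) (hS : IsLRow S) :
    ∃ c : ℂ, rowOp (R * S) = c • (rowOp R * rowOp S) := by
  choose c hc using fun i => Sym.exists_mat_mul (R i) (S i) (hR i) (hS i)
  refine ⟨∏ i, c i, ?_⟩
  rw [rowOp_eq_tens, rowOp_eq_tens, rowOp_eq_tens, tens_mul]
  ext s t
  simp only [tens, Matrix.of_apply, Matrix.smul_apply, smul_eq_mul, Pi.mul_apply, hc,
    Finset.prod_mul_distrib]

theorem Sym.mat_sq (a : Sym) (ha : a ≠ .heart) : a.mat * a.mat = 1 := by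
  cases a <;> first | exact absurd rfl ha | skip
  all_goals ext i j; fin_cases i <;> fin_cases j <;> simp [Sym.mat]

theorem Sym.conjTranspose_mat (a : Sym) : a.matᴴ = a.mat := by
  cases a <;> ext i j <;> fin_cases i <;> fin_cases j <;> simp [Sym.mat]

theorem rowOp_sq (R : Row N) (hR : IsLRow R) : rowOp R * rowOp R = 1 := by
  rw [rowOp_eq_tens, tens_mul, ← tens_one]
  congr 1; funext i; exact Sym.mat_sq _ (hR i)

theorem conjTranspose_rowOp (R : Row N) : (rowOp R)ᴴ = rowOp R := by
  rw [rowOp_eq_tens, conjTranspose_tens]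
  congr 1; funext i; exact Sym.conjTranspose_mat _

/-- The phase lost in multiplying rows is a scalar, which does not affect commutation. This makes
commutation invariant under change of representative. -/
theorem commute_rowOp_mul {R S : Row N} (hR : IsLRow R) (hS : IsLRow S) {ρ : Op (Fin N)}
    (h : Commute (rowOp R) ρ) (h' : Commute (rowOp S) ρ) : Commute (rowOp (R * S)) ρ := by
  obtain ⟨c, hc⟩ := rowOp_mul R S hR hS
  rw [hc]
  exact (h.mul_left h').smul_left c

theorem rowOp_one : rowOp (1 : Row N) = 1 := tens_one

theorem Sym.mul_ne_heart {a b : Sym} : a * b ≠ .heart ↔ a ≠ .heart ∧ b ≠ .heart := by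
  cases a <;> cases b <;> simp <;> decide

theorem isLRow_mul {R S : Row N} : IsLRow (R * S) ↔ IsLRow R ∧ IsLRow S := by
  simp only [IsLRow, Pi.mul_apply, Sym.mul_ne_heart, forall_and]

theorem isLRow_single {i : Fin N} {a : Sym} (ha : a ≠ .heart) : IsLRow (single i a) := by
  intro k
  by_cases hk : k = i
  · subst hk; simpa [single] using ha
  · simp [single, hk]

/-- Conjugation by a unitary that carries one row operator to a multiple of another one. -/
theorem commute_conj {ρ V K K' : Op (Fin N)} {c : ℂ} (hV : Vᴴ * V = 1)
    (hc : V * K = c • (K' * V)) (hc0 : c ≠ 0) (h : Commute K ρ) :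
    Commute K' (V * ρ * Vᴴ) := by
  have hV' : V * Vᴴ = 1 := mul_eq_one_comm.mp hV
  have hK : K' = c⁻¹ • (V * K * Vᴴ) := by
    rw [hc, smul_mul_assoc, smul_smul, inv_mul_cancel₀ hc0, one_smul, mul_assoc, hV', mul_one]
  rw [hK]
  refine Commute.smul_left ?_ _
  simp only [Commute, SemiconjBy] at h ⊢
  calc V * K * Vᴴ * (V * ρ * Vᴴ) = V * K * (Vᴴ * V) * ρ * Vᴴ := by simp only [mul_assoc]
    _ = V * (K * ρ) * Vᴴ := by rw [hV]; simp only [mul_one, mul_assoc]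
    _ = V * (ρ * K) * Vᴴ := by rw [h]
    _ = V * ρ * (Vᴴ * V) * K * Vᴴ := by rw [hV]; simp only [mul_one, mul_assoc]
    _ = V * ρ * Vᴴ * (V * K * Vᴴ) := by simp only [mul_assoc]

/-! ## The gates -/

theorem Clifford1.unitary (U : Clifford1) : U.matᴴ * U.mat = 1 := by
  have h2 : ((Real.sqrt 2 : ℝ) : ℂ) * ((Real.sqrt 2 : ℝ) : ℂ) = 2 := by
    rw [← Complex.ofReal_mul, Real.mul_self_sqrt (by norm_num)]; norm_num
  have h0 : ((Real.sqrt 2 : ℝ) : ℂ) ≠ 0 := by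
    intro h; rw [h] at h2; norm_num at h2
  cases U <;> ext i j <;> fin_cases i <;> fin_cases j <;>
    simp [Clifford1.mat, Matrix.mul_apply, Fin.sum_univ_two] <;>
    field_simp <;> simp [sq, h2] <;> norm_num

theorem matT_unitary : matTᴴ * matT = 1 := by
  have : (starRingEnd ℂ) (Complex.exp (Complex.I * (Real.pi / 4 : ℝ))) *
      Complex.exp (Complex.I * (Real.pi / 4 : ℝ)) = 1 := by
    rw [← Complex.exp_conj, ← Complex.exp_add, map_mul, Complex.conj_I, Complex.conj_ofReal]
    simp
  ext i j; fin_cases i <;> fin_cases j <;> simp [matT, Matrix.mul_apply, Fin.sum_univ_two]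
  simpa using this

theorem appOn_unitary {U : Matrix (Fin 2) (Fin 2) ℂ} (h : Uᴴ * U = 1) (i : Fin N) :
    (appOn U i)ᴴ * appOn U i = 1 := by
  rw [conjTranspose_appOn, appOn_mul, h, appOn_one]

theorem Clifford1.conj_mat (U : Clifford1) (a : Sym) :
    ∃ c : ℂ, c ≠ 0 ∧ U.mat * a.mat = c • ((U.conj a).mat * U.mat) := by
  cases U <;> cases a
  case X.Y => exact ⟨-1, by simp, by
    ext i j; fin_cases i <;> fin_cases j <;> simp [Clifford1.conj, Clifford1.mat, Sym.mat]⟩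
  case X.Z => exact ⟨-1, by simp, by
    ext i j; fin_cases i <;> fin_cases j <;> simp [Clifford1.conj, Clifford1.mat, Sym.mat]⟩
  case Y.X => exact ⟨-1, by simp, by
    ext i j; fin_cases i <;> fin_cases j <;> simp [Clifford1.conj, Clifford1.mat, Sym.mat]⟩
  case Y.Z => exact ⟨-1, by simp, by
    ext i j; fin_cases i <;> fin_cases j <;> simp [Clifford1.conj, Clifford1.mat, Sym.mat]⟩
  case Z.X => exact ⟨-1, by simp, by
    ext i j; fin_cases i <;> fin_cases j <;> simp [Clifford1.conj, Clifford1.mat, Sym.mat]⟩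
  case Z.Y => exact ⟨-1, by simp, by
    ext i j; fin_cases i <;> fin_cases j <;> simp [Clifford1.conj, Clifford1.mat, Sym.mat]⟩
  case H.Y => exact ⟨-1, by simp, by
    ext i j; fin_cases i <;> fin_cases j <;>
      simp [Clifford1.conj, Clifford1.mat, Sym.mat, mul_comm]⟩
  case S.Y => exact ⟨-1, by simp, by
    ext i j; fin_cases i <;> fin_cases j <;> simp [Clifford1.conj, Clifford1.mat, Sym.mat]⟩
  all_goals exact ⟨1, by simp, by
    ext i j; fin_cases i <;> fin_cases j <;>
      simp [Clifford1.conj, Clifford1.mat, Sym.mat]⟩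

theorem Clifford1.conj_conj (U : Clifford1) (a : Sym) : U.conj (U.conj a) = a := by
  cases U <;> cases a <;> rfl

theorem Clifford1.conjRow_conjRow (U : Clifford1) (i : Fin N) (R : Row N) :
    U.conjRow i (U.conjRow i R) = R := by
  funext k; by_cases hk : k = i <;> simp [conjRow, hk, U.conj_conj]

theorem Clifford1.isLRow_conjRow (U : Clifford1) (i : Fin N) (R : Row N) :
    IsLRow (U.conjRow i R) ↔ IsLRow R := by
  have h : ∀ a, U.conj a ≠ .heart ↔ a ≠ .heart := by intro a; cases U <;> cases a <;> decide
  refine forall_congr' fun k => ?_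
  by_cases hk : k = i
  · subst hk; simp [conjRow, h]
  · simp [conjRow, hk]

theorem Clifford1.supportedOn_conjRow (U : Clifford1) (i : Fin N) {A : Finset (Fin N)} {R : Row N}
    (h : SupportedOn A R) : SupportedOn A (U.conjRow i R) := by
  have h1 : U.conj .I = .I := by cases U <;> rfl
  intro k hk
  by_cases hki : k = i
  · subst hki; simp [conjRow, h k hk, h1]
  · simp [conjRow, hki, h k hk]

theorem Clifford1.commute_conjRow (U : Clifford1) (i : Fin N) (R : Row N) {ρ : Op (Fin N)}
    (h : Commute (rowOp R) ρ) :
    Commute (rowOp (U.conjRow i R)) (appOn U.mat i * ρ * (appOn U.mat i)ᴴ) := by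
  obtain ⟨c, hc0, hc⟩ := U.conj_mat (R i)
  refine commute_conj (appOn_unitary U.unitary i) (appOn_mul_rowOp U.mat i R _ c ?_ ?_) hc0 h
  · simpa [conjRow] using hc
  · intro k hk; simp [conjRow, hk]

/-- Controlled-X on basis vectors. -/
def cxFun (i j : Fin N) (s : Fin N → Fin 2) : Fin N → Fin 2 := Function.update s j (s j + s i)

theorem cxFun_cxFun {i j : Fin N} (h : i ≠ j) (s : Fin N → Fin 2) :
    cxFun i j (cxFun i j s) = s := by
  have h2 : ∀ a b : Fin 2, a + b + b = a := by decide
  funext k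
  by_cases hk : k = j
  · subst hk; simp [cxFun, h, h2]
  · simp [cxFun, hk]

theorem cxOp_mul_apply {i j : Fin N} (h : i ≠ j) (K : Op (Fin N)) (s t : Fin N → Fin 2) :
    (cxOp i j * K) s t = K (cxFun i j s) t := by
  have : ∀ u, cxOp i j s u = if u = cxFun i j s then (1 : ℂ) else 0 := by
    intro u
    have : s = Function.update u j (u j + u i) ↔ u = cxFun i j s :=
      ⟨fun e => by rw [e]; exact (cxFun_cxFun h u).symm,
        fun e => by rw [e]; exact (cxFun_cxFun h s).symm⟩
    simp [cxOp, this]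
  simp [Matrix.mul_apply, this]

theorem mul_cxOp_apply {i j : Fin N} (K : Op (Fin N)) (s t : Fin N → Fin 2) :
    (K * cxOp i j) s t = K s (cxFun i j t) := by
  simp [Matrix.mul_apply, cxOp, cxFun]

theorem conjTranspose_cxOp {i j : Fin N} (h : i ≠ j) : (cxOp i j : Op (Fin N))ᴴ = cxOp i j := by
  ext s t
  have : t = Function.update s j (s j + s i) ↔ s = Function.update t j (t j + t i) :=
    ⟨fun e => by rw [e]; exact (cxFun_cxFun h s).symm,
      fun e => by rw [e]; exact (cxFun_cxFun h t).symm⟩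
  simp [cxOp, Matrix.conjTranspose_apply, this, apply_ite]

theorem cxOp_unitary {i j : Fin N} (h : i ≠ j) : (cxOp i j : Op (Fin N))ᴴ * cxOp i j = 1 := by
  rw [conjTranspose_cxOp h]
  ext s t
  rw [cxOp_mul_apply h]
  have : cxFun i j s = Function.update t j (t j + t i) ↔ s = t :=
    ⟨fun e => by rw [← cxFun_cxFun h s, e]; exact cxFun_cxFun h t, fun e => by rw [e]; rfl⟩
  simp [cxOp, this, Matrix.one_apply]

/-- Entrywise form of the conjugation rule on control and target: `y + x` and `w + z` are the target
bits after controlled-X acts from the left and from the right. Only `X ⊗ Z` and `Y ⊗ Y` pick up a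
sign. -/
theorem Sym.cx_mat (a b : Sym) (ha : a ≠ .heart) (hb : b ≠ .heart) :
    ∃ c : ℂ, c ≠ 0 ∧ ∀ x y z w : Fin 2, a.mat x z * b.mat (y + x) w =
      c * ((a * b.toControl).mat x z * (b * a.toTarget).mat y (w + z)) := by
  have h1 : ∀ a b : Sym, a * b = Sym.mul a b := fun _ _ => rfl
  simp only [h1]
  have e : (1 : Fin 2) + 1 = 0 := rfl
  cases a <;> cases b <;> first | exact absurd rfl ha | exact absurd rfl hb | skip
  case X.Z =>
    exact ⟨-1, by simp, by
      intro x y z w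
      fin_cases x <;> fin_cases y <;> fin_cases z <;> fin_cases w <;>
        simp [Sym.mul, Sym.mat, Sym.toControl, Sym.toTarget, e]⟩
  case Y.Y =>
    exact ⟨-1, by simp, by
      intro x y z w
      fin_cases x <;> fin_cases y <;> fin_cases z <;> fin_cases w <;>
        simp [Sym.mul, Sym.mat, Sym.toControl, Sym.toTarget, e]⟩
  all_goals
    exact ⟨1, by simp, by
      intro x y z w
      fin_cases x <;> fin_cases y <;> fin_cases z <;> fin_cases w <;>
        simp [Sym.mul, Sym.mat, Sym.toControl, Sym.toTarget, e, Matrix.one_fin_two]⟩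

theorem cxOp_mul_rowOp {i j : Fin N} (h : i ≠ j) (R : Row N) (hR : IsLRow R) :
    ∃ c : ℂ, c ≠ 0 ∧ cxOp i j * rowOp R = c • (rowOp (cxRow i j R) * cxOp i j) := by
  obtain ⟨c, hc0, hc⟩ := Sym.cx_mat (R i) (R j) (hR i) (hR j)
  refine ⟨c, hc0, ?_⟩
  ext s t
  rw [cxOp_mul_apply h, Matrix.smul_apply, mul_cxOp_apply]
  have hj : j ∈ Finset.univ.erase i := by simp [h.symm]
  have split : ∀ f : Fin N → ℂ, ∏ k, f k = f i * (f j * ∏ k ∈ (Finset.univ.erase i).erase j, f k) :=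
    fun f => by rw [Finset.mul_prod_erase _ _ hj, Finset.mul_prod_erase _ _ (Finset.mem_univ i)]
  simp only [rowOp, Matrix.of_apply, smul_eq_mul]
  rw [split, split fun k => (cxRow i j R k).mat (s k) (cxFun i j t k)]
  have hrest : ∀ k ∈ (Finset.univ.erase i).erase j,
      (R k).mat (cxFun i j s k) (t k) = (cxRow i j R k).mat (s k) (cxFun i j t k) := by
    intro k hk
    simp only [Finset.mem_erase, Finset.mem_univ, and_true] at hk
    simp [cxFun, cxRow, hk.1, hk.2]
  rw [Finset.prod_congr rfl hrest]
  have := hc (s i) (s j) (t i) (t j)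
  generalize ∏ k ∈ (Finset.univ.erase i).erase j,
    (cxRow i j R k).mat (s k) (cxFun i j t k) = P
  simp only [cxFun, cxRow, h, h.symm, Function.update_self, ne_eq, not_false_eq_true,
    Function.update_of_ne, if_true, if_false]
  linear_combination P * this

theorem commute_cxRow {i j : Fin N} (h : i ≠ j) (R : Row N) (hR : IsLRow R) {ρ : Op (Fin N)}
    (hc : Commute (rowOp R) ρ) :
    Commute (rowOp (cxRow i j R)) (cxOp i j * ρ * (cxOp i j)ᴴ) := by
  obtain ⟨c, hc0, e⟩ := cxOp_mul_rowOp h R hR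
  exact commute_conj (cxOp_unitary h) e hc0 hc

theorem isLRow_of_cxRow {i j : Fin N} {R : Row N} (h : IsLRow (cxRow i j R)) : IsLRow R := by
  intro k
  by_cases hi : k = i
  · subst hi
    have := h k
    simp only [cxRow, if_true, Sym.mul_ne_heart] at this
    exact this.1
  · by_cases hj : k = j
    · subst hj
      have := h k
      simp only [cxRow, if_true, hi, if_false, Sym.mul_ne_heart] at this
      exact this.1
    · simpa [cxRow, hi, hj] using h k

theorem isLRow_cxRow {i j : Fin N} {R : Row N} (h : IsLRow R) : IsLRow (cxRow i j R) := by
  have h1 : ∀ a : Sym, a ≠ .heart → a.toControl ≠ .heart := by intro a; cases a <;> decide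
  have h2 : ∀ a : Sym, a ≠ .heart → a.toTarget ≠ .heart := by intro a; cases a <;> decide
  intro k
  simp only [cxRow]
  split_ifs
  · exact Sym.mul_ne_heart.2 ⟨h _, h1 _ (h _)⟩
  · exact Sym.mul_ne_heart.2 ⟨h _, h2 _ (h _)⟩
  · exact h k

/-- Hearts must be excluded: a heart in one of the two columns spreads to the other and erases its
entry. -/
theorem cxRow_cxRow {i j : Fin N} (h : i ≠ j) {R : Row N} (hR : IsLRow R) :
    cxRow i j (cxRow i j R) = R := by
  have h1 : ∀ a b : Sym, a ≠ .heart → b ≠ .heart →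
      a * b.toControl * (b * a.toTarget).toControl = a := by
    intro a b; cases a <;> cases b <;> decide
  have h2 : ∀ a b : Sym, a ≠ .heart → b ≠ .heart →
      b * a.toTarget * (a * b.toControl).toTarget = b := by
    intro a b; cases a <;> cases b <;> decide
  funext k
  by_cases hi : k = i
  · subst hi; simp [cxRow, h.symm, h1 _ _ (hR _) (hR _)]
  · by_cases hj : k = j
    · subst hj; simp [cxRow, hi, h2 _ _ (hR _) (hR _)]
    · simp [cxRow, hi, hj]

theorem supportedOn_cxRow {i j : Fin N} {A : Finset (Fin N)} (hi : i ∈ A) (hj : j ∈ A) {R : Row N}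
    (h : SupportedOn A R) : SupportedOn A (cxRow i j R) := by
  intro k hk
  have h1 : k ≠ i := fun e => hk (e ▸ hi)
  have h2 : k ≠ j := fun e => hk (e ▸ hj)
  simp [cxRow, h1, h2, h k hk]

/-! ## The cone of separable operators -/

/-- The qubits of `A` are pairwise in the same segment. -/
def Block (cell : Fin N → Finset (Fin N)) (A : Finset (Fin N)) : Prop := ∀ i ∈ A, A ⊆ cell i

/-- Products of functions each of which depends on the qubits of one block only. -/
def prodFns (cell : Fin N → Finset (Fin N)) : Submonoid ((Fin N → Fin 2) → ℂ) :=
  Submonoid.closure {g | ∃ A : Finset (Fin N), Block cell A ∧ DependsOn g (A : Set (Fin N))}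

/-- The operator `|ψ⟩⟨ψ|`. -/
def pureOp {V : Type} (ψ : (V → Fin 2) → ℂ) : Op V := Matrix.vecMulVec ψ (star ψ)

/-- Sums of operators `|ψ⟩⟨ψ|` with product vectors `ψ`. -/
def sepCone (cell : Fin N → Finset (Fin N)) : AddSubmonoid (Op (Fin N)) :=
  AddSubmonoid.closure (pureOp '' (prodFns cell : Set ((Fin N → Fin 2) → ℂ)))

theorem mem_prodFns {cell : Fin N → Finset (Fin N)} {g : (Fin N → Fin 2) → ℂ} (A : Finset (Fin N))
    (hA : Block cell A) (hg : DependsOn g (A : Set (Fin N))) : g ∈ prodFns cell :=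
  Submonoid.subset_closure ⟨A, hA, hg⟩

theorem const_mem_prodFns (cell : Fin N → Finset (Fin N)) (c : ℂ) :
    (fun _ => c) ∈ prodFns cell :=
  mem_prodFns ∅ (by simp [Block]) (by simpa using dependsOn_const c)

theorem prodFns_mono {cell cell' : Fin N → Finset (Fin N)} (h : ∀ i, cell i ⊆ cell' i) :
    prodFns cell ≤ prodFns cell' := by
  refine Submonoid.closure_mono ?_
  rintro g ⟨A, hA, hg⟩
  exact ⟨A, fun i hi => (hA i hi).trans (h i), hg⟩

/-- A vector that factors along a partition also factors along a coarser one; merges and joins rely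
on this. -/
theorem sepCone_mono {cell cell' : Fin N → Finset (Fin N)} (h : ∀ i, cell i ⊆ cell' i) :
    sepCone cell ≤ sepCone cell' :=
  AddSubmonoid.closure_mono (Set.image_mono (prodFns_mono h))

theorem pureOp_mem_sepCone {cell : Fin N → Finset (Fin N)} {ψ : (Fin N → Fin 2) → ℂ}
    (h : ψ ∈ prodFns cell) : pureOp ψ ∈ sepCone cell :=
  AddSubmonoid.subset_closure ⟨ψ, h, rfl⟩

theorem conj_pureOp (V : Op (Fin N)) (ψ : (Fin N → Fin 2) → ℂ) :
    V * pureOp ψ * Vᴴ = pureOp (V *ᵥ ψ) := by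
  simp only [pureOp, Matrix.mul_vecMulVec, Matrix.vecMulVec_mul, Matrix.star_mulVec]

theorem conj_mem_sepCone {cell cell' : Fin N → Finset (Fin N)} {V : Op (Fin N)}
    (hV : ∀ ψ ∈ prodFns cell, V *ᵥ ψ ∈ prodFns cell') {ρ : Op (Fin N)} (h : ρ ∈ sepCone cell) :
    V * ρ * Vᴴ ∈ sepCone cell' := by
  induction h using AddSubmonoid.closure_induction with
  | mem x hx =>
    obtain ⟨ψ, hψ, rfl⟩ := hx
    rw [conj_pureOp]
    exact pureOp_mem_sepCone (hV ψ hψ)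
  | zero => simp
  | add x y _ _ hx hy => rw [mul_add, add_mul]; exact add_mem hx hy

/-- A nonnegative scalar `p` is absorbed as `√p` into the vector, a constant being a product
function for the empty block. So the additive monoid is indeed a cone. -/
theorem smul_mem_sepCone {cell : Fin N → Finset (Fin N)} {ρ : Op (Fin N)} (h : ρ ∈ sepCone cell)
    {p : ℝ} (hp : 0 ≤ p) : (p : ℂ) • ρ ∈ sepCone cell := by
  induction h using AddSubmonoid.closure_induction with
  | mem x hx =>
    obtain ⟨ψ, hψ, rfl⟩ := hx
    have : (p : ℂ) • pureOp ψ = pureOp ((fun _ => ((Real.sqrt p : ℝ) : ℂ)) * ψ) := by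
      ext s t
      have e : ((Real.sqrt p : ℝ) : ℂ) * ((Real.sqrt p : ℝ) : ℂ) = p := by
        rw [← Complex.ofReal_mul, Real.mul_self_sqrt hp]
      simp only [pureOp, Matrix.smul_apply, Matrix.vecMulVec_apply, Pi.mul_apply, Pi.star_apply,
        star_mul', smul_eq_mul, RCLike.star_def, Complex.conj_ofReal, ← e]
      ring
    rw [this]
    exact pureOp_mem_sepCone (mul_mem (const_mem_prodFns _ _) hψ)
  | zero => simp
  | add x y _ _ hx hy => rw [smul_add]; exact add_mem hx hy

theorem appOn_mulVec (U : Matrix (Fin 2) (Fin 2) ℂ) (i : Fin N) (ψ : (Fin N → Fin 2) → ℂ)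
    (s : Fin N → Fin 2) :
    (appOn U i *ᵥ ψ) s = ∑ b, U (s i) b * ψ (Function.update s i b) := by
  simp only [Matrix.mulVec, dotProduct]
  refine (Fintype.sum_of_injective (fun b => Function.update s i b)
    (Function.update_injective s i) _ _ ?_ ?_).symm
  · intro t ht
    have : ¬ ∀ j, j ≠ i → s j = t j := by
      intro h
      refine ht ⟨t i, ?_⟩
      funext k
      by_cases hk : k = i
      · subst hk; simp
      · simp [hk, h k hk]
    simp only [appOn, Matrix.of_apply, if_neg this, zero_mul]
  · intro b
    have : ∀ j, j ≠ i → s j = Function.update s i b j := fun j hj => by simp [hj]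
    simp only [appOn, Matrix.of_apply, if_pos this, Function.update_self]

theorem cxOp_mulVec {i j : Fin N} (h : i ≠ j) (ψ : (Fin N → Fin 2) → ℂ) (s : Fin N → Fin 2) :
    (cxOp i j *ᵥ ψ) s = ψ (cxFun i j s) := by
  have := cxOp_mul_apply h (Matrix.of fun s (_ : Fin N → Fin 2) => ψ s) s s
  simpa [Matrix.mul_apply, Matrix.mulVec, dotProduct] using this

/-- A product function is a function on the segment of `j` times a product function on the other
qubits. -/
theorem exists_factor {cell : Fin N → Finset (Fin N)} (j : Fin N) {ψ : (Fin N → Fin 2) → ℂ}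
    (h : ψ ∈ prodFns cell) :
    ∃ f r : (Fin N → Fin 2) → ℂ, ψ = f * r ∧ DependsOn f (cell j : Set (Fin N)) ∧
      r ∈ prodFns (fun k => cell k \ {j}) := by
  induction h using Submonoid.closure_induction with
  | mem g hg =>
    obtain ⟨A, hA, hg⟩ := hg
    by_cases hj : j ∈ A
    · exact ⟨g, 1, by simp, hg.mono (by exact_mod_cast hA j hj), one_mem _⟩
    · refine ⟨1, g, by simp, fun _ _ _ => rfl, mem_prodFns A (fun i hi k hk => ?_) hg⟩
      rw [Finset.mem_sdiff, Finset.mem_singleton]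
      exact ⟨hA i hi hk, fun e => hj (e ▸ hk)⟩
  | one => exact ⟨1, 1, by simp, fun _ _ _ => rfl, one_mem _⟩
  | mul x y _ _ hx hy =>
    obtain ⟨f, r, rfl, hf, hr⟩ := hx
    obtain ⟨f', r', rfl, hf', hr'⟩ := hy
    exact ⟨f * f', r * r', by ring, fun s t h => by
      simp only [Pi.mul_apply, hf h, hf' h], mul_mem hr hr'⟩

/-- With `j` removed from every segment, no block contains `j`, so none of the factors sees the bit
at `j`. -/
theorem prodFns_update {cell : Fin N → Finset (Fin N)} {j : Fin N} {r : (Fin N → Fin 2) → ℂ}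
    (h : r ∈ prodFns (fun k => cell k \ {j})) (s : Fin N → Fin 2) (b : Fin 2) :
    r (Function.update s j b) = r s := by
  induction h using Submonoid.closure_induction with
  | mem g hg =>
    obtain ⟨A, hA, hg⟩ := hg
    refine hg fun k hk => ?_
    have : k ≠ j := by
      have := hA k hk hk
      simp only [Finset.mem_sdiff, Finset.mem_singleton] at this
      exact this.2
    simp [this]
  | one => rfl
  | mul x y _ _ hx hy => simp only [Pi.mul_apply, hx, hy]

theorem block_cell {cell : Fin N → Finset (Fin N)} (hc : ∀ i j, j ∈ cell i → cell j = cell i)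
    (i : Fin N) : Block cell (cell i) := fun k hk => (hc i k hk).ge

/-- A local operator, unitary or not, changes only the factor of a product vector that belongs to
the segment of `i`. -/
theorem appOn_conj_mem {cell : Fin N → Finset (Fin N)} (hm : ∀ i, i ∈ cell i)
    (hc : ∀ i j, j ∈ cell i → cell j = cell i) (U : Matrix (Fin 2) (Fin 2) ℂ) (i : Fin N)
    {ρ : Op (Fin N)} (h : ρ ∈ sepCone cell) :
    appOn U i * ρ * (appOn U i)ᴴ ∈ sepCone cell := by
  refine conj_mem_sepCone (fun ψ hψ => ?_) h
  obtain ⟨f, r, rfl, hf, hr⟩ := exists_factor i hψ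
  have e : appOn U i *ᵥ (f * r) =
      (fun s => ∑ b, U (s i) b * f (Function.update s i b)) * r := by
    funext s
    simp only [appOn_mulVec, Pi.mul_apply, prodFns_update hr, Finset.sum_mul, mul_assoc]
  rw [e]
  refine mul_mem (mem_prodFns (cell i) (block_cell hc i) ?_)
    (prodFns_mono (fun k => Finset.sdiff_subset) hr)
  intro s t hst
  refine Finset.sum_congr rfl fun b _ => ?_
  rw [hst i (hm i)]
  congr 1
  refine hf fun k hk => ?_
  by_cases hk' : k = i
  · subst hk'; simp
  · simp [hk', hst k hk]

/-- Controlled-X permutes basis vectors, so it precomposes each factor with `cxFun`. A factor that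
sees the target then depends also on the control, which lies in the same segment; the other factors
are unchanged. -/
theorem cxOp_conj_mem {cell : Fin N → Finset (Fin N)}
    (hc : ∀ i j, j ∈ cell i → cell j = cell i) {i j : Fin N} (hij : i ≠ j) (hi : i ∈ cell j)
    {ρ : Op (Fin N)} (h : ρ ∈ sepCone cell) :
    cxOp i j * ρ * (cxOp i j)ᴴ ∈ sepCone cell := by
  refine conj_mem_sepCone (fun ψ hψ => ?_) h
  have e : cxOp i j *ᵥ ψ = fun s => ψ (cxFun i j s) := funext fun s => cxOp_mulVec hij ψ s
  rw [e]
  clear e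
  induction hψ using Submonoid.closure_induction with
  | mem g hg =>
    obtain ⟨A, hA, hg⟩ := hg
    by_cases hjA : j ∈ A
    · refine mem_prodFns (cell j) (block_cell hc j) fun s t hst => hg fun k hk => ?_
      have hkj : k ∈ cell j := hA j hjA hk
      have hj : j ∈ cell j := hA j hjA hjA
      by_cases hk' : k = j
      · subst hk'; simp [cxFun, hst _ hi, hst _ hj]
      · simp [cxFun, hk', hst k hkj]
    · refine mem_prodFns A hA fun s t hst => hg fun k hk => ?_
      have hk' : k ≠ j := fun e => hjA (e ▸ hk)
      simp [cxFun, hk', hst k hk]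
  | one => exact one_mem _
  | mul x y _ _ hx hy => exact mul_mem hx hy

/-- The partition in which `j` is a segment of its own. -/
def splitOne (cell : Fin N → Finset (Fin N)) (j : Fin N) : Fin N → Finset (Fin N) :=
  fun k => if k = j then {j} else cell k \ {j}

/-- A rank-one operator on qubit `j` contracts the vector against `y` in that qubit and puts `x` in
its place, so any entanglement of `j` with the rest is destroyed. -/
theorem rankOne_conj_mem {cell : Fin N → Finset (Fin N)}
    (hc : ∀ i j, j ∈ cell i → cell j = cell i) (x y : Fin 2 → ℂ) (j : Fin N)
    {ρ : Op (Fin N)} (h : ρ ∈ sepCone cell) :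
    appOn (Matrix.vecMulVec x y) j * ρ * (appOn (Matrix.vecMulVec x y) j)ᴴ ∈
      sepCone (splitOne cell j) := by
  refine conj_mem_sepCone (fun ψ hψ => ?_) h
  obtain ⟨f, r, rfl, hf, hr⟩ := exists_factor j hψ
  have e : appOn (Matrix.vecMulVec x y) j *ᵥ (f * r) =
      (fun s => x (s j)) * (fun s => ∑ b, y b * f (Function.update s j b)) * r := by
    funext s
    simp only [appOn_mulVec, Pi.mul_apply, prodFns_update hr, Finset.sum_mul, Finset.mul_sum,
      Matrix.vecMulVec_apply, mul_assoc]
  have hsub : ∀ k, cell k \ {j} ⊆ splitOne cell j k ∨ k = j := by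
    intro k
    by_cases hk : k = j
    · exact .inr hk
    · left; simp [splitOne, hk]
  rw [e]
  refine mul_mem (mul_mem (mem_prodFns {j} ?_ ?_) (mem_prodFns (cell j \ {j}) ?_ ?_)) ?_
  · intro i hi
    rw [Finset.mem_singleton] at hi
    simp [hi, splitOne]
  · intro s t hst
    simp only [hst j (by simp)]
  · intro i hi
    rw [Finset.mem_sdiff, Finset.mem_singleton] at hi
    rw [splitOne, if_neg hi.2, hc j i hi.1]
  · intro s t hst
    refine Finset.sum_congr rfl fun b _ => ?_
    congr 1
    refine hf fun k hk => ?_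
    by_cases hk' : k = j
    · subst hk'; simp
    · have : k ∈ cell j \ {j} := by simp [hk']; exact hk
      simp [hk', hst k (by exact_mod_cast this)]
  · refine Submonoid.closure_mono ?_ hr
    rintro g ⟨A, hA, hg⟩
    refine ⟨A, fun i hi => ?_, hg⟩
    have h1 := hA i hi
    have h2 := h1 hi
    rw [Finset.mem_sdiff, Finset.mem_singleton] at h2
    simpa [splitOne, h2.2] using h1

/-- Pinching by complementary projections does nothing to an operator that commutes with them. -/
theorem sum_proj_conj {ρ P Q : Op (Fin N)} (hPQ : P + Q = 1) (hP : P * P = P)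
    (h : Commute P ρ) : P * ρ * P + Q * ρ * Q = ρ := by
  have hQ : Q = 1 - P := by rw [← hPQ]; simp
  have e : P * ρ * P = P * ρ := by rw [h.eq, mul_assoc, hP]
  have e' : ρ * P = P * ρ := h.eq.symm
  subst hQ
  simp only [sub_mul, mul_sub, one_mul, mul_one, e, e']
  abel

theorem Sym.exists_rankOne {a : Sym} (ha : a ≠ .heart) (ha' : a ≠ .I) :
    ∃ x y : Fin 2 → ℂ, (2⁻¹ : ℂ) • (1 + a.mat) = Matrix.vecMulVec x (star x) ∧
      (2⁻¹ : ℂ) • (1 - a.mat) = Matrix.vecMulVec y (star y) := by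
  have h2 : ((Real.sqrt 2 : ℝ) : ℂ) * ((Real.sqrt 2 : ℝ) : ℂ) = 2 := by
    rw [← Complex.ofReal_mul, Real.mul_self_sqrt (by norm_num)]; norm_num
  have h0 : ((Real.sqrt 2 : ℝ) : ℂ) ≠ 0 := by
    intro h; rw [h] at h2; norm_num at h2
  have h3 : (((Real.sqrt 2 : ℝ) : ℂ))⁻¹ * (((Real.sqrt 2 : ℝ) : ℂ))⁻¹ = 2⁻¹ := by
    rw [← mul_inv, h2]
  set q : ℂ := (((Real.sqrt 2 : ℝ) : ℂ))⁻¹ with hq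
  have hs : (starRingEnd ℂ) q = q := by rw [hq]; simp
  cases a
  · exact absurd rfl ha'
  · refine ⟨![q, q], ![q, -q], ?_, ?_⟩ <;> ext i j <;> fin_cases i <;> fin_cases j <;>
      simp [Sym.mat, Matrix.vecMulVec_apply, hs, h3]
  · refine ⟨![q, Complex.I * q], ![q, -Complex.I * q], ?_, ?_⟩ <;> ext i j <;> fin_cases i <;>
      fin_cases j <;> simp [Sym.mat, Matrix.vecMulVec_apply, hs, h3] <;> ring_nf <;>
      simp [sq, h3]
  · refine ⟨![1, 0], ![0, 1], ?_, ?_⟩ <;> ext i j <;> fin_cases i <;> fin_cases j <;>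
      simp [Sym.mat, Matrix.vecMulVec_apply] <;> norm_num
  · exact absurd rfl ha

/-- The eigenprojections of a nontrivial Pauli matrix have rank one. Hence `ρ`, which equals its
pinching by them, is a sum of two operators in which `j` has been separated. -/
theorem mem_splitOne {cell : Fin N → Finset (Fin N)}
    (hc : ∀ i j, j ∈ cell i → cell j = cell i) {j : Fin N} {a : Sym} (ha : a ≠ .heart)
    (ha' : a ≠ .I) {ρ : Op (Fin N)} (h : ρ ∈ sepCone cell) (hρ : Commute (rowOp (single j a)) ρ) :
    ρ ∈ sepCone (splitOne cell j) := by
  obtain ⟨x, y, hx, hy⟩ := Sym.exists_rankOne ha ha'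
  have hxs : (appOn ((2⁻¹ : ℂ) • (1 + a.mat)) j : Op (Fin N))ᴴ =
      appOn ((2⁻¹ : ℂ) • (1 + a.mat)) j := by
    rw [conjTranspose_appOn]; simp [a.conjTranspose_mat]
  have hys : (appOn ((2⁻¹ : ℂ) • (1 - a.mat)) j : Op (Fin N))ᴴ =
      appOn ((2⁻¹ : ℂ) • (1 - a.mat)) j := by
    rw [conjTranspose_appOn]; simp [a.conjTranspose_mat]
  have h1 := rankOne_conj_mem hc x (star x) j h
  have h2 := rankOne_conj_mem hc y (star y) j h
  rw [← hx, hxs] at h1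
  rw [← hy, hys] at h2
  have := add_mem h1 h2
  rwa [sum_proj_conj] at this
  · rw [← appOn_add, ← smul_add]
    have : (1 : Matrix (Fin 2) (Fin 2) ℂ) + a.mat + (1 - a.mat) = (2 : ℂ) • 1 := by
      rw [two_smul]; abel
    rw [this, smul_smul, inv_mul_cancel₀ two_ne_zero, one_smul, appOn_one]
  · rw [appOn_mul]
    congr 1
    rw [smul_mul_smul_comm]
    have : (1 + a.mat) * (1 + a.mat) = (2 : ℂ) • (1 + a.mat) := by
      rw [add_mul, mul_add, mul_add, a.mat_sq ha, two_smul]; simp; abel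
    rw [this, smul_smul]; norm_num
  · rw [appOn_smul, appOn_add, appOn_one, ← rowOp_single]
    exact ((Commute.one_left ρ).add_left hρ).smul_left _

theorem splitOne_part {cell : Fin N → Finset (Fin N)} (hc : ∀ i j, j ∈ cell i → cell j = cell i)
    (l : Fin N) : ∀ i j, j ∈ splitOne cell l i → splitOne cell l j = splitOne cell l i := by
  intro i j hj
  by_cases hi : i = l
  · subst hi
    simp only [splitOne, if_true, Finset.mem_singleton] at hj
    rw [hj]
  · simp only [splitOne, hi, if_false, Finset.mem_sdiff, Finset.mem_singleton] at hj ⊢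
    simp [hj.2, hc i j hj.1]

/-- All qubits of `D` with a Pauli matrix commuting with `ρ` split off. -/
theorem mem_sepCone_split {cell : Fin N → Finset (Fin N)}
    (hc : ∀ i j, j ∈ cell i → cell j = cell i) (D : Finset (Fin N)) {ρ : Op (Fin N)}
    (h : ρ ∈ sepCone cell)
    (hD : ∀ j ∈ D, ∃ a : Sym, a ≠ .heart ∧ a ≠ .I ∧ Commute (rowOp (single j a)) ρ) :
    ρ ∈ sepCone (fun k => if k ∈ D then {k} else cell k \ D) := by
  induction D using Finset.induction_on generalizing cell with
  | empty => simpa using h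
  | insert j D hj ih =>
    obtain ⟨a, ha, ha', hcomm⟩ := hD j (Finset.mem_insert_self j D)
    have h1 := ih (splitOne_part hc j) (mem_splitOne hc ha ha' h hcomm)
      fun k hk => hD k (Finset.mem_insert_of_mem hk)
    refine sepCone_mono (fun k => ?_) h1
    intro l
    by_cases hkj : k = j <;> by_cases hkD : k ∈ D <;>
      simp [splitOne, hkj, hkD, hj] <;> tauto

/-! ## Compactness -/

/-- By Carathéodory, `dim E + 1` points suffice for every convex combination, so the hull is a
continuous image of the compact product of a simplex and a power of `s`. -/
theorem isCompact_convexHull_of_finiteDimensional {E : Type*} [AddCommGroup E] [Module ℝ E]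
    [TopologicalSpace E] [ContinuousAdd E] [ContinuousSMul ℝ E] [FiniteDimensional ℝ E]
    {s : Set E} (hs : IsCompact s) : IsCompact (convexHull ℝ s) := by
  rcases s.eq_empty_or_nonempty with rfl | ⟨x₀, hx₀⟩
  · simp
  set d := Module.finrank ℝ E + 1
  have hK : IsCompact (stdSimplex ℝ (Fin d) ×ˢ Set.pi Set.univ fun _ : Fin d => s) :=
    (isCompact_stdSimplex ℝ (Fin d)).prod (isCompact_univ_pi fun _ => hs)
  have hf : Continuous fun p : (Fin d → ℝ) × (Fin d → E) => ∑ i, p.1 i • p.2 i := by fun_prop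
  convert hK.image hf
  ext x
  constructor
  · intro hx
    obtain ⟨ι, hι, z, w, hz, hind, hw, hw1, rfl⟩ := eq_pos_convex_span_of_mem_convexHull hx
    have hcard : Fintype.card ι ≤ Fintype.card (Fin d) := by
      rw [Fintype.card_fin]
      exact hind.card_le_finrank_succ.trans (Nat.succ_le_succ (Submodule.finrank_le _))
    obtain ⟨e⟩ := Function.Embedding.nonempty_of_card_le hcard
    have hext : ∀ i, Function.extend e w 0 (e i) = w i := fun i => e.injective.extend_apply _ _ _
    have hextz : ∀ i, Function.extend e z (fun _ => x₀) (e i) = z i :=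
      fun i => e.injective.extend_apply _ _ _
    have hout : ∀ k ∉ Set.range e, Function.extend e w 0 k = 0 := fun k hk => by
      rw [Function.extend_apply' _ _ _ hk]; rfl
    -- A combination of fewer than `d` points is padded with copies of `x₀` of weight zero.
    refine ⟨(Function.extend e w 0, Function.extend e z fun _ => x₀), ⟨⟨fun k => ?_, ?_⟩, ?_⟩, ?_⟩
    · by_cases hk : k ∈ Set.range e
      · obtain ⟨i, rfl⟩ := hk
        simp only [hext]; exact (hw i).le
      · simp only [hout k hk, le_refl]
    · rw [← hw1]
      exact (Fintype.sum_of_injective e e.injective _ _ hout fun i => (hext i).symm).symm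
    · intro k _
      by_cases hk : k ∈ Set.range e
      · obtain ⟨i, rfl⟩ := hk
        simp only [hextz]; exact hz ⟨i, rfl⟩
      · simp only [Function.extend_apply' _ _ _ hk]; exact hx₀
    · refine (Fintype.sum_of_injective e e.injective _ _ (fun k hk => ?_) fun i => ?_).symm
      · simp only [hout k hk, zero_smul]
      · simp only [hext, hextz]
  · rintro ⟨⟨w, z⟩, ⟨hw, hz⟩, rfl⟩
    exact mem_convexHull_of_exists_fintype w z hw.1 hw.2 (fun i => hz i trivial) rfl

/-! ## Separability in terms of the cone -/

/-- Inserts one factor of a tensor product. Writing `τ` as a sum of `|v⟩⟨v|`, the entrywise product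
of `|v⟩⟨v|` and `|ψ⟩⟨ψ|` is the rank-one operator of the pointwise product `vψ`, again a product
vector. -/
theorem hadamard_mem_sepCone {cell : Fin N → Finset (Fin N)} {A : Finset (Fin N)}
    (hA : Block cell A) {τ : Op A} (hτ : τ.PosSemidef) {M : Op (Fin N)} (hM : M ∈ sepCone cell) :
    (Matrix.of fun s t => τ (fun x : A => s x) (fun x : A => t x) * M s t) ∈ sepCone cell := by
  obtain ⟨m, v, rfl⟩ := Matrix.posSemidef_iff_eq_sum_vecMulVec.1 hτ
  induction hM using AddSubmonoid.closure_induction with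
  | mem x hx =>
    obtain ⟨ψ, hψ, rfl⟩ := hx
    have : (Matrix.of fun s t => (∑ i, vecMulVec (v i) (star (v i))) (fun x : A => s x)
        (fun x : A => t x) * pureOp ψ s t) =
        ∑ i, pureOp ((fun s => v i fun x : A => s x) * ψ) := by
      ext s t
      simp only [Matrix.of_apply, Matrix.sum_apply, pureOp, Matrix.vecMulVec_apply, Pi.mul_apply,
        Pi.star_apply, star_mul', Finset.sum_mul]
      exact Finset.sum_congr rfl fun i _ => by ring
    rw [this]
    refine sum_mem fun i _ => pureOp_mem_sepCone (mul_mem (mem_prodFns A hA ?_) hψ)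
    intro s t hst
    exact congrArg (v i) (funext fun x => hst x x.2)
  | zero =>
    convert zero_mem (sepCone cell) using 1
    ext s t; simp
  | add x y _ _ hx hy =>
    convert add_mem hx hy using 1
    ext s t; simp only [Matrix.of_apply, Matrix.add_apply, mul_add]

theorem Assignment.cell_eq_of_mem_segments (γ : Assignment N) {A : Finset (Fin N)}
    (hA : A ∈ γ.segments) {x : Fin N} (hx : x ∈ A) : γ.cell x = A := by
  simp only [segments, Finset.mem_image, Finset.mem_univ, true_and] at hA
  obtain ⟨i, rfl⟩ := hA
  exact γ.cell_eq i x hx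

theorem Assignment.cell_mem_segments (γ : Assignment N) (i : Fin N) : γ.cell i ∈ γ.segments :=
  Finset.mem_image_of_mem _ (Finset.mem_univ i)

theorem Assignment.Separable.mem_sepCone {γ : Assignment N} {ρ : Op (Fin N)} (h : γ.Separable ρ) :
    ρ ∈ sepCone γ.cell := by
  obtain ⟨m, p, τ, hp, -, hτ, hρ⟩ := h
  have key : ∀ k, ∀ F ⊆ γ.segments, (Matrix.of fun s t : Fin N → Fin 2 =>
      ∏ A ∈ F, τ k A (fun x : A => s x) (fun x : A => t x)) ∈ sepCone γ.cell := by
    intro k F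
    induction F using Finset.induction_on with
    | empty =>
      intro _
      convert pureOp_mem_sepCone (one_mem (prodFns γ.cell)) using 1
      ext s t; simp [pureOp, Matrix.vecMulVec_apply]
    | insert A F hA ih =>
      intro hF
      have hAs := hF (Finset.mem_insert_self A F)
      have := hadamard_mem_sepCone (cell := γ.cell) (A := A)
        (fun i hi => (γ.cell_eq_of_mem_segments hAs hi).ge) (hτ k A hAs).1
        (ih ((Finset.subset_insert A F).trans hF))
      convert this using 1
      ext s t
      simp only [Matrix.of_apply, Finset.prod_insert hA]
  have : ρ = ∑ k, (p k : ℂ) • (Matrix.of fun s t : Fin N → Fin 2 =>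
      ∏ A ∈ γ.segments, τ k A (fun x : A => s x) (fun x : A => t x)) := by
    ext s t
    simp only [hρ, Matrix.sum_apply, Matrix.smul_apply, Matrix.of_apply, smul_eq_mul]
  rw [this]
  exact sum_mem fun k _ => smul_mem_sepCone (key k _ subset_rfl) (hp k)

/-- The product over the segments of vectors on the segments. -/
def Assignment.prodVec (γ : Assignment N)
    (u : (A : Finset (Fin N)) → EuclideanSpace ℂ (A → Fin 2)) (s : Fin N → Fin 2) : ℂ :=
  ∏ A ∈ γ.segments, u A fun x : A => s x

/-- The pure product states. -/
def Assignment.pureStates (γ : Assignment N) : Set (Op (Fin N)) :=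
  (fun u => pureOp (γ.prodVec u)) '' {u | ∀ A, ‖u A‖ = 1}

/-- Unit vectors are chosen for all sets of qubits, not only for the segments; the parameter space
is then a full product of spheres, and the state depends continuously on it. -/
theorem Assignment.isCompact_pureStates (γ : Assignment N) : IsCompact γ.pureStates := by
  have h : IsCompact {u : (A : Finset (Fin N)) → EuclideanSpace ℂ (A → Fin 2) | ∀ A, ‖u A‖ = 1} := by
    have := isCompact_univ_pi fun A : Finset (Fin N) =>
      isCompact_sphere (0 : EuclideanSpace ℂ (A → Fin 2)) 1
    convert this using 1
    ext u; simp [Set.mem_pi]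
  refine h.image ?_
  refine continuous_matrix fun s t => ?_
  simp only [pureOp, Matrix.vecMulVec_apply, Pi.star_apply, Assignment.prodVec]
  fun_prop

/-- A bit string on all qubits is the same as a family of bit strings on the segments, so the sum
distributes over the product. This computes traces of product states. -/
theorem Assignment.sum_prod_segments (γ : Assignment N)
    (f : (A : Finset (Fin N)) → (A → Fin 2) → ℂ) :
    ∑ s : Fin N → Fin 2, ∏ A ∈ γ.segments, f A (fun x : A => s x) =
      ∏ A ∈ γ.segments, ∑ a, f A a := by
  rw [← Finset.prod_coe_sort γ.segments fun A => ∑ a, f A a, Finset.prod_univ_sum,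
    Fintype.piFinset_univ]
  refine Fintype.sum_bijective
    (fun (s : Fin N → Fin 2) (A : γ.segments) (x : A.1) => s x) ⟨?_, ?_⟩ _ _ ?_
  · intro s t h
    funext i
    exact congrFun (congrFun h ⟨γ.cell i, γ.cell_mem_segments i⟩) ⟨i, γ.mem_cell i⟩
  · intro h
    refine ⟨fun i => h ⟨γ.cell i, γ.cell_mem_segments i⟩ ⟨i, γ.mem_cell i⟩, ?_⟩
    funext ⟨A, hA⟩ ⟨x, hx⟩
    have key : ∀ (B : Finset (Fin N)) (hB : B ∈ γ.segments) (hxB : x ∈ B), B = A →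
        h ⟨B, hB⟩ ⟨x, hxB⟩ = h ⟨A, hA⟩ ⟨x, hx⟩ := by
      intro B hB hxB e; subst e; rfl
    exact key _ _ _ (γ.cell_eq_of_mem_segments hA hx)
  · intro s
    exact (Finset.prod_coe_sort γ.segments fun A => f A fun x : A => s x).symm

theorem trace_pureOp_of_norm {V : Type} [Fintype V] [DecidableEq V]
    (u : EuclideanSpace ℂ (V → Fin 2)) (h : ‖u‖ = 1) : ∑ a, u a * star (u a) = 1 := by
  have h1 := EuclideanSpace.norm_sq_eq u
  rw [h] at h1
  have : ∀ a, u a * star (u a) = ((‖u a‖ ^ 2 : ℝ) : ℂ) := fun a => by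
    rw [RCLike.star_def, Complex.mul_conj, Complex.normSq_eq_norm_sq]
  simp only [this]
  rw [← Complex.ofReal_sum, ← h1]; simp

theorem Assignment.trace_of_mem_pureStates (γ : Assignment N) {κ : Op (Fin N)}
    (h : κ ∈ γ.pureStates) : κ.trace = 1 := by
  obtain ⟨u, hu, rfl⟩ := h
  have : (pureOp (γ.prodVec u)).trace = ∑ s : Fin N → Fin 2, ∏ A ∈ γ.segments,
      (u A (fun x : A => s x) * star (u A fun x : A => s x)) := by
    simp only [Matrix.trace, Matrix.diag, pureOp, Matrix.vecMulVec_apply, Pi.star_apply,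
      Assignment.prodVec, star_prod, Finset.prod_mul_distrib]
  rw [this, γ.sum_prod_segments fun A a => u A a * star (u A a)]
  exact Finset.prod_eq_one fun A _ => trace_pureOp_of_norm (u A) (hu A)

theorem Assignment.trace_of_mem_convexHull (γ : Assignment N) {κ : Op (Fin N)}
    (h : κ ∈ convexHull ℝ γ.pureStates) : κ.trace = 1 := by
  refine convexHull_min (t := {κ : Op (Fin N) | κ.trace = 1})
    (fun κ => γ.trace_of_mem_pureStates) ?_ h
  intro x hx y hy a b _ _ hab
  simp only [Set.mem_ofPred_eq] at hx hy ⊢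
  rw [Matrix.trace_add, Matrix.trace_smul, Matrix.trace_smul, hx, hy]
  simp only [Complex.real_smul, mul_one]
  exact_mod_cast hab

theorem exists_unit_vector {ι : Type} [Fintype ι] [Nonempty ι] (v : ι → ℂ) :
    ∃ (n : ℂ) (u : EuclideanSpace ℂ ι), ‖u‖ = 1 ∧ ∀ a, v a = n * u a := by
  classical
  by_cases h : WithLp.toLp 2 v = (0 : EuclideanSpace ℂ ι)
  · refine ⟨0, EuclideanSpace.single (Classical.arbitrary ι) 1, by simp, fun a => ?_⟩
    have := congrArg (fun w : EuclideanSpace ℂ ι => w a) h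
    simpa using this
  · have hn : (‖WithLp.toLp 2 v‖ : ℂ) ≠ 0 := by exact_mod_cast norm_ne_zero_iff.2 h
    refine ⟨‖WithLp.toLp 2 v‖, (‖WithLp.toLp 2 v‖ : ℂ)⁻¹ • WithLp.toLp 2 v, ?_, fun a => ?_⟩
    · rw [norm_smul, norm_inv, Complex.norm_real, norm_norm]
      exact inv_mul_cancel₀ (norm_ne_zero_iff.2 h)
    · simp [mul_inv_cancel_left₀ hn]

/-- Collects the arbitrary blocks of a product function into one factor per segment and moves the
norms of the factors into the scalar. -/
theorem Assignment.exists_prodVec (γ : Assignment N) {ψ : (Fin N → Fin 2) → ℂ}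
    (h : ψ ∈ prodFns γ.cell) :
    ∃ (c : ℂ) (u : (A : Finset (Fin N)) → EuclideanSpace ℂ (A → Fin 2)),
      (∀ A, ‖u A‖ = 1) ∧ ∀ s, ψ s = c * γ.prodVec u s := by
  classical
  have h1 : ∃ (c : ℂ) (f : (A : Finset (Fin N)) → (A → Fin 2) → ℂ),
      ∀ s, ψ s = c * ∏ A ∈ γ.segments, f A fun x : A => s x := by
    induction h using Submonoid.closure_induction with
    | mem g hg =>
      obtain ⟨B, hB, hg⟩ := hg
      rcases B.eq_empty_or_nonempty with rfl | ⟨i, hi⟩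
      · exact ⟨g 0, fun _ _ => 1, fun s => by simpa using hg (by simp)⟩
      -- The block lies inside the segment of `i`, so `g` can be read off from the bits there; the
      -- filling by `0` outside is never seen by `g`.
      · refine ⟨1, fun A a => if A = γ.cell i then
          g (fun k => if hk : k ∈ A then a ⟨k, hk⟩ else 0) else 1, fun s => ?_⟩
        rw [Finset.prod_eq_single_of_mem _ (γ.cell_mem_segments i) fun A _ hA =>
          if_neg hA, one_mul]
        beta_reduce
        rw [if_pos rfl]
        refine hg fun k hk => ?_
        rw [dif_pos (hB i hi hk)]
    | one => exact ⟨1, fun _ _ => 1, fun s => by simp⟩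
    | mul x y _ _ hx hy =>
      obtain ⟨c, f, hf⟩ := hx
      obtain ⟨c', f', hf'⟩ := hy
      refine ⟨c * c', fun A a => f A a * f' A a, fun s => ?_⟩
      rw [Pi.mul_apply, hf, hf', Finset.prod_mul_distrib]; ring
  obtain ⟨c, f, hf⟩ := h1
  choose n u hu hn using fun A => exists_unit_vector (f A)
  refine ⟨c * ∏ A ∈ γ.segments, n A, u, hu, fun s => ?_⟩
  rw [hf, Assignment.prodVec, mul_assoc, ← Finset.prod_mul_distrib]
  congr 1
  exact Finset.prod_congr rfl fun A _ => hn A _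

theorem Assignment.exists_convexHull (γ : Assignment N) {ρ : Op (Fin N)} (h : ρ ∈ sepCone γ.cell) :
    ∃ r : ℝ, 0 ≤ r ∧ ∃ κ ∈ convexHull ℝ γ.pureStates, ρ = r • κ := by
  induction h using AddSubmonoid.closure_induction with
  | mem x hx =>
    obtain ⟨ψ, hψ, rfl⟩ := hx
    obtain ⟨c, u, hu, e⟩ := γ.exists_prodVec hψ
    refine ⟨Complex.normSq c, Complex.normSq_nonneg c, _, subset_convexHull ℝ _ ⟨u, hu, rfl⟩, ?_⟩
    ext s t
    simp only [pureOp, Matrix.vecMulVec_apply, Pi.star_apply, e, Matrix.smul_apply,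
      Complex.real_smul, ← Complex.mul_conj, star_mul', RCLike.star_def]
    ring
  | zero =>
    -- Any pure product state serves here, as its coefficient is zero.
    refine ⟨0, le_rfl, pureOp (γ.prodVec fun A => EuclideanSpace.single 0 1),
      subset_convexHull ℝ _ ⟨_, fun A => by simp, rfl⟩, by simp⟩
  | add x y _ _ hx hy =>
    obtain ⟨r, hr, κ, hκ, rfl⟩ := hx
    obtain ⟨r', hr', κ', hκ', rfl⟩ := hy
    rcases (add_nonneg hr hr').eq_or_lt with h0 | h0
    · have h1 : r = 0 := by linarith
      have h2 : r' = 0 := by linarith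
      exact ⟨0, le_rfl, κ, hκ, by simp [h1, h2]⟩
    · refine ⟨r + r', h0.le, (r / (r + r')) • κ + (r' / (r + r')) • κ',
        convex_convexHull ℝ _ hκ hκ' (by positivity) (by positivity) (by field_simp), ?_⟩
      rw [smul_add, smul_smul, smul_smul, mul_div_cancel₀ _ h0.ne', mul_div_cancel₀ _ h0.ne']

theorem Assignment.separable_smul (γ : Assignment N) {κ : Op (Fin N)}
    (h : κ ∈ convexHull ℝ γ.pureStates) {r : ℝ} (h0 : 0 ≤ r) (h1 : r ≤ 1) :
    γ.Separable (r • κ) := by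
  obtain ⟨ι, hι, w, z, hw, hw1, hz, rfl⟩ := mem_convexHull_iff_exists_fintype.1 h
  choose u hu hz using hz
  let e := (Fintype.equivFin ι).symm
  refine ⟨Fintype.card ι, fun k => r * w (e k), fun k A => pureOp (u (e k) A),
    fun k => mul_nonneg h0 (hw _), ?_, fun k A _ => ⟨posSemidef_vecMulVec_self_star _, ?_⟩,
    fun s t => ?_⟩
  · rw [← Finset.mul_sum, e.sum_comp w, hw1, mul_one]; exact h1
  · exact trace_pureOp_of_norm (u (e k) A) (hu _ A)
  · rw [Matrix.smul_apply, Matrix.sum_apply, ← e.sum_comp, Finset.smul_sum]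
    refine Finset.sum_congr rfl fun k _ => ?_
    rw [← hz]
    simp only [Matrix.smul_apply, Complex.real_smul, pureOp, Matrix.vecMulVec_apply, Pi.star_apply,
      Assignment.prodVec, star_prod, Finset.prod_mul_distrib]
    push_cast; ring

/-- Points of the convex hull have trace one, so the scale factor is the trace of `ρ`. -/
theorem Assignment.smul_of_trace_le (γ : Assignment N) {ρ : Op (Fin N)} (h : ρ ∈ sepCone γ.cell)
    (ht : ρ.trace.re ≤ 1) :
    ∃ r : ℝ, 0 ≤ r ∧ r ≤ 1 ∧ ∃ κ ∈ convexHull ℝ γ.pureStates, ρ = r • κ := by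
  obtain ⟨r, hr, κ, hκ, rfl⟩ := γ.exists_convexHull h
  refine ⟨r, hr, ?_, κ, hκ, rfl⟩
  rw [Matrix.trace_smul, γ.trace_of_mem_convexHull hκ] at ht
  simpa using ht

theorem Assignment.separable_of_mem_sepCone (γ : Assignment N) {ρ : Op (Fin N)}
    (h : ρ ∈ sepCone γ.cell) (ht : ρ.trace.re ≤ 1) : γ.Separable ρ := by
  obtain ⟨r, h0, h1, κ, hκ, rfl⟩ := γ.smul_of_trace_le h ht
  exact γ.separable_smul hκ h0 h1

/-- The trace bound places the whole sequence in the image of `[0,1] × hull` under scaling, which is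
compact and therefore closed. -/
theorem Assignment.mem_sepCone_of_tendsto (γ : Assignment N) {a : ℕ → Op (Fin N)} {ρ : Op (Fin N)}
    (ha : ∀ n, a n ∈ sepCone γ.cell) (ht : ∀ n, (a n).trace.re ≤ 1)
    (h : Filter.Tendsto a Filter.atTop (nhds ρ)) : ρ ∈ sepCone γ.cell := by
  have hK : IsCompact ((fun p : ℝ × Op (Fin N) => p.1 • p.2) ''
      (Set.Icc 0 1 ×ˢ convexHull ℝ γ.pureStates)) :=
    (isCompact_Icc.prod (isCompact_convexHull_of_finiteDimensional γ.isCompact_pureStates)).image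
      (by fun_prop)
  obtain ⟨⟨r, κ⟩, ⟨hr, hκ⟩, rfl⟩ := hK.isClosed.mem_of_tendsto h (Filter.Eventually.of_forall
    fun n => by
      obtain ⟨r, h0, h1, κ, hκ, e⟩ := γ.smul_of_trace_le (ha n) (ht n)
      exact ⟨(r, κ), ⟨⟨h0, h1⟩, hκ⟩, e.symm⟩)
  exact (γ.separable_smul hκ hr.1 hr.2).mem_sepCone

/-! ## The concrete semantics -/

theorem isClosed_posSemidef (n : Type) [Fintype n] :
    IsClosed {A : Matrix n n ℂ | A.PosSemidef} := by
  have : {A : Matrix n n ℂ | A.PosSemidef} =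
      {A | Aᴴ = A} ∩ ⋂ x : n → ℂ, {A | 0 ≤ star x ⬝ᵥ (A *ᵥ x)} := by
    ext A
    simp only [Set.mem_inter_iff, Set.mem_iInter, Set.mem_ofPred_eq,
      Matrix.posSemidef_iff_dotProduct_mulVec]
    rfl
  rw [this]
  refine (isClosed_eq (by fun_prop) continuous_id).inter (isClosed_iInter fun x => ?_)
  exact isClosed_le continuous_const (by fun_prop)

/-- For `A` a sum of `|v⟩⟨v|`, use `|v_s v_t| ≤ (|v_s|² + |v_t|²)/2 ≤ ‖v‖²` for each term.
Summability of traces then gives entrywise summability. -/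
theorem norm_apply_le_trace {n : Type} [Fintype n] {A : Matrix n n ℂ} (hA : A.PosSemidef)
    (s t : n) : ‖A s t‖ ≤ A.trace.re := by
  classical
  obtain ⟨m, v, rfl⟩ := Matrix.posSemidef_iff_eq_sum_vecMulVec.1 hA
  have h1 : ∀ (i : Fin m) (a : n), ‖v i a‖ ^ 2 ≤ ∑ b, ‖v i b‖ ^ 2 := fun i a =>
    Finset.single_le_sum (f := fun b => ‖v i b‖ ^ 2) (fun _ _ => by positivity) (Finset.mem_univ a)
  have h2 : (∑ i, vecMulVec (v i) (star (v i))).trace.re = ∑ i, ∑ b, ‖v i b‖ ^ 2 := by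
    rw [Matrix.trace_sum]
    simp only [Matrix.trace, Matrix.diag, Matrix.vecMulVec_apply, Pi.star_apply, RCLike.star_def,
      Complex.mul_conj, Complex.normSq_eq_norm_sq, Complex.re_sum, Complex.ofReal_re]
  rw [h2, Matrix.sum_apply]
  refine (norm_sum_le _ _).trans (Finset.sum_le_sum fun i _ => ?_)
  simp only [Matrix.vecMulVec_apply, Pi.star_apply, norm_mul, norm_star]
  nlinarith [h1 i s, h1 i t, sq_nonneg (‖v i s‖ - ‖v i t‖)]

theorem summable_of_trace_le {n : Type} [Fintype n] {a : ℕ → Matrix n n ℂ}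
    (ha : ∀ k, (a k).PosSemidef) {c : ℝ} (hc : ∀ m, ∑ k ∈ Finset.range m, (a k).trace.re ≤ c) :
    Summable a := by
  have h0 : ∀ k, 0 ≤ (a k).trace.re := fun k => (Complex.le_def.1 (ha k).trace_nonneg).1
  have h1 : Summable fun k => (a k).trace.re := summable_of_sum_range_le h0 hc
  refine Pi.summable.2 fun s => Pi.summable.2 fun t => ?_
  exact h1.of_norm_bounded fun k => norm_apply_le_trace (ha k) s t

theorem ketbra_add : ketbra 0 + ketbra 1 = 1 := by
  ext i j; fin_cases i <;> fin_cases j <;> simp [ketbra]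

theorem ketbra_mul (b : Fin 2) : ketbra b * ketbra b = ketbra b := by
  ext i j; fin_cases b <;> fin_cases i <;> fin_cases j <;>
    simp [ketbra, Matrix.mul_apply]

theorem conjTranspose_ketbra (b : Fin 2) : (ketbra b)ᴴ = ketbra b := by
  ext i j; fin_cases b <;> fin_cases i <;> fin_cases j <;> simp [ketbra]

theorem project_eq (b : Fin 2) (i : Fin N) (ρ : Op (Fin N)) :
    project b i ρ = appOn (ketbra b) i * ρ * (appOn (ketbra b) i)ᴴ := by
  rw [conjTranspose_appOn, conjTranspose_ketbra, project]

theorem posSemidef_project (b : Fin 2) (i : Fin N) {ρ : Op (Fin N)} (h : ρ.PosSemidef) :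
    (project b i ρ).PosSemidef := by
  rw [project_eq]; exact h.mul_mul_conjTranspose_same _

/-- The two measurement outcomes share the trace; this conservation law controls both branches of
`if` and the exits of `while`. -/
theorem trace_project (i : Fin N) (ρ : Op (Fin N)) :
    (project 0 i ρ).trace + (project 1 i ρ).trace = ρ.trace := by
  have h : ∀ b, (project b i ρ).trace = (appOn (ketbra b) i * ρ).trace := fun b => by
    rw [project, Matrix.trace_mul_comm, ← mul_assoc, appOn_mul, ketbra_mul]
  rw [h, h, ← Matrix.trace_add, ← add_mul, ← appOn_add, ketbra_add, appOn_one, one_mul]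

theorem trace_re_nonneg {ρ : Op (Fin N)} (h : ρ.PosSemidef) : 0 ≤ ρ.trace.re :=
  (Complex.le_def.1 h.trace_nonneg).1

theorem trace_project_le (b : Fin 2) (i : Fin N) {ρ : Op (Fin N)} (h : ρ.PosSemidef) :
    (project b i ρ).trace.re ≤ ρ.trace.re := by
  have h1 := congrArg Complex.re (trace_project i ρ)
  have h2 := trace_re_nonneg (posSemidef_project 0 i h)
  have h3 := trace_re_nonneg (posSemidef_project 1 i h)
  rw [Complex.add_re] at h1
  fin_cases b <;> simp only [Fin.zero_eta, Fin.mk_one] <;> linarith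

theorem trace_conj {V : Op (Fin N)} (hV : Vᴴ * V = 1) (ρ : Op (Fin N)) :
    (V * ρ * Vᴴ).trace = ρ.trace := by
  rw [Matrix.trace_mul_comm, ← mul_assoc, hV, one_mul]

/-- The loop body followed by its iterations: the states remain positive semidefinite, and the
exits have total trace at most the trace of the input. -/
theorem iterate_bounds (i : Fin N) {f : Op (Fin N) → Op (Fin N)}
    (hf : ∀ σ : Op (Fin N), σ.PosSemidef →
      (f σ).PosSemidef ∧ (f σ).trace.re ≤ (project 0 i σ).trace.re)
    {ρ : Op (Fin N)} (h : ρ.PosSemidef) (n : ℕ) :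
    (f^[n] ρ).PosSemidef ∧
      (f^[n] ρ).trace.re + ∑ k ∈ Finset.range n, (project 1 i (f^[k] ρ)).trace.re ≤
        ρ.trace.re := by
  induction n with
  | zero => simpa using h
  | succ n ih =>
    rw [Function.iterate_succ_apply', Finset.sum_range_succ]
    obtain ⟨h1, h2⟩ := hf _ ih.1
    refine ⟨h1, ?_⟩
    have h3 := congrArg Complex.re (trace_project i (f^[n] ρ))
    rw [Complex.add_re] at h3
    linarith [ih.2]

theorem sum_exit_le (i : Fin N) {f : Op (Fin N) → Op (Fin N)}
    (hf : ∀ σ : Op (Fin N), σ.PosSemidef →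
      (f σ).PosSemidef ∧ (f σ).trace.re ≤ (project 0 i σ).trace.re)
    {ρ : Op (Fin N)} (h : ρ.PosSemidef) (n : ℕ) :
    ∑ k ∈ Finset.range n, (project 1 i (f^[k] ρ)).trace.re ≤ ρ.trace.re := by
  have h1 := iterate_bounds i hf h n
  linarith [trace_re_nonneg h1.1, h1.2]

theorem tendsto_exit (i : Fin N) {f : Op (Fin N) → Op (Fin N)}
    (hf : ∀ σ : Op (Fin N), σ.PosSemidef →
      (f σ).PosSemidef ∧ (f σ).trace.re ≤ (project 0 i σ).trace.re)
    {ρ : Op (Fin N)} (h : ρ.PosSemidef) :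
    Filter.Tendsto (fun n => ∑ k ∈ Finset.range n, project 1 i (f^[k] ρ)) Filter.atTop
      (nhds (∑' k, project 1 i (f^[k] ρ))) :=
  (summable_of_trace_le (fun k => posSemidef_project 1 i (iterate_bounds i hf h k).1)
    (sum_exit_le i hf h)).hasSum.tendsto_sum_nat

theorem QIL.sem_bounds (C : QIL N) : ∀ ρ : Op (Fin N), ρ.PosSemidef →
    (C.sem ρ).PosSemidef ∧ (C.sem ρ).trace.re ≤ ρ.trace.re := by
  have conj : ∀ V : Op (Fin N), Vᴴ * V = 1 → ∀ ρ : Op (Fin N), ρ.PosSemidef →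
      (V * ρ * Vᴴ).PosSemidef ∧ (V * ρ * Vᴴ).trace.re ≤ ρ.trace.re := fun V hV ρ h =>
    ⟨h.mul_mul_conjTranspose_same V, by rw [trace_conj hV]⟩
  induction C with
  | skip => exact fun ρ h => ⟨h, le_rfl⟩
  | seq C C' ih ih' =>
    intro ρ h
    obtain ⟨h1, h2⟩ := ih ρ h
    obtain ⟨h3, h4⟩ := ih' _ h1
    exact ⟨h3, h4.trans h2⟩
  | gate U i => exact conj _ (appOn_unitary U.unitary i)
  | gateT i => exact conj _ (appOn_unitary matT_unitary i)
  | cx i j hij => exact conj _ (cxOp_unitary hij)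
  | ite i C C' ih ih' =>
    intro ρ h
    obtain ⟨h1, h2⟩ := ih _ (posSemidef_project 0 i h)
    obtain ⟨h3, h4⟩ := ih' _ (posSemidef_project 1 i h)
    refine ⟨h1.add h3, ?_⟩
    have h5 := congrArg Complex.re (trace_project i ρ)
    rw [Complex.add_re] at h5
    rw [QIL.sem, Matrix.trace_add, Complex.add_re]
    linarith
  -- The remaining constructor is `while`: positivity and the trace bound pass to the limit of the
  -- partial sums of exits.
  | _ =>
    rename_i i C ih
    intro ρ h
    have hf : ∀ σ : Op (Fin N), σ.PosSemidef → (C.sem (project 0 i σ)).PosSemidef ∧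
        (C.sem (project 0 i σ)).trace.re ≤ (project 0 i σ).trace.re :=
      fun σ hσ => ih _ (posSemidef_project 0 i hσ)
    have ht := tendsto_exit (f := fun σ => C.sem (project 0 i σ)) i hf h
    refine ⟨(isClosed_posSemidef _).mem_of_tendsto ht (Filter.Eventually.of_forall fun n =>
      Matrix.posSemidef_sum _ fun k _ => posSemidef_project 1 i (iterate_bounds i hf h k).1), ?_⟩
    have hc : Continuous fun A : Op (Fin N) => A.trace.re :=
      Complex.continuous_re.comp (Continuous.matrix_trace continuous_id)
    refine le_of_tendsto ((hc.tendsto _).comp ht) (Filter.Eventually.of_forall fun n => ?_)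
    simp only [Function.comp, Matrix.trace_sum, Complex.re_sum]
    exact sum_exit_le i hf h n

theorem IsPartialDensity.sem {ρ : Op (Fin N)} (h : IsPartialDensity ρ) (C : QIL N) :
    IsPartialDensity (C.sem ρ) :=
  ⟨(C.sem_bounds ρ h.1).1, (C.sem_bounds ρ h.1).2.trans h.2⟩

theorem IsPartialDensity.project {ρ : Op (Fin N)} (h : IsPartialDensity ρ) (b : Fin 2)
    (i : Fin N) : IsPartialDensity (project b i ρ) :=
  ⟨posSemidef_project b i h.1, (trace_project_le b i h.1).trans h.2⟩

/-! ## L-rows of arrays and assignments -/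

/-- A multiplicative property of the L-rows of one representative holds for all L-rows. -/
theorem HasRow.induction {M : Multiset (Row N)} {L : Row N} (h : HasRow (⟦M⟧ : Arr N) L)
    (hL : IsLRow L) {P : Row N → Prop}
    (hmul : ∀ R S, IsLRow R → IsLRow S → P R → P S → P (R * S))
    (hM : ∀ R ∈ M, IsLRow R → P R) : P L := by
  obtain ⟨K, hK⟩ := h
  have hc : Conv M (L ::ₘ K) := (Quotient.exact hK).2
  have key : ∀ {M' : Multiset (Row N)}, Conv M M' → ∀ R ∈ M', IsLRow R → P R := by
    intro M' h
    induction h with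
    | refl => exact hM
    | tail _ h ih =>
      cases h with
      | mul R S M₀ =>
        intro T hT hTL
        rcases Multiset.mem_cons.1 hT with rfl | hT
        -- Since hearts absorb, a product without hearts comes from two L-rows; so heart rows never
        -- contribute to the L-rows of another representative.
        · obtain ⟨hR, hS⟩ := isLRow_mul.1 hTL
          exact hmul R S hR hS (ih R (by simp) hR) (ih S (by simp) hS)
        · exact ih T (Multiset.mem_cons_of_mem hT) hTL
  exact key hc L (Multiset.mem_cons_self L K) hL

theorem hasRow_of_mem {M : Multiset (Row N)} {R : Row N} (h : R ∈ M) :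
    HasRow (⟦M⟧ : Arr N) R := by
  obtain ⟨K, rfl⟩ := Multiset.exists_cons_of_mem h
  exact ⟨K, rfl⟩

theorem HasRow.commute {M : Multiset (Row N)} {L : Row N} (h : HasRow (⟦M⟧ : Arr N) L)
    (hL : IsLRow L) {ρ : Op (Fin N)} (hM : ∀ R ∈ M, IsLRow R → Commute (rowOp R) ρ) :
    Commute (rowOp L) ρ :=
  h.induction hL (P := fun R => Commute (rowOp R) ρ)
    (fun _ _ hR hS h h' => commute_rowOp_mul hR hS h h') hM

theorem HasRow.supportedOn {M : Multiset (Row N)} {L : Row N} (h : HasRow (⟦M⟧ : Arr N) L)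
    (hL : IsLRow L) {A : Finset (Fin N)} (hM : ∀ R ∈ M, IsLRow R → SupportedOn A R) :
    SupportedOn A L :=
  h.induction hL (P := SupportedOn A)
    (fun R S _ _ h h' i hi => by rw [Pi.mul_apply, h i hi, h' i hi]; rfl) hM

/-- The L-rows of an element on the segment `A`; for `I` these are all L-rows on `A`. -/
def Ext.HasLRow (A : Finset (Fin N)) : Ext N → Row N → Prop
  | .unknown, _ => False
  | .mixed, L => IsLRow L ∧ SupportedOn A L
  | .arr q, L => IsLRow L ∧ HasRow q L

theorem Ext.HasLRow.isLRow {A : Finset (Fin N)} {E : Ext N} {L : Row N} (h : E.HasLRow A L) :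
    IsLRow L := by
  cases E
  · exact h.elim
  · exact h.1
  · exact h.1

theorem Ext.hasLRow_ofRows {A : Finset (Fin N)} {M : Multiset (Row N)} {L : Row N}
    (h : (Ext.ofRows M).HasLRow A L) : IsLRow L ∧ HasRow (⟦M⟧ : Arr N) L := by
  unfold Ext.ofRows at h
  split_ifs at h
  · exact h.elim
  · exact h

theorem Ext.HasLRow.pauli_commute {A : Finset (Fin N)} {j : Fin N} {a : Sym} {L : Row N}
    (h : (Ext.pauli j a).HasLRow A L) {ρ : Op (Fin N)} (hρ : Commute (rowOp (single j a)) ρ) :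
    Commute (rowOp L) ρ :=
  h.2.commute h.1 fun R hR _ => by rw [Multiset.mem_singleton.1 hR]; exact hρ

theorem supportedOn_single {A : Finset (Fin N)} {j : Fin N} (hj : j ∈ A) (a : Sym) :
    SupportedOn A (single j a) := fun i hi => by
  have : i ≠ j := fun e => hi (e ▸ hj)
  simp [single, this]

theorem Ext.HasLRow.pauli_supportedOn {A B : Finset (Fin N)} {j : Fin N} (hj : j ∈ B) {a : Sym}
    {L : Row N} (h : (Ext.pauli j a).HasLRow A L) : SupportedOn B L :=
  h.2.supportedOn h.1 fun R hR _ => by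
    rw [Multiset.mem_singleton.1 hR]; exact supportedOn_single hj a

/-- All L-rows are supported on their segment. -/
def Assignment.Supp (γ : Assignment N) : Prop :=
  ∀ i L, (γ.val i).HasLRow (γ.cell i) L → SupportedOn (γ.cell i) L

/-- The operator is in the cone of separable operators and commutes with all L-rows. -/
def Assignment.Good (γ : Assignment N) (ρ : Op (Fin N)) : Prop :=
  ρ ∈ sepCone γ.cell ∧ ∀ i L, (γ.val i).HasLRow (γ.cell i) L → Commute (rowOp L) ρ

theorem Assignment.not_mem_cell (γ : Assignment N) {i k : Fin N} (h : k ∉ γ.cell i) :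
    i ∉ γ.cell k := fun hi => h (by rw [γ.cell_eq k i hi]; exact γ.mem_cell k)

theorem Assignment.Supp.eq_I {γ : Assignment N} (hS : γ.Supp) {i k : Fin N} (h : k ∉ γ.cell i)
    {L : Row N} (hL : (γ.val k).HasLRow (γ.cell k) L) : L i = .I :=
  hS k L hL i (γ.not_mem_cell h)

theorem Assignment.Supp.setVal {γ : Assignment N} (hS : γ.Supp) {i : Fin N} {E : Ext N}
    (hE : ∀ L, E.HasLRow (γ.cell i) L → SupportedOn (γ.cell i) L) : (γ.setVal i E).Supp := by
  intro k L hL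
  by_cases hk : k ∈ γ.cell i
  · simp only [Assignment.setVal, hk, if_true, γ.cell_eq i k hk] at hL ⊢
    exact hE L hL
  · simp only [Assignment.setVal, hk, if_false] at hL ⊢
    exact hS k L hL

theorem Assignment.good_setVal {γ : Assignment N} {i : Fin N} {E : Ext N} {ρ : Op (Fin N)}
    (hρ : ρ ∈ sepCone γ.cell)
    (hE : ∀ L, E.HasLRow (γ.cell i) L → Commute (rowOp L) ρ)
    (h : ∀ k L, k ∉ γ.cell i → (γ.val k).HasLRow (γ.cell k) L → Commute (rowOp L) ρ) :
    (γ.setVal i E).Good ρ := by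
  refine ⟨hρ, fun k L hL => ?_⟩
  by_cases hk : k ∈ γ.cell i
  · simp only [Assignment.setVal, hk, if_true, γ.cell_eq i k hk] at hL
    exact hE L hL
  · simp only [Assignment.setVal, hk, if_false] at hL
    exact h k L hk hL

/-- The pieces of `A` have commuting L-rows. -/
def Pieces.Good (P : Pieces N) (A : Finset (Fin N)) (ρ : Op (Fin N)) : Prop :=
  (∀ j ∈ P.singles, ∃ a : Sym, a ≠ .heart ∧ a ≠ .I ∧ P.basis j = .pauli j a ∧
    Commute (rowOp (single j a)) ρ) ∧
  ∀ L, P.rest.HasLRow (A \ P.singles) L → Commute (rowOp L) ρ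

/-- The L-rows of the pieces of `A` are supported on the pieces. -/
def Pieces.Supp (P : Pieces N) (A : Finset (Fin N)) : Prop :=
  (∀ j ∈ P.singles, ∃ a : Sym, P.basis j = .pauli j a) ∧
  ∀ L, P.rest.HasLRow (A \ P.singles) L → SupportedOn (A \ P.singles) L

theorem Assignment.Supp.split {γ : Assignment N} (hS : γ.Supp) {i : Fin N} {P : Pieces N}
    (hP : P.Supp (γ.cell i)) : (γ.split i P).Supp := by
  intro k L hL
  by_cases hk : k ∈ γ.cell i
  · by_cases hs : k ∈ P.singles
    · simp only [Assignment.split, hk, hs, if_true] at hL ⊢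
      obtain ⟨a, ha⟩ := hP.1 k hs
      rw [ha] at hL
      exact hL.pauli_supportedOn (Finset.mem_singleton_self k)
    · simp only [Assignment.split, hk, hs, if_true, if_false] at hL ⊢
      exact hP.2 L hL
  · simp only [Assignment.split, hk, if_false] at hL ⊢
    exact hS k L hL

theorem Assignment.good_split {γ : Assignment N} {i : Fin N} {P : Pieces N} {ρ : Op (Fin N)}
    (hρ : ρ ∈ sepCone γ.cell) (hP : P.Good (γ.cell i) ρ)
    (h : ∀ k L, k ∉ γ.cell i → (γ.val k).HasLRow (γ.cell k) L → Commute (rowOp L) ρ) :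
    (γ.split i P).Good ρ := by
  refine ⟨?_, fun k L hL => ?_⟩
  -- `P.singles` is not required to lie in the segment, whereas `split` affects only that segment;
  -- hence the intersection.
  · have h1 := mem_sepCone_split γ.cell_eq (P.singles ∩ γ.cell i) hρ fun j hj => by
      obtain ⟨a, h1, h2, -, h3⟩ := hP.1 j (Finset.mem_inter.1 hj).1
      exact ⟨a, h1, h2, h3⟩
    refine sepCone_mono (fun k => ?_) h1
    by_cases hk : k ∈ γ.cell i
    · by_cases hs : k ∈ P.singles
      · simp [Assignment.split, hk, hs]
      · simp only [Assignment.split, hk, hs, Finset.mem_inter, false_and, if_false, if_true,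
          γ.cell_eq i k hk]
        intro l hl
        simp only [Finset.mem_sdiff, Finset.mem_inter] at hl ⊢
        tauto
    · simp [Assignment.split, hk]
  · by_cases hk : k ∈ γ.cell i
    · by_cases hs : k ∈ P.singles
      · simp only [Assignment.split, hk, hs, if_true] at hL
        obtain ⟨a, -, -, ha, hc⟩ := hP.1 k hs
        rw [ha] at hL
        exact hL.pauli_commute hc
      · simp only [Assignment.split, hk, hs, if_true, if_false] at hL
        exact hP.2 L hL
    · simp only [Assignment.split, hk, if_false] at hL
      exact h k L hk hL

/-! ## Splitting off one-qubit stabilizers -/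

theorem basisAt_spec {q : Arr N} {j : Fin N} (h : HasSingle q j) :
    HasRow q (single j (basisAt q j)) := by
  unfold basisAt
  split_ifs with h1 h2
  · exact h1
  · exact h2
  · rcases h with h | h | h
    · exact absurd h h1
    · exact absurd h h2
    · exact h

theorem basisAt_ne (q : Arr N) (j : Fin N) : basisAt q j ≠ .heart ∧ basisAt q j ≠ .I := by
  unfold basisAt
  split_ifs <;> simp

theorem commute_basisAt {q : Arr N} {ρ : Op (Fin N)}
    (hq : ∀ L, IsLRow L → HasRow q L → Commute (rowOp L) ρ) {J : Finset (Fin N)} {j : Fin N}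
    (hj : j ∈ splitSet J q) : Commute (rowOp (single j (basisAt q j))) ρ := by
  simp only [splitSet, Finset.mem_filter] at hj
  have := basisAt_spec hj.2
  exact hq _ (isLRow_single (basisAt_ne q j).1) this

variable {rep : (Multiset (Row N) → Prop) → Multiset (Row N)}

/-- The rows of the remainder belong to a representative of `q` itself, so they inherit commutation.
-/
theorem good_update (hrep : IsRepChoice rep) (J A : Finset (Fin N)) {q : Arr N} {ρ : Op (Fin N)}
    (hq : ∀ L, IsLRow L → HasRow q L → Commute (rowOp L) ρ) :
    (update rep J A q).Good A ρ := by
  refine ⟨fun j hj => ⟨basisAt q j, (basisAt_ne q j).1, (basisAt_ne q j).2, rfl,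
    commute_basisAt hq hj⟩, fun L hL => ?_⟩
  simp only [update] at hL
  split_ifs at hL with h
  · obtain ⟨h1, h2⟩ := Ext.hasLRow_ofRows hL
    obtain ⟨-, h3⟩ := hrep _ h
    refine h2.commute h1 fun R hR hRL => hq R hRL ?_
    rw [← h3]
    exact hasRow_of_mem (Multiset.mem_add.2 (.inr hR))
  · exact hL.elim

theorem supp_update (hrep : IsRepChoice rep) (J A : Finset (Fin N)) (q : Arr N) :
    (update rep J A q).Supp A := by
  refine ⟨fun j _ => ⟨basisAt q j, rfl⟩, fun L hL => ?_⟩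
  simp only [update] at hL ⊢
  split_ifs at hL with h
  · obtain ⟨h1, h2⟩ := Ext.hasLRow_ofRows hL
    exact h2.supportedOn h1 fun R hR _ => (hrep _ h).1 R hR
  · exact hL.elim

theorem good_updateE (hrep : IsRepChoice rep) (J A : Finset (Fin N)) {E : Ext N} {ρ : Op (Fin N)}
    (hE : ∀ L, E.HasLRow A L → Commute (rowOp L) ρ) : (updateE rep J A E).Good A ρ := by
  cases E with
  | unknown => exact ⟨fun j hj => by simp [updateE] at hj, fun L hL => hL.elim⟩
  | mixed =>
    exact ⟨fun j hj => by simp [updateE] at hj, fun L hL => hE L (by simpa [updateE] using hL)⟩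
  | arr q =>
    have hq : ∀ L, IsLRow L → HasRow q L → Commute (rowOp L) ρ := fun L h h' => hE L ⟨h, h'⟩
    simp only [updateE]
    split_ifs with h1 h2
    · exact good_update hrep J A hq
    · exact ⟨fun j hj => by simp [h2] at hj, fun L hL => hq L hL.1 hL.2⟩
    · exact ⟨fun j hj => ⟨basisAt q j, (basisAt_ne q j).1, (basisAt_ne q j).2, rfl,
        commute_basisAt hq hj⟩, fun L hL => hL.elim⟩

theorem supp_updateE (hrep : IsRepChoice rep) (J A : Finset (Fin N)) {E : Ext N}
    (hE : ∀ L, E.HasLRow A L → SupportedOn A L) : (updateE rep J A E).Supp A := by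
  cases E with
  | unknown => exact ⟨fun j hj => by simp [updateE] at hj, fun L hL => hL.elim⟩
  | mixed => exact ⟨fun j hj => by simp [updateE] at hj, fun L hL => hL.2⟩
  | arr q =>
    simp only [updateE]
    split_ifs with h1 h2
    · exact supp_update hrep J A q
    · refine ⟨fun j hj => by simp [h2] at hj, fun L hL => ?_⟩
      simp only [h2, Finset.sdiff_empty]
      exact hE L hL
    · exact ⟨fun j _ => ⟨basisAt q j, rfl⟩, fun L hL => hL.elim⟩

/-! ## One-qubit gates -/

theorem Ext.HasLRow.of_conj {A : Finset (Fin N)} {U : Clifford1} {i : Fin N} {E : Ext N}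
    {L : Row N} (h : (E.conj U i).HasLRow A L) {P : Row N → Prop}
    (hmul : ∀ R S, IsLRow R → IsLRow S → P R → P S → P (R * S))
    (hP : ∀ R, E.HasLRow A R → P (U.conjRow i R)) : P L := by
  cases E with
  | unknown => exact h.elim
  | mixed =>
    -- Without signs, conjugation is an involution on rows, so every L-row of `I` is the conjugate
    -- of another one.
    rw [← U.conjRow_conjRow i L]
    exact hP _ ⟨(U.isLRow_conjRow i L).2 h.1, U.supportedOn_conjRow i h.2⟩
  | arr q =>
    induction q using Quotient.inductionOn with
    | h M =>
      refine HasRow.induction (M := M.map (U.conjRow i)) h.2 h.1 hmul fun R hR hRL => ?_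
      obtain ⟨R', hR', rfl⟩ := Multiset.mem_map.1 hR
      exact hP R' ⟨(U.isLRow_conjRow i R').1 hRL, hasRow_of_mem hR'⟩

theorem supportedOn_mul {A : Finset (Fin N)} (R S : Row N) (_ : IsLRow R) (_ : IsLRow S)
    (h : SupportedOn A R) (h' : SupportedOn A S) : SupportedOn A (R * S) := fun i hi => by
  rw [Pi.mul_apply, h i hi, h' i hi]; rfl

theorem Assignment.Supp.gate {γ : Assignment N} (hS : γ.Supp) (U : Clifford1) (i : Fin N) :
    (γ.setVal i ((γ.val i).conj U i)).Supp :=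
  hS.setVal fun _ hL => hL.of_conj supportedOn_mul fun R hR =>
    U.supportedOn_conjRow i (hS i R hR)

theorem Assignment.Good.gate {γ : Assignment N} (hS : γ.Supp) {ρ : Op (Fin N)} (h : γ.Good ρ)
    (U : Clifford1) (i : Fin N) :
    (γ.setVal i ((γ.val i).conj U i)).Good (appOn U.mat i * ρ * (appOn U.mat i)ᴴ) := by
  refine Assignment.good_setVal (appOn_conj_mem γ.mem_cell γ.cell_eq _ i h.1) (fun L hL => ?_)
    fun k L hk hL => ?_
  · exact hL.of_conj (P := fun L => Commute (rowOp L) _)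
      (fun R S hR hS h h' => commute_rowOp_mul hR hS h h')
      fun R hR => U.commute_conjRow i R (h.2 i R hR)
  · have h1 := U.commute_conjRow i L (h.2 k L hL)
    have h2 : U.conjRow i L = L := by
      have h3 : U.conj .I = .I := by cases U <;> rfl
      funext l
      by_cases hl : l = i
      · subst hl; simp [Clifford1.conjRow, hS.eq_I hk hL, h3]
      · simp [Clifford1.conjRow, hl]
    rwa [h2] at h1

/-! ### Diagonal operators and the gate `T` -/

theorem commute_conj_of_commute {ρ V K : Op (Fin N)} (hV : Vᴴ * V = 1) (hK : Commute K V)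
    (h : Commute K ρ) : Commute K (V * ρ * Vᴴ) :=
  commute_conj (c := 1) hV (by rw [one_smul]; exact hK.symm.eq) one_ne_zero h

theorem Sym.mat_diag {a : Sym} (ha : ¬ a.Flips) (U : Matrix (Fin 2) (Fin 2) ℂ) (h : U 0 1 = 0)
    (h' : U 1 0 = 0) : U * a.mat = a.mat * U := by
  cases a
  case X => exact absurd (.inl rfl) ha
  case Y => exact absurd (.inr rfl) ha
  all_goals
    ext i j; fin_cases i <;> fin_cases j <;>
      simp [Sym.mat, Matrix.mul_apply, Fin.sum_univ_two, h, h']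

theorem commute_diag {L : Row N} {i : Fin N} (h : ¬ (L i).Flips) (U : Matrix (Fin 2) (Fin 2) ℂ)
    (h0 : U 0 1 = 0) (h1 : U 1 0 = 0) : Commute (rowOp L) (appOn U i) :=
  commute_appOn_rowOp U i L (Sym.mat_diag h U h0 h1)

theorem not_flips_I : ¬ Sym.I.Flips := by simp [Sym.Flips]

theorem exists_diag (U : Matrix (Fin 2) (Fin 2) ℂ) (h0 : U 0 1 = 0) (h1 : U 1 0 = 0) :
    U = ((U 0 0 + U 1 1) / 2) • 1 + ((U 0 0 - U 1 1) / 2) • Sym.Z.mat := by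
  ext i j; fin_cases i <;> fin_cases j <;> simp [Sym.mat, h0, h1] <;> ring

/-- Diagonal operators on a qubit commute with everything that commutes with `Z`. -/
theorem commute_appOn_of_Z {i : Fin N} {ρ : Op (Fin N)} (h : Commute (rowOp (single i .Z)) ρ)
    (U : Matrix (Fin 2) (Fin 2) ℂ) (h0 : U 0 1 = 0) (h1 : U 1 0 = 0) : Commute (appOn U i) ρ := by
  rw [exists_diag U h0 h1, appOn_add, appOn_smul, appOn_smul, appOn_one, ← rowOp_single]
  exact ((Commute.one_left ρ).smul_left _).add_left (h.smul_left _)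

theorem matT_offDiag : matT 0 1 = 0 ∧ matT 1 0 = 0 := by simp [matT]

/-- Exactly the rows that `T` could disturb acquire a heart; the L-rows left over are old rows
commuting with `T`. -/
theorem isLRow_heartCol {i : Fin N} {R : Row N} (h : IsLRow (heartCol i R)) :
    IsLRow R ∧ ¬ (R i).Flips := by
  have h1 : ¬ (R i).Flips := by
    intro hf
    refine h i ?_
    rw [heartCol, if_pos ⟨rfl, hf⟩]
  refine ⟨fun k hk => h k ?_, h1⟩
  simp [heartCol, hk]

theorem heartCol_eq {i : Fin N} {R : Row N} (h : ¬ (R i).Flips) : heartCol i R = R := by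
  funext k
  simp only [heartCol]
  rw [if_neg]
  rintro ⟨rfl, hk⟩
  exact h hk

/-- The L-rows after a `T` gate are generated by L-rows that do not flip the qubit. -/
theorem Ext.HasLRow.of_gateT (hrep : IsRepChoice rep) {A : Finset (Fin N)} {i : Fin N} {E : Ext N}
    {L : Row N} (h : (E.gateT rep i).HasLRow A L) {P : Row N → Prop}
    (hmul : ∀ R S, IsLRow R → IsLRow S → P R → P S → P (R * S))
    (hmixed : E = .mixed → P L)
    (hP : ∀ R, E.HasLRow A R → ¬ (R i).Flips → P R) : P L := by
  cases E with
  | unknown => exact h.elim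
  | mixed => exact hmixed rfl
  | arr q =>
    simp only [Ext.gateT] at h
    split_ifs at h with h1 h2
    · obtain ⟨M, rfl, hM⟩ := h1
      exact h.2.induction h.1 hmul fun R hR hRL => hP R ⟨hRL, hasRow_of_mem hR⟩ (hM R hR)
    · obtain ⟨hq, -⟩ := hrep _ h2
      refine h.2.induction h.1 hmul fun R hR hRL => ?_
      obtain ⟨R', hR', rfl⟩ := Multiset.mem_map.1 hR
      obtain ⟨h3, h4⟩ := isLRow_heartCol hRL
      rw [heartCol_eq h4]
      refine hP R' ⟨h3, ?_⟩ h4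
      have := hasRow_of_mem hR'
      rwa [hq] at this
    · exact h.elim

theorem Assignment.Supp.gateT (hrep : IsRepChoice rep) {γ : Assignment N} (hS : γ.Supp)
    (i : Fin N) : (γ.setVal i ((γ.val i).gateT rep i)).Supp := by
  refine hS.setVal fun L hL => hL.of_gateT hrep supportedOn_mul (fun e => ?_) fun R hR _ =>
    hS i R hR
  rw [e] at hL
  exact hL.2

theorem Assignment.Good.gateT (hrep : IsRepChoice rep) {γ : Assignment N} (hS : γ.Supp)
    {ρ : Op (Fin N)} (h : γ.Good ρ) (i : Fin N) :
    (γ.setVal i ((γ.val i).gateT rep i)).Good (appOn matT i * ρ * (appOn matT i)ᴴ) := by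
  obtain ⟨h0, h1⟩ := matT_offDiag
  have hu : (appOn matT i : Op (Fin N))ᴴ * appOn matT i = 1 := appOn_unitary matT_unitary i
  refine Assignment.good_setVal (appOn_conj_mem γ.mem_cell γ.cell_eq _ i h.1) (fun L hL => ?_)
    fun k L hk hL => ?_
  · refine hL.of_gateT (P := fun L => Commute (rowOp L) _) hrep
      (fun R S hR hS h h' => commute_rowOp_mul hR hS h h') (fun e => ?_) fun R hR hf =>
      commute_conj_of_commute hu (commute_diag hf _ h0 h1) (h.2 i R hR)
    rw [e] at hL
    -- On `I` the gate leaves the state fixed: `T` is a combination of `1` and `Z`, and `Z` is among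
    -- the L-rows of `I`.
    have hZ : Commute (rowOp (single i .Z)) ρ := h.2 i _ (by
      rw [e]
      exact ⟨isLRow_single (by simp), supportedOn_single (γ.mem_cell i) _⟩)
    have : appOn matT i * ρ * (appOn matT i)ᴴ = ρ := by
      rw [(commute_appOn_of_Z hZ matT h0 h1).eq, mul_assoc, mul_eq_one_comm.1 hu, mul_one]
    rw [this]
    exact h.2 i L (by rw [e]; exact hL)
  · refine commute_conj_of_commute hu (commute_diag ?_ _ h0 h1) (h.2 k L hL)
    rw [hS.eq_I hk hL]
    exact not_flips_I

/-! ## Measurement -/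

theorem project_mem_sepCone (γ : Assignment N) (b : Fin 2) (i : Fin N) {ρ : Op (Fin N)}
    (h : ρ ∈ sepCone γ.cell) : project b i ρ ∈ sepCone γ.cell := by
  rw [project_eq]; exact appOn_conj_mem γ.mem_cell γ.cell_eq _ i h

theorem ketbra_offDiag (b : Fin 2) : ketbra b 0 1 = 0 ∧ ketbra b 1 0 = 0 := by
  fin_cases b <;> simp [ketbra]

theorem commute_project {b : Fin 2} {i : Fin N} {L : Row N} (hf : ¬ (L i).Flips)
    {ρ : Op (Fin N)} (h : Commute (rowOp L) ρ) : Commute (rowOp L) (project b i ρ) := by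
  have h1 := commute_diag hf (ketbra b) (ketbra_offDiag b).1 (ketbra_offDiag b).2
  exact (h1.mul_right h).mul_right h1

/-- `Z` acts on `|b⟩⟨b|` from either side as the same sign, whatever `ρ` is. The sign is the only
trace of the outcome, so one abstract result serves both. -/
theorem commute_Z_project (b : Fin 2) (i : Fin N) (ρ : Op (Fin N)) :
    Commute (rowOp (single i .Z)) (project b i ρ) := by
  have h : ∃ c : ℂ, Sym.Z.mat * ketbra b = c • ketbra b ∧ ketbra b * Sym.Z.mat = c • ketbra b := by
    fin_cases b
    · exact ⟨1, by ext i j; fin_cases i <;> fin_cases j <;> simp [Sym.mat, ketbra, Matrix.mul_apply],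
        by ext i j; fin_cases i <;> fin_cases j <;> simp [Sym.mat, ketbra, Matrix.mul_apply]⟩
    · exact ⟨-1, by ext i j; fin_cases i <;> fin_cases j <;> simp [Sym.mat, ketbra, Matrix.mul_apply],
        by ext i j; fin_cases i <;> fin_cases j <;> simp [Sym.mat, ketbra, Matrix.mul_apply]⟩
  obtain ⟨c, h1, h2⟩ := h
  rw [rowOp_single, Commute, SemiconjBy, project]
  simp only [← mul_assoc, appOn_mul, h1]
  simp only [mul_assoc, appOn_mul, h2]
  simp only [appOn_smul, smul_mul_assoc, mul_smul_comm]

theorem Row.mul_self {R : Row N} (hR : IsLRow R) : R * R = 1 := by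
  funext k
  have : ∀ a : Sym, a ≠ .heart → a * a = 1 := by intro a; cases a <;> decide
  exact this _ (hR k)

/-- Multiplying rows by a fixed L-row gives an equivalent array. -/
theorem mk_map_mul {R : Row N} (hR : IsLRow R) (p : Row N → Prop) [DecidablePred p]
    (K M : Multiset (Row N)) :
    (⟦R ::ₘ (K.map (fun S => if p S then S * R else S) + M)⟧ : Arr N) = ⟦R ::ₘ (K + M)⟧ := by
  induction K using Multiset.induction_on generalizing M with
  | empty => simp
  | cons S K ih =>
    have step : ∀ T M', (⟦R ::ₘ (T * R) ::ₘ M'⟧ : Arr N) = ⟦R ::ₘ T ::ₘ M'⟧ := by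
      intro T M'
      have h1 : ∀ T : Row N, Conv (R ::ₘ T ::ₘ M') (R ::ₘ (T * R) ::ₘ M') := fun T => by
        rw [Multiset.cons_swap R T, Multiset.cons_swap R (T * R)]
        exact .single (.mul T R M')
      refine Quotient.sound ⟨?_, h1 T⟩
      -- Multiplying by `R` twice restores `T`, because an L-row squares to the identity; this gives
      -- the reverse conversion.
      have := h1 (T * R)
      rwa [mul_assoc, Row.mul_self hR, mul_one] at this
    have e : (⟦R ::ₘ ((S ::ₘ K).map (fun S => if p S then S * R else S) + M)⟧ : Arr N) =
        ⟦R ::ₘ S ::ₘ (K.map (fun S => if p S then S * R else S) + M)⟧ := by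
      rw [Multiset.map_cons, Multiset.cons_add]
      split_ifs
      · exact step _ _
      · rfl
    rw [e, ← Multiset.add_cons, ih, Multiset.add_cons, Multiset.cons_add]

/-- A heart-free array in which some row flips the qubit has a representative with one such row. -/
theorem exists_oneFlip {i : Fin N} {M : Multiset (Row N)} (hM : ∀ R ∈ M, IsLRow R) {R : Row N}
    (hR : R ∈ M) (hf : (R i).Flips) : ∃ K, OneFlip i (⟦M⟧ : Arr N) K := by
  classical
  obtain ⟨K, rfl⟩ := Multiset.exists_cons_of_mem hR
  refine ⟨K.map (fun S => if (S i).Flips then S * R else S), R, ?_, hf, ?_⟩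
  · simpa using mk_map_mul (hM R hR) (fun S => (S i).Flips) K 0
  · intro S hS
    obtain ⟨T, hT, rfl⟩ := Multiset.mem_map.1 hS
    have hT' := hM T (Multiset.mem_cons_of_mem hT) i
    have h1 : ∀ a b : Sym, a.Flips → b.Flips → a * b = .I ∨ a * b = .Z := by
      rintro a b (rfl | rfl) (rfl | rfl) <;> decide
    have h2 : ∀ a : Sym, a ≠ .heart → ¬ a.Flips → a = .I ∨ a = .Z := by
      intro a; cases a <;> simp [Sym.Flips]
    split_ifs with h
    · exact h1 _ _ h hf
    · exact h2 _ hT' h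

theorem not_flips_of {a : Sym} (h : a = .I ∨ a = .Z) : ¬ a.Flips := by
  rcases h with rfl | rfl <;> simp [Sym.Flips]

/-- The row replaced is the only one that need not commute with the projection. If no such
representative exists, then no row of the stabilizer flips qubit `i` at all, by `exists_oneFlip`. -/
theorem commute_measSt (hrep : IsRepChoice rep) {A : Finset (Fin N)} {i : Fin N} {q : Arr N}
    (hst : IsStabilizer A q) {b : Fin 2} {ρ : Op (Fin N)}
    (hq : ∀ L, IsLRow L → HasRow q L → Commute (rowOp L) ρ) (L : Row N) (hL : IsLRow L)
    (h : HasRow (measSt rep i q) L) : Commute (rowOp L) (project b i ρ) := by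
  simp only [measSt] at h
  split_ifs at h with h1
  · obtain ⟨R, e, -, hM⟩ := hrep _ h1
    refine h.commute hL fun S hS hSL => ?_
    rcases Multiset.mem_cons.1 hS with rfl | hS
    · exact commute_Z_project b i ρ
    · refine commute_project (not_flips_of (hM S hS)) (hq S hSL ?_)
      have := hasRow_of_mem (Multiset.mem_cons_of_mem (a := S) (b := R) hS)
      rwa [e] at this
  · obtain ⟨M, rfl, -, hM, -⟩ := hst
    refine h.commute hL fun S hS hSL => commute_project (fun hf => ?_) (hq S hSL (hasRow_of_mem hS))
    exact h1 (exists_oneFlip (fun R hR => (hM R hR).2) hS hf)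

theorem eraseCol_eq_mul (i : Fin N) {R : Row N} (h : R i ≠ .heart) :
    eraseCol i R = R * single i (R i) := by
  have h1 : ∀ a : Sym, a ≠ .heart → a * a = .I := by intro a; cases a <;> decide
  funext k
  by_cases hk : k = i
  · subst hk; simp [eraseCol, single, h1 _ h]
  · simp only [eraseCol, single, Pi.mul_apply, Function.update_of_ne hk]
    exact (mul_one (R k)).symm

theorem isLRow_of_eraseCol {i : Fin N} {R : Row N} (h : IsLRow (eraseCol i R))
    (hi : R i ≠ .heart) : IsLRow R := fun k => by
  by_cases hk : k = i
  · rwa [hk]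
  · have := h k
    rwa [eraseCol, Function.update_of_ne hk] at this

theorem ne_heart_of {a : Sym} (h : a = .I ∨ a = .Z) : a ≠ .heart := by
  rcases h with rfl | rfl <;> simp

theorem hasLRow_erase (hrep : IsRepChoice rep) {A : Finset (Fin N)} {i : Fin N} {q : Arr N}
    (hex : ∃ M, OneFlip i q M) {L : Row N}
    (h : (Ext.ofRows ((rep (OneFlip i q)).map (eraseCol i))).HasLRow A L) {P : Row N → Prop}
    (hmul : ∀ R S, IsLRow R → IsLRow S → P R → P S → P (R * S))
    (hP : ∀ R, IsLRow R → HasRow q R → (R i = .I ∨ R i = .Z) → P (eraseCol i R)) : P L := by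
  obtain ⟨T, e, -, hM⟩ := hrep _ hex
  obtain ⟨h1, h2⟩ := Ext.hasLRow_ofRows h
  refine h2.induction h1 hmul fun R hR hRL => ?_
  obtain ⟨S, hS, rfl⟩ := Multiset.mem_map.1 hR
  have hS' := hM S hS
  refine hP S (isLRow_of_eraseCol hRL (ne_heart_of hS')) ?_ hS'
  have := hasRow_of_mem (Multiset.mem_cons_of_mem (a := S) (b := T) hS)
  rwa [e] at this

/-- Erasing an entry `Z` means multiplying by `Z_i`, which commutes with every projected state. -/
theorem commute_eraseCol {i : Fin N} {R : Row N} (hR : IsLRow R) (h : R i = .I ∨ R i = .Z)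
    {b : Fin 2} {ρ : Op (Fin N)} (hρ : Commute (rowOp R) ρ) :
    Commute (rowOp (eraseCol i R)) (project b i ρ) := by
  rw [eraseCol_eq_mul i (hR i)]
  refine commute_rowOp_mul hR (isLRow_single (hR i)) (commute_project (not_flips_of h) hρ) ?_
  rcases h with h | h
  · rw [h, rowOp_single]
    simp [Sym.mat, appOn_one]
  · rw [h]; exact commute_Z_project b i ρ

theorem supportedOn_eraseCol {A : Finset (Fin N)} {i : Fin N} {R : Row N}
    (h : SupportedOn A R) : SupportedOn (A \ {i}) (eraseCol i R) := fun k hk => by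
  by_cases hki : k = i
  · subst hki; simp [eraseCol]
  · rw [eraseCol, Function.update_of_ne hki]
    exact h k fun hkA => hk (by simp [hkA, hki])

theorem sdiff_insert_eq (A S : Finset (Fin N)) (i : Fin N) :
    A \ insert i S = (A \ {i}) \ S := by
  ext k; simp only [Finset.mem_sdiff, Finset.mem_insert, Finset.mem_singleton]; tauto

theorem Pieces.Good.insert {P : Pieces N} {A : Finset (Fin N)} {i : Fin N} {ρ : Op (Fin N)}
    (hP : P.Good (A \ {i}) ρ) (hZ : Commute (rowOp (single i .Z)) ρ) :
    (⟨insert i P.singles, Function.update P.basis i (.pauli i .Z), P.rest⟩ : Pieces N).Good A ρ := by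
  refine ⟨fun j hj => ?_, fun L hL => hP.2 L (by rwa [← sdiff_insert_eq])⟩
  by_cases hji : j = i
  · subst hji
    exact ⟨.Z, by simp, by simp, by simp, hZ⟩
  · obtain ⟨a, h1, h2, h3, h4⟩ := hP.1 j ((Finset.mem_insert.1 hj).resolve_left hji)
    exact ⟨a, h1, h2, by simp [hji, h3], h4⟩

theorem Pieces.Supp.insert {P : Pieces N} {A : Finset (Fin N)} {i : Fin N}
    (hP : P.Supp (A \ {i})) :
    (⟨insert i P.singles, Function.update P.basis i (.pauli i .Z), P.rest⟩ : Pieces N).Supp A := by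
  refine ⟨fun j hj => ?_, fun L hL => ?_⟩
  · by_cases hji : j = i
    · subst hji
      exact ⟨.Z, by simp⟩
    · obtain ⟨a, h3⟩ := hP.1 j ((Finset.mem_insert.1 hj).resolve_left hji)
      exact ⟨a, by simp [hji, h3]⟩
  · simp only [sdiff_insert_eq] at hL ⊢
    exact hP.2 L hL

theorem Pieces.good_default {A : Finset (Fin N)} {i : Fin N} {ρ : Op (Fin N)}
    (hZ : Commute (rowOp (single i .Z)) ρ) :
    (⟨{i}, fun _ => .pauli i .Z, .unknown⟩ : Pieces N).Good A ρ :=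
  ⟨fun j hj => ⟨.Z, by simp, by simp, by rw [Finset.mem_singleton.1 hj],
    by rwa [Finset.mem_singleton.1 hj]⟩, fun L hL => hL.elim⟩

theorem Pieces.supp_default (A : Finset (Fin N)) (i : Fin N) :
    (⟨{i}, fun _ => .pauli i .Z, .unknown⟩ : Pieces N).Supp A :=
  ⟨fun j hj => ⟨.Z, by rw [Finset.mem_singleton.1 hj]⟩, fun L hL => hL.elim⟩

theorem Assignment.Supp.measE (hrep : IsRepChoice rep) {γ : Assignment N} (hS : γ.Supp)
    (i : Fin N) : (measE rep i γ).Supp := by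
  have hi := hS i
  unfold ExtStab.measE
  split_ifs with hc
  · exact hS.setVal fun L hL => hL.pauli_supportedOn (γ.mem_cell i)
  · split
    · rename_i q hq
      rw [hq] at hi
      split_ifs with h1 h2
      · exact hS.split (supp_update hrep _ _ _)
      · exact hS.split (Pieces.Supp.insert (supp_updateE hrep _ _ fun L hL =>
          hasLRow_erase hrep h2 hL supportedOn_mul fun R hR hqR _ =>
            supportedOn_eraseCol (hi R ⟨hR, hqR⟩)))
      · exact hS.split (Pieces.supp_default _ i)
    · exact hS.split (Pieces.supp_default _ i)

/-- The projection is local, so it respects the old partition. The finer one comes from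
`good_split`, because the detached qubits carry Pauli matrices commuting with the projected state.
-/
theorem Assignment.Good.measE (hrep : IsRepChoice rep) {γ : Assignment N} (hS : γ.Supp)
    {ρ : Op (Fin N)} (h : γ.Good ρ) (i : Fin N) (b : Fin 2) :
    (measE rep i γ).Good (project b i ρ) := by
  have hi := h.2 i
  have hsep := project_mem_sepCone γ b i h.1
  have hZ := commute_Z_project b i ρ
  have hoff : ∀ k L, k ∉ γ.cell i → (γ.val k).HasLRow (γ.cell k) L →
      Commute (rowOp L) (project b i ρ) := fun k L hk hL =>
    commute_project (by rw [hS.eq_I hk hL]; exact not_flips_I) (h.2 k L hL)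
  unfold ExtStab.measE
  split_ifs with hc
  · exact Assignment.good_setVal hsep (fun L hL => hL.pauli_commute hZ) hoff
  · split
    · rename_i q hq
      rw [hq] at hi
      split_ifs with h1 h2
      · exact Assignment.good_split hsep (good_update hrep _ _
          (commute_measSt hrep h1 fun L hL hqL => hi L ⟨hL, hqL⟩)) hoff
      · refine Assignment.good_split hsep (Pieces.Good.insert (good_updateE hrep _ _ fun L hL =>
          hasLRow_erase (P := fun L => Commute (rowOp L) _) hrep h2 hL
            (fun R S hR hS h h' => commute_rowOp_mul hR hS h h') fun R hR hqR hRi =>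
            commute_eraseCol hR hRi (hi R ⟨hR, hqR⟩)) hZ) hoff
      · exact Assignment.good_split hsep (Pieces.good_default hZ) hoff
    · exact Assignment.good_split hsep (Pieces.good_default hZ) hoff

/-! ## Controlled-X -/

theorem appOn_mul_apply (U : Matrix (Fin 2) (Fin 2) ℂ) (i : Fin N) (K : Op (Fin N))
    (s t : Fin N → Fin 2) :
    (appOn U i * K) s t = ∑ b, U (s i) b * K (Function.update s i b) t := by
  rw [← appOn_mulVec U i fun s => K s t]
  simp [Matrix.mul_apply, Matrix.mulVec, dotProduct]

theorem cxOp_eq {i j : Fin N} (h : i ≠ j) :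
    (cxOp i j : Op (Fin N)) =
      appOn (ketbra 0) i + appOn Sym.X.mat j * appOn (ketbra 1) i := by
  have e : (1 : Fin 2) + 1 = 0 := rfl
  have h1 := cxOp_mul_apply h (1 : Op (Fin N))
  ext s t
  have h2 := appOn_mul_apply (ketbra 0) i (1 : Op (Fin N)) s t
  have h3 := appOn_mul_apply (ketbra 1) i (1 : Op (Fin N))
  simp only [mul_one] at h1 h2 h3
  rw [Matrix.add_apply, h1, h2, appOn_mul_apply]
  simp only [h3, Function.update_of_ne h, Fin.sum_univ_two]
  have hs : s i = 0 ∨ s i = 1 := by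
    generalize s i = x; fin_cases x <;> simp
  have hsj : s j = 0 ∨ s j = 1 := by
    generalize s j = x; fin_cases x <;> simp
  have hu : ∀ x, Function.update (Function.update s j x) i (s i) = Function.update s j x := fun x => by
    rw [Function.update_comm h.symm, Function.update_eq_self]
  rcases hs with hs | hs
  · have : cxFun i j s = s := by simp [cxFun, hs]
    rw [this, hs]
    have hu' := Function.update_eq_self i s
    rw [hs] at hu'
    simp [ketbra, Matrix.one_apply, hu']
  · rw [hs] at hu ⊢
    rcases hsj with hsj | hsj <;> 
      simp [ketbra, Matrix.one_apply, hu, hsj, Sym.mat, cxFun, hs, e]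

/-- After pinching `ρ`, the operator `V` is needed only on the ranges of `P` and `Q`, where
controlled-X becomes local. -/
theorem conj_eq_of_proj {ρ V P Q : Op (Fin N)} (hPQ : P + Q = 1) (hP : P * P = P) (hPs : Pᴴ = P)
    (h : Commute P ρ) : V * ρ * Vᴴ = V * P * ρ * (V * P)ᴴ + V * Q * ρ * (V * Q)ᴴ := by
  have hQs : Qᴴ = Q := by
    have : Q = 1 - P := by rw [← hPQ]; simp
    rw [this, Matrix.conjTranspose_sub, hPs, Matrix.conjTranspose_one]
  conv_lhs => rw [← sum_proj_conj hPQ hP h]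
  simp only [Matrix.conjTranspose_mul, hPs, hQs, mul_add, add_mul, mul_assoc]

theorem ketbra_zero_mul_one : ketbra 0 * ketbra 1 = 0 := by
  ext i j; fin_cases i <;> fin_cases j <;> simp [ketbra, Matrix.mul_apply]

theorem ketbra_one_mul_zero : ketbra 1 * ketbra 0 = 0 := by
  ext i j; fin_cases i <;> fin_cases j <;> simp [ketbra, Matrix.mul_apply]

theorem appOn_zero (i : Fin N) : (appOn 0 i : Op (Fin N)) = 0 := by
  simpa using appOn_smul 0 0 i

theorem commute_appOn_of_X {i : Fin N} {ρ : Op (Fin N)} (h : Commute (rowOp (single i .X)) ρ)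
    (c d : ℂ) : Commute (appOn (c • 1 + d • Sym.X.mat) i) ρ := by
  rw [appOn_add, appOn_smul, appOn_smul, appOn_one, ← rowOp_single]
  exact ((Commute.one_left ρ).smul_left _).add_left (h.smul_left _)

/-- If the control has a definite `Z`, controlled-X keeps the segments apart. -/
theorem cxOp_conj_mem_of_Z (γ : Assignment N) {i j : Fin N} (hij : i ≠ j) {ρ : Op (Fin N)}
    (hρ : ρ ∈ sepCone γ.cell) (h : Commute (rowOp (single i .Z)) ρ) :
    cxOp i j * ρ * (cxOp i j)ᴴ ∈ sepCone γ.cell := by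
  have hmem := fun (U : Matrix (Fin 2) (Fin 2) ℂ) (k : Fin N) {σ : Op (Fin N)} =>
    appOn_conj_mem γ.mem_cell γ.cell_eq U k (ρ := σ)
  rw [conj_eq_of_proj (P := appOn (ketbra 0) i) (Q := appOn (ketbra 1) i)
    (by rw [← appOn_add, ketbra_add, appOn_one]) (by rw [appOn_mul, ketbra_mul])
    (by rw [conjTranspose_appOn, conjTranspose_ketbra])
    (commute_appOn_of_Z h _ (ketbra_offDiag 0).1 (ketbra_offDiag 0).2)]
  have e0 : (cxOp i j : Op (Fin N)) * appOn (ketbra 0) i = appOn (ketbra 0) i := by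
    rw [cxOp_eq hij, add_mul, mul_assoc, appOn_mul, appOn_mul, ketbra_mul, ketbra_one_mul_zero,
      appOn_zero, mul_zero, add_zero]
  have e1 : (cxOp i j : Op (Fin N)) * appOn (ketbra 1) i =
      appOn Sym.X.mat j * appOn (ketbra 1) i := by
    rw [cxOp_eq hij, add_mul, mul_assoc, appOn_mul, appOn_mul, ketbra_mul, ketbra_zero_mul_one,
      appOn_zero, zero_add]
  rw [e0, e1, Matrix.conjTranspose_mul]
  refine add_mem (hmem _ i hρ) ?_
  convert hmem Sym.X.mat j (hmem (ketbra 1) i hρ) using 1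
  simp only [mul_assoc]

/-- If the target has a definite `X`, controlled-X keeps the segments apart. -/
theorem cxOp_conj_mem_of_X (γ : Assignment N) {i j : Fin N} (hij : i ≠ j) {ρ : Op (Fin N)}
    (hρ : ρ ∈ sepCone γ.cell) (h : Commute (rowOp (single j .X)) ρ) :
    cxOp i j * ρ * (cxOp i j)ᴴ ∈ sepCone γ.cell := by
  have hmem := fun (U : Matrix (Fin 2) (Fin 2) ℂ) (k : Fin N) {σ : Op (Fin N)} =>
    appOn_conj_mem γ.mem_cell γ.cell_eq U k (ρ := σ)
  -- `P` and `Q` are the projections onto the `+1` and `-1` eigenspaces of `X`.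
  set P : Matrix (Fin 2) (Fin 2) ℂ := (2⁻¹ : ℂ) • 1 + (2⁻¹ : ℂ) • Sym.X.mat with hP
  set Q : Matrix (Fin 2) (Fin 2) ℂ := (2⁻¹ : ℂ) • 1 + (-2⁻¹ : ℂ) • Sym.X.mat with hQ
  have hX := Sym.mat_sq .X (by simp)
  have hXP : Sym.X.mat * P = P := by
    rw [hP, mul_add, mul_smul_comm, mul_smul_comm, hX, mul_one, add_comm]
  have hXQ : Sym.X.mat * Q = (-1 : ℂ) • Q := by
    rw [hQ, mul_add, mul_smul_comm, mul_smul_comm, hX, mul_one, smul_add, smul_smul, smul_smul,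
      add_comm]
    norm_num
  have hPP : P * P = P := by
    conv_lhs => rw [hP, add_mul, smul_mul_assoc, smul_mul_assoc, hXP, one_mul, ← add_smul]
    rw [show (2⁻¹ : ℂ) + 2⁻¹ = 1 by norm_num, one_smul]
  have hPQ : P + Q = 1 := by
    rw [hP, hQ, add_add_add_comm, ← add_smul, ← add_smul]
    norm_num
  have hPs : Pᴴ = P := by
    rw [hP]; simp [Sym.conjTranspose_mat]
  rw [conj_eq_of_proj (P := appOn P j) (Q := appOn Q j)
    (by rw [← appOn_add, hPQ, appOn_one]) (by rw [appOn_mul, hPP])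
    (by rw [conjTranspose_appOn, hPs]) (commute_appOn_of_X h _ _)]
  have e0 : (cxOp i j : Op (Fin N)) * appOn P j = appOn P j := by
    rw [cxOp_eq hij, add_mul, (appOn_comm Sym.X.mat (ketbra 1) hij.symm).eq, mul_assoc, appOn_mul,
      hXP, ← add_mul, ← appOn_add, ketbra_add, appOn_one, one_mul]
  -- On the `-1` eigenspace of the target's `X`, controlled-X acts as `Z` on the control (phase
  -- kickback).
  have e1 : (cxOp i j : Op (Fin N)) * appOn Q j =
      appOn (ketbra 0 + (-1 : ℂ) • ketbra 1) i * appOn Q j := by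
    rw [cxOp_eq hij, add_mul, (appOn_comm Sym.X.mat (ketbra 1) hij.symm).eq, mul_assoc, appOn_mul,
      hXQ, appOn_add _ _ i, appOn_smul _ Q, appOn_smul _ _ i, add_mul, mul_smul_comm,
      smul_mul_assoc]
  rw [e0, e1, Matrix.conjTranspose_mul]
  refine add_mem (hmem _ j hρ) ?_
  convert hmem (ketbra 0 + (-1 : ℂ) • ketbra 1) i (hmem Q j hρ) using 1
  simp only [mul_assoc]

/-! ### Transport of L-rows through controlled-X -/

theorem commute_cx {i j : Fin N} (hij : i ≠ j) {ρ : Op (Fin N)} {L : Row N} (hL : IsLRow L)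
    (h : Commute (rowOp (cxRow i j L)) ρ) :
    Commute (rowOp L) (cxOp i j * ρ * (cxOp i j)ᴴ) := by
  have := commute_cxRow hij _ (isLRow_cxRow hL) h
  rwa [cxRow_cxRow hij hL] at this

theorem mul_I (a : Sym) : a * .I = a := mul_one a

theorem I_mul (a : Sym) : .I * a = a := one_mul a

/-- A row with `I` at the control pulls back to itself, possibly multiplied by `Z_i`, and `Z_i` is
known to commute. Hence rows of the target's segment survive unchanged. -/
theorem commute_cx_of_Z {i j : Fin N} (hij : i ≠ j) {ρ : Op (Fin N)}
    (hZ : Commute (rowOp (single i .Z)) ρ) {L : Row N} (hL : IsLRow L) (hi : L i = .I)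
    (h : Commute (rowOp L) ρ) : Commute (rowOp L) (cxOp i j * ρ * (cxOp i j)ᴴ) := by
  refine commute_cx hij hL ?_
  have e : cxRow i j L = L * single i (L j).toControl := by
    funext k
    by_cases hk : k = i
    · subst hk; simp [cxRow, single]
    · by_cases hkj : k = j
      · subst hkj; simp [cxRow, single, hk, hi, Sym.toTarget, mul_I]
      · simp [cxRow, single, hk, hkj, mul_I]
  have h1 : ∀ a : Sym, a ≠ .heart → a.toControl = .I ∨ a.toControl = .Z := by
    intro a; cases a <;> simp [Sym.toControl]
  rw [e]
  rcases h1 _ (hL j) with h2 | h2 <;> rw [h2]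
  · refine commute_rowOp_mul hL (isLRow_single (by simp)) h ?_
    rw [rowOp_single]; simp [Sym.mat, appOn_one]
  · exact commute_rowOp_mul hL (isLRow_single (by simp)) h hZ

theorem commute_cx_of_X {i j : Fin N} (hij : i ≠ j) {ρ : Op (Fin N)}
    (hX : Commute (rowOp (single j .X)) ρ) {L : Row N} (hL : IsLRow L) (hj : L j = .I)
    (h : Commute (rowOp L) ρ) : Commute (rowOp L) (cxOp i j * ρ * (cxOp i j)ᴴ) := by
  refine commute_cx hij hL ?_
  have e : cxRow i j L = L * single j (L i).toTarget := by
    funext k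
    by_cases hk : k = i
    · subst hk; simp [cxRow, single, hij, hj, Sym.toControl, mul_I]
    · by_cases hkj : k = j
      · subst hkj; simp [cxRow, single, hk]
      · simp [cxRow, single, hk, hkj, mul_I]
  have h1 : ∀ a : Sym, a ≠ .heart → a.toTarget = .I ∨ a.toTarget = .X := by
    intro a; cases a <;> simp [Sym.toTarget]
  rw [e]
  rcases h1 _ (hL i) with h2 | h2 <;> rw [h2]
  · refine commute_rowOp_mul hL (isLRow_single (by simp)) h ?_
    rw [rowOp_single]; simp [Sym.mat, appOn_one]
  · exact commute_rowOp_mul hL (isLRow_single (by simp)) h hX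

theorem commute_cx_single_Z {i j : Fin N} (hij : i ≠ j) {ρ : Op (Fin N)}
    (hZ : Commute (rowOp (single i .Z)) ρ) :
    Commute (rowOp (single i .Z)) (cxOp i j * ρ * (cxOp i j)ᴴ) := by
  refine commute_cx hij (isLRow_single (by simp)) ?_
  have e : cxRow i j (single i .Z) = single i .Z := by
    funext k
    by_cases hk : k = i
    · subst hk; simp [cxRow, single, hij.symm, Sym.toControl, mul_I]
    · by_cases hkj : k = j
      · subst hkj; simp [cxRow, single, hk, Sym.toTarget, mul_I]
      · simp [cxRow, single, hk, hkj]
  rwa [e]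

theorem commute_cx_single_X {i j : Fin N} (hij : i ≠ j) {ρ : Op (Fin N)}
    (hX : Commute (rowOp (single j .X)) ρ) :
    Commute (rowOp (single j .X)) (cxOp i j * ρ * (cxOp i j)ᴴ) := by
  refine commute_cx hij (isLRow_single (by simp)) ?_
  have e : cxRow i j (single j .X) = single j .X := by
    funext k
    by_cases hk : k = i
    · subst hk; simp [cxRow, single, hij, Sym.toControl, mul_I]
    · by_cases hkj : k = j
      · subst hkj; simp [cxRow, single, hk, hij, Sym.toTarget, mul_I]
      · simp [cxRow, single, hk, hkj]
  rwa [e]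

theorem cxRow_eq_self {i j : Fin N} {L : Row N} (hi : L i = .I) (hj : L j = .I) :
    cxRow i j L = L := by
  funext k
  by_cases hk : k = i
  · subst hk; simp [cxRow, hi, hj, Sym.toControl, mul_I]
  · by_cases hkj : k = j
    · subst hkj; simp [cxRow, hk, hi, hj, Sym.toTarget, mul_I]
    · simp [cxRow, hk, hkj]

theorem Ext.HasLRow.of_cx {A : Finset (Fin N)} {i j : Fin N} (hij : i ≠ j) (hi : i ∈ A)
    (hj : j ∈ A) {E : Ext N} {L : Row N} (h : (E.cx i j).HasLRow A L) {P : Row N → Prop}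
    (hmul : ∀ R S, IsLRow R → IsLRow S → P R → P S → P (R * S))
    (hP : ∀ R, E.HasLRow A R → P (cxRow i j R)) : P L := by
  cases E with
  | unknown => exact h.elim
  | mixed =>
    rw [← cxRow_cxRow hij h.1]
    exact hP _ ⟨isLRow_cxRow h.1, supportedOn_cxRow hi hj h.2⟩
  | arr q =>
    induction q using Quotient.inductionOn with
    | h M =>
      refine HasRow.induction (M := M.map (cxRow i j)) h.2 h.1 hmul fun R hR hRL => ?_
      obtain ⟨R', hR', rfl⟩ := Multiset.mem_map.1 hR
      exact hP R' ⟨isLRow_of_cxRow hRL, hasRow_of_mem hR'⟩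

theorem Ext.HasLRow.of_tensor {A B C : Finset (Fin N)} {E E' : Ext N} {L : Row N}
    (h : (E.tensor E').HasLRow A L) {P : Row N → Prop}
    (hmul : ∀ R S, IsLRow R → IsLRow S → P R → P S → P (R * S))
    (hP : ∀ R, E.HasLRow B R → P R) (hP' : ∀ R, E'.HasLRow C R → P R) : P L := by
  cases E with
  | unknown => exact h.elim
  | mixed => exact h.elim
  | arr q =>
    cases E' with
    | unknown => exact h.elim
    | mixed => exact h.elim
    | arr q' =>
      induction q using Quotient.inductionOn with
      | h M =>
        induction q' using Quotient.inductionOn with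
        | h M' =>
          refine HasRow.induction (M := M + M') h.2 h.1 hmul fun R hR hRL => ?_
          rcases Multiset.mem_add.1 hR with hR | hR
          · exact hP R ⟨hRL, hasRow_of_mem hR⟩
          · exact hP' R ⟨hRL, hasRow_of_mem hR⟩

theorem Assignment.Supp.merge {γ : Assignment N} (hS : γ.Supp) {i j : Fin N} {E : Ext N}
    (hE : ∀ L, E.HasLRow (γ.cell i ∪ γ.cell j) L → SupportedOn (γ.cell i ∪ γ.cell j) L) :
    (γ.merge i j E).Supp := by
  intro k L hL
  by_cases hk : k ∈ γ.cell i ∪ γ.cell j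
  · simp only [Assignment.merge, if_pos hk] at hL ⊢
    exact hE L hL
  · simp only [Assignment.merge, if_neg hk] at hL ⊢
    exact hS k L hL

theorem Assignment.cell_subset_merge (γ : Assignment N) (i j : Fin N) (E : Ext N) (k : Fin N) :
    γ.cell k ⊆ (γ.merge i j E).cell k := by
  by_cases hk : k ∈ γ.cell i ∪ γ.cell j
  · simp only [Assignment.merge, if_pos hk]
    rcases Finset.mem_union.1 hk with h | h
    · rw [γ.cell_eq i k h]; exact Finset.subset_union_left
    · rw [γ.cell_eq j k h]; exact Finset.subset_union_right
  · simp only [Assignment.merge, if_neg hk]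
    exact subset_rfl

theorem SupportedOn.mono {A B : Finset (Fin N)} (h : A ⊆ B) {L : Row N} (hL : SupportedOn A L) :
    SupportedOn B L := fun k hk => hL k fun hkA => hk (h hkA)

theorem Assignment.Supp.cx (hrep : IsRepChoice rep) {γ : Assignment N} (hS : γ.Supp) {i j : Fin N}
    (hij : i ≠ j) : (γ.cx rep i j).Supp := by
  unfold Assignment.cx
  split_ifs with h1 h2 h3 h4
  · have hj : j ∈ γ.cell i := by rw [h1]; exact γ.mem_cell j
    exact hS.split (supp_updateE hrep _ _ fun L hL =>
      hL.of_cx hij (γ.mem_cell i) hj supportedOn_mul fun R hR =>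
        supportedOn_cxRow (γ.mem_cell i) hj (hS i R hR))
  · exact hS
  · exact hS.setVal fun L hL => hL.pauli_supportedOn (γ.mem_cell i)
  · exact hS.setVal fun L hL => hL.pauli_supportedOn (γ.mem_cell j)
  · have hi : i ∈ γ.cell i ∪ γ.cell j := Finset.mem_union_left _ (γ.mem_cell i)
    have hj : j ∈ γ.cell i ∪ γ.cell j := Finset.mem_union_right _ (γ.mem_cell j)
    refine hS.merge fun L hL => hL.of_cx hij hi hj supportedOn_mul fun R hR =>
      supportedOn_cxRow hi hj ?_
    exact hR.of_tensor supportedOn_mul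
      (fun R hR => (hS i R hR).mono Finset.subset_union_left)
      (fun R hR => (hS j R hR).mono Finset.subset_union_right)

theorem Assignment.Good.commute_mixed {γ : Assignment N} {ρ : Op (Fin N)} (h : γ.Good ρ)
    {i : Fin N} (hi : γ.val i = .mixed) {a : Sym} (ha : a ≠ .heart) :
    Commute (rowOp (single i a)) ρ :=
  h.2 i _ (by rw [hi]; exact ⟨isLRow_single ha, supportedOn_single (γ.mem_cell i) a⟩)

theorem Assignment.Good.commute_pauli {γ : Assignment N} {ρ : Op (Fin N)} (h : γ.Good ρ)
    {i : Fin N} {a : Sym} (ha : a ≠ .heart) (hi : γ.IsPauli i a) :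
    Commute (rowOp (single i a)) ρ :=
  h.2 i _ (by rw [hi.2]; exact ⟨isLRow_single ha, hasRow_of_mem (by simp)⟩)

theorem Assignment.IsPauli.commute {γ : Assignment N} {i : Fin N} {a : Sym} (h : γ.IsPauli i a)
    {ρ : Op (Fin N)} (hρ : Commute (rowOp (single i a)) ρ) {k : Fin N} (hk : k ∈ γ.cell i)
    {L : Row N} (hL : (γ.val k).HasLRow (γ.cell k) L) : Commute (rowOp L) ρ := by
  rw [γ.val_eq i k hk, h.2] at hL
  exact hL.pauli_commute hρ

/-- A control or target that is `I` supplies the needed `Z` or `X`, so the segments stay apart just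
as for `⟨Z⟩` or `⟨X⟩`; if both are `I`, the gate fixes the state. Only the remaining cases need both
qubits in one segment. -/
theorem Assignment.Good.cx (hrep : IsRepChoice rep) {γ : Assignment N} (hS : γ.Supp)
    {ρ : Op (Fin N)} (h : γ.Good ρ) {i j : Fin N} (hij : i ≠ j) :
    (γ.cx rep i j).Good (cxOp i j * ρ * (cxOp i j)ᴴ) := by
  have hmul : ∀ R S : Row N, IsLRow R → IsLRow S →
      Commute (rowOp R) (cxOp i j * ρ * (cxOp i j)ᴴ) →
      Commute (rowOp S) (cxOp i j * ρ * (cxOp i j)ᴴ) →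
      Commute (rowOp (R * S)) (cxOp i j * ρ * (cxOp i j)ᴴ) :=
    fun R S hR hS h h' => commute_rowOp_mul hR hS h h'
  unfold Assignment.cx
  split_ifs with h1 h2 h3 h4
  · have hj : j ∈ γ.cell i := by rw [h1]; exact γ.mem_cell j
    have hi : i ∈ γ.cell j := by rw [← h1]; exact γ.mem_cell i
    refine Assignment.good_split (cxOp_conj_mem γ.cell_eq hij hi h.1)
      (good_updateE hrep _ _ fun L hL => ?_) fun k L hk hL => ?_
    · exact hL.of_cx (P := fun L => Commute (rowOp L) _) hij (γ.mem_cell i) hj hmul fun R hR =>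
        commute_cxRow hij R hR.isLRow (h.2 i R hR)
    · refine commute_cx hij hL.isLRow ?_
      rw [cxRow_eq_self (hS.eq_I hk hL) (hS.eq_I (by rwa [← h1]) hL)]
      exact h.2 k L hL
  · rcases h2 with h2 | h2 | ⟨h2, h3⟩
    · have hZ := h.commute_pauli (by simp) h2
      refine ⟨cxOp_conj_mem_of_Z γ hij h.1 hZ, fun k L hL => ?_⟩
      by_cases hk : k ∈ γ.cell i
      · exact h2.commute (commute_cx_single_Z hij hZ) hk hL
      · exact commute_cx_of_Z hij hZ hL.isLRow (hS.eq_I hk hL) (h.2 k L hL)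
    · have hX := h.commute_pauli (by simp) h2
      refine ⟨cxOp_conj_mem_of_X γ hij h.1 hX, fun k L hL => ?_⟩
      by_cases hk : k ∈ γ.cell j
      · exact h2.commute (commute_cx_single_X hij hX) hk hL
      · exact commute_cx_of_X hij hX hL.isLRow (hS.eq_I hk hL) (h.2 k L hL)
    · have hZ := h.commute_mixed h2 (a := .Z) (by simp)
      have hX := h.commute_mixed h3 (a := .X) (by simp)
      rw [rowOp_single] at hX
      have hc : Commute (cxOp i j) ρ := by
        rw [cxOp_eq hij]
        exact (commute_appOn_of_Z hZ _ (ketbra_offDiag 0).1 (ketbra_offDiag 0).2).add_left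
          (hX.mul_left (commute_appOn_of_Z hZ _ (ketbra_offDiag 1).1 (ketbra_offDiag 1).2))
      rw [hc.eq, mul_assoc, mul_eq_one_comm.1 (cxOp_unitary hij), mul_one]
      exact h
  · have hZ := h.commute_mixed h3 (a := .Z) (by simp)
    exact Assignment.good_setVal (cxOp_conj_mem_of_Z γ hij h.1 hZ)
      (fun L hL => hL.pauli_commute (commute_cx_single_Z hij hZ)) fun k L hk hL =>
      commute_cx_of_Z hij hZ hL.isLRow (hS.eq_I hk hL) (h.2 k L hL)
  · have hX := h.commute_mixed h4 (a := .X) (by simp)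
    exact Assignment.good_setVal (cxOp_conj_mem_of_X γ hij h.1 hX)
      (fun L hL => hL.pauli_commute (commute_cx_single_X hij hX)) fun k L hk hL =>
      commute_cx_of_X hij hX hL.isLRow (hS.eq_I hk hL) (h.2 k L hL)
  · have hi : i ∈ γ.cell i ∪ γ.cell j := Finset.mem_union_left _ (γ.mem_cell i)
    have hj : j ∈ γ.cell i ∪ γ.cell j := Finset.mem_union_right _ (γ.mem_cell j)
    refine ⟨?_, fun k L hL => ?_⟩
    · refine cxOp_conj_mem (γ.merge i j _).cell_eq hij ?_
        (sepCone_mono (γ.cell_subset_merge i j _) h.1)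
      simp only [Assignment.merge, if_pos hj]
      exact hi
    · by_cases hk : k ∈ γ.cell i ∪ γ.cell j
      · simp only [Assignment.merge, if_pos hk] at hL
        refine hL.of_cx (P := fun L => Commute (rowOp L) _) hij hi hj hmul fun R hR =>
          commute_cxRow hij R hR.isLRow ?_
        exact hR.of_tensor (P := fun L => Commute (rowOp L) ρ)
          (fun R S hR hS h h' => commute_rowOp_mul hR hS h h') (h.2 i) (h.2 j)
      · simp only [Assignment.merge, if_neg hk] at hL
        rw [Finset.mem_union, not_or] at hk
        refine commute_cx hij hL.isLRow ?_
        rw [cxRow_eq_self (hS.eq_I hk.1 hL) (hS.eq_I hk.2 hL)]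
        exact h.2 k L hL

/-! ## The approximate join -/

theorem Ext.HasLRow.of_normal {A : Finset (Fin N)} {E : Ext N} {L : Row N}
    (h : E.normal.HasLRow A L) : E.HasLRow A L := by
  classical
  cases E with
  | unknown => exact h
  | mixed => exact h
  | arr q =>
    induction q using Quotient.inductionOn with
    | h M =>
      obtain ⟨h1, K, hK⟩ := Ext.hasLRow_ofRows (M := M.filter IsLRow) h
      obtain ⟨h2, h3⟩ := Quotient.exact hK
      -- A conversion between arrays of L-rows remains one after the deleted heart rows are put
      -- back.
      refine ⟨h1, K + M.filter fun R => ¬ IsLRow R, Quotient.sound ⟨?_, ?_⟩⟩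
      · have := Conv.add_right (M.filter fun R => ¬ IsLRow R) h2
        rwa [Multiset.filter_add_not, Multiset.cons_add] at this
      · have := Conv.add_right (M.filter fun R => ¬ IsLRow R) h3
        rwa [Multiset.filter_add_not, Multiset.cons_add] at this

/-- An L-row is the product of its one-qubit entries. This handles rows on a segment composed of
several `I`'s. -/
theorem commute_of_singles {ρ : Op (Fin N)} {L : Row N} (hL : IsLRow L)
    (h : ∀ j, L j ≠ .I → Commute (rowOp (single j (L j))) ρ) : Commute (rowOp L) ρ := by
  have key : ∀ S : Finset (Fin N), IsLRow (fun k => if k ∈ S then L k else .I) ∧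
      Commute (rowOp fun k => if k ∈ S then L k else .I) ρ := by
    intro S
    induction S using Finset.induction_on with
    | empty =>
      refine ⟨fun k => by simp, ?_⟩
      have e : (fun k => if k ∈ (∅ : Finset (Fin N)) then L k else Sym.I) = 1 := by
        funext k; simp; rfl
      rw [e, rowOp_one]
      exact Commute.one_left ρ
    | insert j S hj ih =>
      have e : (fun k => if k ∈ insert j S then L k else Sym.I) =
          (fun k => if k ∈ S then L k else Sym.I) * single j (L j) := by
        funext k
        by_cases hk : k = j
        · subst hk; simp [hj, single, I_mul]
        · simp [hk, single, mul_I]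
      have h1 : IsLRow (single j (L j)) := isLRow_single (hL j)
      rw [e]
      refine ⟨isLRow_mul.2 ⟨ih.1, h1⟩, commute_rowOp_mul ih.1 h1 ih.2 ?_⟩
      by_cases hI : L j = .I
      · rw [hI, rowOp_single]; simp [Sym.mat, appOn_one]
      · exact h j hI
  simpa using (key Finset.univ).2

theorem Assignment.combine_cases (γ : Assignment N) (B : Finset (Fin N)) :
    (∃ i ∈ B, (∀ j ∈ B, γ.cell j = γ.cell i) ∧ γ.combine B = γ.val i) ∨
      ((∀ j ∈ B, γ.val j = .mixed) ∧ γ.combine B = .mixed) ∨ γ.combine B = .unknown := by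
  classical
  unfold Assignment.combine
  split_ifs with h h'
  · exact .inl ⟨h.choose, h.choose_spec.1, h.choose_spec.2, rfl⟩
  · exact .inr (.inl ⟨h', rfl⟩)
  · exact .inr (.inr rfl)

theorem Assignment.cell_eq_of_saturated {γ : Assignment N} {B : Finset (Fin N)} {i : Fin N}
    (hB : γ.cell i ⊆ B) (h : ∀ j ∈ B, γ.cell j = γ.cell i) : γ.cell i = B :=
  hB.antisymm fun j hj => by rw [← h j hj]; exact γ.mem_cell j

theorem Assignment.Supp.combine {γ : Assignment N} (hS : γ.Supp) {B : Finset (Fin N)}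
    (hB : ∀ i ∈ B, γ.cell i ⊆ B) {L : Row N} (hL : (γ.combine B).HasLRow B L) :
    SupportedOn B L := by
  rcases γ.combine_cases B with ⟨i, hi, h1, h2⟩ | ⟨h1, h2⟩ | h1
  · have e := Assignment.cell_eq_of_saturated (hB i hi) h1
    rw [h2] at hL
    have := hS i L (by rwa [e])
    rwa [e] at this
  · rw [h2] at hL; exact hL.2
  · rw [h1] at hL; exact hL.elim

theorem Assignment.Good.combine {γ : Assignment N} {ρ : Op (Fin N)} (h : γ.Good ρ)
    {B : Finset (Fin N)} (hB : ∀ i ∈ B, γ.cell i ⊆ B) {L : Row N}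
    (hL : (γ.combine B).HasLRow B L) : Commute (rowOp L) ρ := by
  rcases γ.combine_cases B with ⟨i, hi, h1, h2⟩ | ⟨h1, h2⟩ | h1
  · have e := Assignment.cell_eq_of_saturated (hB i hi) h1
    rw [h2] at hL
    exact h.2 i L (by rwa [e])
  · rw [h2] at hL
    refine commute_of_singles hL.1 fun j hj => ?_
    exact h.commute_mixed (h1 j (by_contra fun hjB => hj (hL.2 j hjB))) (hL.1 j)
  · rw [h1] at hL; exact hL.elim

/-- If the members other than `I` agree on one element, its L-rows are those of the join. The
support hypothesis ensures that they count as L-rows of the members `I` too. -/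
theorem Ext.HasLRow.of_join {ι : Type} {x : ι → Ext N} {B : Finset (Fin N)} {L : Row N}
    (h : (Ext.join x).HasLRow B L)
    (hS : ∀ n L, (x n).HasLRow B L → SupportedOn B L) :
    SupportedOn B L ∧ ∀ n, (x n).HasLRow B L := by
  classical
  unfold Ext.join at h
  split_ifs at h with h1 h2
  · exact ⟨h.2, fun n => by rw [h1 n]; exact h⟩
  · obtain ⟨m, hm⟩ := not_forall.1 h1
    have hF := h2.choose_spec
    have hsupp : SupportedOn B L := hS m L (by rw [(hF m).resolve_left hm]; exact h)
    refine ⟨hsupp, fun n => ?_⟩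
    rcases hF n with h3 | h3
    · rw [h3]; exact ⟨h.isLRow, hsupp⟩
    · rw [h3]; exact h
  · exact h.elim

theorem Assignment.Supp.normal {γ : Assignment N} (hS : γ.Supp) : γ.normal.Supp :=
  fun i L hL => hS i L hL.of_normal

theorem Assignment.Good.normal {γ : Assignment N} {ρ : Op (Fin N)} (h : γ.Good ρ) :
    γ.normal.Good ρ := ⟨h.1, fun i L hL => h.2 i L hL.of_normal⟩

theorem cell_subset_joinCell {ι : Type} (f : ι → Assignment N) (n : ι) (i : Fin N) :
    (f n).cell i ⊆ joinCell f i := fun j hj => by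
  classical
  have : Linked f i j := Relation.EqvGen.rel i j ⟨n, hj⟩
  simp only [joinCell, Finset.mem_filter, Finset.mem_univ, true_and, this]

theorem joinCell_saturated {ι : Type} (f : ι → Assignment N) (n : ι) (i : Fin N) :
    ∀ k ∈ joinCell f i, (f n).cell k ⊆ joinCell f i := fun k hk => by
  rw [← joinCell_eq f i k hk]; exact cell_subset_joinCell f n k

theorem supp_approxJoin {ι : Type} {f : ι → Assignment N} (hS : ∀ n, (f n).Supp) :
    (approxJoin f).Supp := fun i _ hL =>
  (Ext.HasLRow.of_join hL fun n _ hL =>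
    (hS n).normal.combine (joinCell_saturated (fun n => (f n).normal) n i) hL).1

/-- The join weakens each member: its partition is coarser, and its L-rows are L-rows of the member
or, on a union of `I`'s, products of such. -/
theorem Assignment.Good.approxJoin {ι : Type} {f : ι → Assignment N} (hS : ∀ n, (f n).Supp)
    {n : ι} {ρ : Op (Fin N)} (h : (f n).Good ρ) : (approxJoin f).Good ρ := by
  refine ⟨sepCone_mono (cell_subset_joinCell (fun n => (f n).normal) n) h.normal.1,
    fun i L hL => ?_⟩
  have := (Ext.HasLRow.of_join hL fun n _ hL =>
    (hS n).normal.combine (joinCell_saturated (fun n => (f n).normal) n i) hL).2 n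
  exact h.normal.combine (joinCell_saturated (fun n => (f n).normal) n i) this

theorem Assignment.Good.add {γ : Assignment N} {ρ ρ' : Op (Fin N)} (h : γ.Good ρ)
    (h' : γ.Good ρ') : γ.Good (ρ + ρ') :=
  ⟨add_mem h.1 h'.1, fun i L hL => (h.2 i L hL).add_right (h'.2 i L hL)⟩

theorem Assignment.good_sum {γ : Assignment N} {ι : Type} (s : Finset ι) {a : ι → Op (Fin N)}
    (h : ∀ k ∈ s, γ.Good (a k)) : γ.Good (∑ k ∈ s, a k) :=
  ⟨sum_mem fun k hk => (h k hk).1,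
    fun i L hL => Commute.sum_right _ _ _ fun k hk => (h k hk).2 i L hL⟩

theorem Assignment.good_of_tendsto {γ : Assignment N} {a : ℕ → Op (Fin N)} {ρ : Op (Fin N)}
    (ha : ∀ n, γ.Good (a n)) (ht : ∀ n, (a n).trace.re ≤ 1)
    (h : Filter.Tendsto a Filter.atTop (nhds ρ)) : γ.Good ρ := by
  refine ⟨γ.mem_sepCone_of_tendsto (fun n => (ha n).1) ht h, fun i L hL => ?_⟩
  have hc : IsClosed {σ : Op (Fin N) | rowOp L * σ = σ * rowOp L} :=
    isClosed_eq (by fun_prop) (by fun_prop)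
  exact hc.mem_of_tendsto h (Filter.Eventually.of_forall fun n => ((ha n).2 i L hL).eq)

/-! ## Soundness -/

theorem QIL.sound (hrep : IsRepChoice rep) (C : QIL N) : ∀ (γ : Assignment N) (ρ : Op (Fin N)),
    IsPartialDensity ρ → γ.Supp → γ.Good ρ →
      (C.semE rep γ).Supp ∧ (C.semE rep γ).Good (C.sem ρ) := by
  induction C with
  | skip => exact fun γ ρ _ hS h => ⟨hS, h⟩
  | seq C C' ih ih' =>
    intro γ ρ hρ hS h
    obtain ⟨h1, h2⟩ := ih γ ρ hρ hS h
    exact ih' _ _ (hρ.sem C) h1 h2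
  | gate U i => exact fun γ ρ _ hS h => ⟨hS.gate U i, h.gate hS U i⟩
  | gateT i => exact fun γ ρ _ hS h => ⟨hS.gateT hrep i, h.gateT hrep hS i⟩
  | cx i j hij => exact fun γ ρ _ hS h => ⟨hS.cx hrep hij, h.cx hrep hS hij⟩
  | ite i C C' ih ih' =>
    intro γ ρ hρ hS h
    have hm := hS.measE hrep i
    obtain ⟨h1, h2⟩ := ih _ _ (hρ.project 0 i) hm (h.measE hrep hS i 0)
    obtain ⟨h3, h4⟩ := ih' _ _ (hρ.project 1 i) hm (h.measE hrep hS i 1)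
    have hSf : ∀ b : Bool, (if b then C.semE rep (measE rep i γ)
        else C'.semE rep (measE rep i γ)).Supp := by
      intro b; cases b
      · exact h3
      · exact h1
    exact ⟨supp_approxJoin hSf,
      (Assignment.Good.approxJoin (n := true) hSf (by exact h2)).add
        (Assignment.Good.approxJoin (n := false) hSf (by exact h4))⟩
  -- The case of `while`: the `n`-th exit state is good for the `n`-th assignment, hence for the
  -- join; then sums and the limit are taken with the join fixed.
  | _ =>
    rename_i i C ih
    intro γ ρ hρ hS h
    set f : Op (Fin N) → Op (Fin N) := fun σ => C.sem (project 0 i σ) with hf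
    set F : Assignment N → Assignment N := fun δ => C.semE rep (ExtStab.measE rep i δ) with hF
    have hfb : ∀ σ : Op (Fin N), σ.PosSemidef →
        (f σ).PosSemidef ∧ (f σ).trace.re ≤ (project 0 i σ).trace.re :=
      fun σ hσ => C.sem_bounds _ (posSemidef_project 0 i hσ)
    have hit : ∀ n, IsPartialDensity (f^[n] ρ) ∧ (F^[n] γ).Supp ∧ (F^[n] γ).Good (f^[n] ρ) := by
      intro n
      induction n with
      | zero => exact ⟨hρ, hS, h⟩
      | succ n ihn =>
        obtain ⟨h1, h2, h3⟩ := ihn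
        rw [Function.iterate_succ_apply', Function.iterate_succ_apply']
        exact ⟨(h1.project 0 i).sem C,
          ih _ _ (h1.project 0 i) (h2.measE hrep i) (h3.measE hrep h2 i 0)⟩
    have hSn : ∀ n, (ExtStab.measE rep i (F^[n] γ)).Supp := fun n => (hit n).2.1.measE hrep i
    refine ⟨supp_approxJoin hSn, ?_⟩
    refine Assignment.good_of_tendsto (fun n => Assignment.good_sum _ fun k _ =>
      Assignment.Good.approxJoin (n := k) hSn ((hit k).2.2.measE hrep (hit k).2.1 i 1))
      (fun n => ?_) (tendsto_exit i hfb hρ.1)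
    rw [Matrix.trace_sum, Complex.re_sum]
    exact (sum_exit_le i hfb hρ.1 n).trans hρ.2

/-! ## The satisfaction relation -/

/-- Subtracting from `(1+K)ρ(1-K)` its adjoint leaves `2(Kρ - ρK)`. -/
theorem commute_of_proj {K ρ : Op (Fin N)} (hK : Kᴴ = K) (hρ : ρᴴ = ρ)
    (h : (1 + K) * ρ * (1 - K) = 0) : Commute K ρ := by
  have h' := congrArg Matrix.conjTranspose h
  simp only [Matrix.conjTranspose_mul, Matrix.conjTranspose_add, Matrix.conjTranspose_sub,
    Matrix.conjTranspose_one, hK, hρ, Matrix.conjTranspose_zero] at h'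
  have e : (2 : ℂ) • (K * ρ - ρ * K) =
      (1 + K) * ρ * (1 - K) - (1 - K) * (ρ * (1 + K)) := by
    rw [two_smul]; noncomm_ring
  rw [h, h', sub_zero] at e
  exact sub_eq_zero.1 ((smul_eq_zero.1 e).resolve_left two_ne_zero)

theorem projPlus_mul_projMinus_iff {L : Row N} (hL : IsLRow L) {ρ : Op (Fin N)} (hρ : ρᴴ = ρ) :
    projPlus L * ρ * projMinus L = 0 ↔ Commute (rowOp L) ρ := by
  have e : projPlus L * ρ * projMinus L =
      (1 / 4 : ℂ) • ((1 + rowOp L) * ρ * (1 - rowOp L)) := by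
    simp only [projPlus, projMinus, smul_mul_assoc, mul_smul_comm, smul_smul]
    norm_num
  rw [e, smul_eq_zero, or_iff_right (by norm_num)]
  refine ⟨commute_of_proj (conjTranspose_rowOp L) hρ, fun h => ?_⟩
  have h1 : (1 + rowOp L) * (1 - rowOp L) = 0 := by
    have : (1 + rowOp L) * (1 - rowOp L) = 1 - rowOp L * rowOp L := by noncomm_ring
    rw [this, rowOp_sq L hL, sub_self]
  have h2 : Commute ρ (1 - rowOp L) := (Commute.one_right ρ).sub_right h.symm
  rw [mul_assoc, h2.eq, ← mul_assoc, h1, zero_mul]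

theorem mul_appOn_apply (U : Matrix (Fin 2) (Fin 2) ℂ) (i : Fin N) (K : Op (Fin N))
    (s t : Fin N → Fin 2) :
    (K * appOn U i) s t = ∑ b, K s (Function.update t i b) * U b (t i) := by
  have h := congrFun (congrFun (Matrix.transpose_mul K (appOn U i)) t) s
  have h2 : (appOn U i : Op (Fin N))ᵀ = appOn Uᵀ i := by
    ext s t; simp only [appOn, Matrix.transpose_apply, Matrix.of_apply, eq_comm]
  rw [h2, appOn_mul_apply] at h
  rw [Matrix.transpose_apply] at h
  rw [h]
  simp [mul_comm]

theorem commute_of_mixed {i : Fin N} {ρ : Op (Fin N)} {ρ' : Op {j : Fin N // j ≠ i}}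
    (h : ∀ s t, ρ s t =
      (if s i = t i then (1 / 2 : ℂ) else 0) * ρ' (fun x => s x.1) (fun x => t x.1))
    (U : Matrix (Fin 2) (Fin 2) ℂ) : Commute (appOn U i) ρ := by
  have h1 : ∀ (s : Fin N → Fin 2) b,
      (fun x : {j : Fin N // j ≠ i} => Function.update s i b x.1) = fun x => s x.1 := fun s b => by
    funext x; simp [x.2]
  ext s t
  rw [appOn_mul_apply, mul_appOn_apply]
  simp only [h, h1, Function.update_self]
  simp [mul_comm]

/-- An operator commuting with `X` and `Z` of a qubit is maximally mixed there. -/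
theorem exists_mixed {i : Fin N} {ρ : Op (Fin N)} (hρ : IsPartialDensity ρ)
    (hX : Commute (rowOp (single i .X)) ρ) (hZ : Commute (rowOp (single i .Z)) ρ) :
    ∃ ρ' : Op {j : Fin N // j ≠ i}, IsPartialDensity ρ' ∧ ∀ s t, ρ s t =
      (if s i = t i then (1 / 2 : ℂ) else 0) * ρ' (fun x => s x.1) (fun x => t x.1) := by
  rw [rowOp_single] at hX hZ
  -- In block form over qubit `i`, commuting with `X` identifies the two diagonal blocks, and
  -- commuting with `Z` kills the off-diagonal ones.
  have hX' : ∀ s t, ρ (Function.update s i (1 + s i)) t = ρ s (Function.update t i (1 + t i)) := by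
    intro s t
    have := congrFun (congrFun hX.eq s) t
    rw [appOn_mul_apply, mul_appOn_apply] at this
    have e : (1 : Fin 2) + 1 = 0 := rfl
    have h2 : ∀ x : Fin 2, x = 0 ∨ x = 1 := by decide
    rcases h2 (s i) with hs | hs <;> rcases h2 (t i) with ht | ht <;>
      simpa [hs, ht, Sym.mat, e] using this
  have hZ' : ∀ s t, s i ≠ t i → ρ s t = 0 := by
    intro s t hst
    have := congrFun (congrFun hZ.eq s) t
    rw [appOn_mul_apply, mul_appOn_apply] at this
    have h2 : ∀ x : Fin 2, x = 0 ∨ x = 1 := by decide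
    have us := Function.update_eq_self i s
    have ut := Function.update_eq_self i t
    rcases h2 (s i) with hs | hs <;> rcases h2 (t i) with ht | ht <;>
      rw [hs] at us <;> rw [ht] at ut <;>
      simp [hs, ht, Sym.mat, us, ut] at this hst <;>
      first
        | exact self_eq_neg.1 this
        | exact neg_eq_self.1 this
  let e : (Fin N → Fin 2) ≃ Fin 2 × ({j : Fin N // j ≠ i} → Fin 2) := Equiv.funSplitAt i (Fin 2)
  have hes : ∀ a x, (e.symm (a, x)) i = a := fun a x => by
    simp [e, Equiv.funSplitAt, Equiv.piSplitAt]
  have hup : ∀ a b x, Function.update (e.symm (a, x)) i b = e.symm (b, x) := by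
    intro a b x
    funext k
    by_cases hk : k = i
    · subst hk; rw [hes]; simp
    · simp [e, Equiv.funSplitAt, Equiv.piSplitAt, hk]
  have hflip : ∀ a x y, ρ (e.symm (a, x)) (e.symm (a, y)) = ρ (e.symm (0, x)) (e.symm (0, y)) := by
    intro a x y
    have := hX' (e.symm (0, x)) (e.symm (1, y))
    rw [hes, hes, hup, hup] at this
    fin_cases a
    · rfl
    · exact this
  -- The factor `2` compensates the `1/2` of the mixed qubit: the two diagonal blocks being equal,
  -- this is the partial trace over `i`.
  refine ⟨(2 : ℂ) • ρ.submatrix (fun x => e.symm (0, x)) (fun x => e.symm (0, x)),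
    ⟨(hρ.1.submatrix _).smul (by norm_num), ?_⟩, fun s t => ?_⟩
  · have h1 : ρ.trace = ((2 : ℂ) • ρ.submatrix (fun x => e.symm (0, x))
        (fun x => e.symm (0, x))).trace := by
      simp only [Matrix.trace, Matrix.diag, Matrix.smul_apply, Matrix.submatrix_apply]
      rw [← e.symm.sum_comp, Fintype.sum_prod_type, Fin.sum_univ_two]
      simp only [hflip 1, smul_eq_mul, ← Finset.mul_sum]
      ring
    rw [← h1]
    exact hρ.2
  · have hs : e.symm (s i, fun x => s x.1) = s := e.symm_apply_apply s
    have ht : e.symm (t i, fun x => t x.1) = t := e.symm_apply_apply t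
    by_cases hst : s i = t i
    · rw [if_pos hst, Matrix.smul_apply, Matrix.submatrix_apply, ← hflip (s i)]
      nth_rewrite 2 [hst]
      rw [hs, ht, smul_eq_mul]
      ring
    · rw [if_neg hst, hZ' s t hst, zero_mul]

theorem Assignment.IsExtended.supp {γ : Assignment N} (h : γ.IsExtended) : γ.Supp := by
  intro i L hL
  have hi := h i
  cases hE : γ.val i with
  | unknown => rw [hE] at hL; exact hL.elim
  | mixed => rw [hE] at hL; exact hL.2
  | arr q =>
    rw [hE] at hL hi
    obtain ⟨⟨M, rfl, -, -, hM, -⟩, -⟩ := hi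
    exact hL.2.supportedOn hL.1 fun R hR _ => hM R hR

theorem Assignment.Models.good {γ : Assignment N} (hγ : γ.IsExtended) {ρ : Op (Fin N)}
    (hρ : IsPartialDensity ρ) (h : γ.Models ρ) : γ.Good ρ := by
  obtain ⟨h1, h2, h3⟩ := h
  refine ⟨h1.mem_sepCone, fun i L hL => ?_⟩
  have hi := hγ i
  cases hE : γ.val i with
  | unknown => rw [hE] at hL; exact hL.elim
  | mixed =>
    rw [hE] at hL hi
    obtain ⟨ρ', -, e⟩ := h3 i hE
    -- An element `I` occurs only on a one-qubit segment, so all its L-rows are Pauli matrices on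
    -- `i`.
    obtain ⟨j, hj⟩ := Finset.card_eq_one.1 hi
    have hij : i = j := by
      have := γ.mem_cell i
      rwa [hj, Finset.mem_singleton] at this
    refine commute_of_singles hL.1 fun k hk => ?_
    have hki : k = i := by
      by_contra hki
      exact hk (hL.2 k (by rw [hj, Finset.mem_singleton, ← hij]; exact hki))
    rw [rowOp_single, hki]
    exact commute_of_mixed e _
  | arr q =>
    rw [hE] at hL
    exact (projPlus_mul_projMinus_iff hL.1 hρ.1.isHermitian).1 (h2 i q hE L hL.2 hL.1)

theorem Assignment.Good.models {γ : Assignment N} {ρ : Op (Fin N)} (h : γ.Good ρ)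
    (hρ : IsPartialDensity ρ) : γ.Models ρ :=
  ⟨γ.separable_of_mem_sepCone h.1 hρ.2,
    fun i q hE L hqL hL => (projPlus_mul_projMinus_iff hL hρ.1.isHermitian).2
      (h.2 i L (by rw [hE]; exact ⟨hL, hqL⟩)),
    fun _ hE => exists_mixed hρ (h.commute_mixed hE (by simp)) (h.commute_mixed hE (by simp))⟩

end ExtStab

end

theorem mainTheorem2 (N : ℕ)
    (rep : (Multiset (ExtStab.Row N) → Prop) → Multiset (ExtStab.Row N))
    (hrep : ExtStab.IsRepChoice rep)
    (ρ : Matrix (Fin N → Fin 2) (Fin N → Fin 2) ℂ) (hρ : ExtStab.IsPartialDensity ρ)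
    (γ : ExtStab.Assignment N) (hγ : γ.IsExtended) (C : ExtStab.QIL N)
    (h : γ.Models ρ) :
    (ExtStab.QIL.semE rep C γ).Models (C.sem ρ) := by
  exact (C.sound hrep γ ρ hρ hγ.supp (h.good hγ hρ)).2.models (hρ.sem C)
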